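/- **Notation.** For an integer $N\ge 2$, $\omega_{N-1}$ is the area of the unit sphere in $\mathbb R^N$ and $B_1^N$ is the open unit ball of $\mathbb R^N$. For a domain $\Omega\subset\mathbb R^N$, $\dot W^{1,p}_0(\Omega)$ is the completion of $C_c^\infty(\Omega)$ with respect to $\|\nabla(\cdot)\|_{L^p(\Omega)}$, realised as a space of functions $u$ with weak gradient $\nabla u$; $\dot W^{1,p}_{0,\mathrm{rad}}(\Omega)$ is the set of its radially symmetric elements. For $1<p<N$ put $p^*=\frac{Np}{N-p}$. For $1<p<\infty$, call $v:[0,\infty)\to\mathbb R$ *$p$-admissible* if it is absolutely continuous on every $[0,R]$, $v(0)=0$ and $v'\in L^p(0,\infty)$. **Proposition (Bliss).** (1) (Bliss inequality.) Let $1<p<q$. For every $p$-admissible $v$, $$C(p,q)\Big(\int_0^\infty \frac{|v(t)|^q}{t^{1+q\frac{p-1}{p}}}\,dt\Big)^{1/q}\le\Big(\int_0^\infty|v'(t)|^p\,dt\Big)^{1/p},\qquad C(p,q)=\left(\frac{\Gamma(\frac{q}{q-p})\Gamma(\frac{p(q-1)}{q-p})}{\Gamma(\frac{pq}{q-p})}\right)^{\frac1p-\frac1q}\Big(\frac{q(p-1)}{p}\Big)^{\frac1q}.$$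 This inequality yields, by changes of variables, the best Sobolev inequality and the generalized critical Hardy inequality for radial functions, in the following sense. (2) (Sobolev inequality.) Let $1<p<N$. For every $u\in\dot W^{1,p}_{0,\mathrm{rad}}(\mathbb R^N)$ there is a $p$-admissible $v$ with $$u(x)=v\Big(\tfrac{p-1}{N-p}\,\omega_{N-1}^{-\frac1{p-1}}|x|^{-\frac{N-p}{p-1}}\Big)\quad\text{for a.e. }x\in\mathbb R^N,\qquad \int_{\mathbb R^N}|\nabla u|^p\,dx=\int_0^\infty|v'(t)|^p\,dt,$$ $$\int_{\mathbb R^N}|u|^{p^*}dx=\omega_{N-1}^{-\frac{p}{N-p}}\Big(\frac{p-1}{N-p}\Big)^{\frac{p(N-1)}{N-p}}\int_0^\infty\frac{|v(t)|^{p^*}}{t^{1+p^*\frac{p-1}{p}}}\,dt .$$ Moreover the constant $$S_{N,p}=\pi^{\frac p2}N\Big(\frac{N-p}{p-1}\Big)^{p-1}\left(\frac{\Gamma(\frac Np)\Gamma(1+N-\frac Np)}{\Gamma(1+\frac N2)\Gamma(N)}\right)^{\frac pN}$$ is the largest real number $S$ such that $$S\Big(\int_{\mathbb R^N}|u|^{p^*}dx\Big)^{\frac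 p{p^*}}\le\int_{\mathbb R^N}|\nabla u|^p\,dx\qquad\text{for all }u\in\dot W^{1,p}_{0,\mathrm{rad}}(\mathbb R^N).$$ (3) (Generalized critical Hardy inequality.) Let $N\ge2$. For every $u\in\dot W^{1,N}_{0,\mathrm{rad}}(B_1^N)$ there is an $N$-admissible $v$ with $u(x)=v\big(\omega_{N-1}^{-\frac1{N-1}}\log\frac1{|x|}\big)$ for a.e. $x\in B_1^N$, $\int_{B_1^N}|\nabla u|^N\,dx=\int_0^\infty|v'(t)|^N\,dt$ and, for every $q>N$ (both sides may be $+\infty$ a priori), $$\int_{B_1^N}\frac{|u(x)|^q}{|x|^N(\log\frac1{|x|})^{1+q\frac{N-1}N}}\,dx=\omega_{N-1}^{1-\frac qN}\int_0^\infty\frac{|v(t)|^q}{t^{1+q\frac{N-1}N}}\,dt .$$ Moreover, for every $q>N$ and every $u\in\dot W^{1,N}_{0,\mathrm{rad}}(B_1^N)$, $$C(q)\Big(\int_{B_1^N}\frac{|u(x)|^q}{|x|^N(\log\frac1{|x|})^{1+q\frac{N-1}N}}\,dx\Big)^{\frac Nq}\le\int_{B_1^N}|\nabla u|^N\,dx,$$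 $$C(q)=\omega_{N-1}^{1-\frac Nq}\left(\frac{\Gamma(\frac q{q-N})\Gamma(\frac{N(q-1)}{q-N})}{\Gamma(\frac{Nq}{q-N})}\right)^{1-\frac Nq}\Big(\frac{q(N-1)}N\Big)^{\frac Nq}.$$ (4) (Limit.) $\lim_{q\to N+0}C(q)=\big(\frac{N-1}N\big)^N$, and for every $u\in\dot W^{1,N}_{0,\mathrm{rad}}(B_1^N)$ the critical Hardy inequality holds: $$\Big(\frac{N-1}N\Big)^N\int_{B_1^N}\frac{|u(x)|^N}{|x|^N(\log\frac1{|x|})^N}\,dx\le\int_{B_1^N}|\nabla u|^N\,dx .$$ -/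

import Mathlib

open MeasureTheory Set Filter Topology
open scoped ENNReal ContDiff

noncomputable section

namespace BlissHardy

/-- The Euclidean space of dimension `N`. -/
abbrev E (N : ℕ) : Type := EuclideanSpace ℝ (Fin N)

/-- `ω_{N-1}`: the area of the unit sphere of `ℝ^N`. -/
def sphereArea (N : ℕ) : ℝ :=
  ((volume : Measure (E N)).toSphere univ).toReal

/-- The unit ball `B_1^N`. -/
def unitBall (N : ℕ) : Set (E N) := Metric.ball 0 1

/-! ### The one-dimensional setting -/

/-- `v : [0, ∞) → ℝ` is (locally) absolutely continuous, `v 0 = 0` and `v' ∈ L^p(0, ∞)`.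
Only the values of `v` on `[0, ∞)` matter. -/
structure BlissAdmissible (p : ℝ) (v : ℝ → ℝ) : Prop where
  absCont : ∀ R : ℝ, 0 ≤ R → AbsolutelyContinuousOnInterval v 0 R
  map_zero : v 0 = 0
  deriv_memLp : MemLp (deriv v) (ENNReal.ofReal p) (volume.restrict (Ioi (0 : ℝ)))

/-- `∫_0^∞ |v'(t)|^p dt`, as an element of `[0, ∞]`. -/
def blissEnergy (p : ℝ) (v : ℝ → ℝ) : ℝ≥0∞ :=
  ∫⁻ t in Ioi (0 : ℝ), ENNReal.ofReal (|deriv v t| ^ p)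

/-- `∫_0^∞ |v(t)|^q / t^{1 + q (p-1)/p} dt`, as an element of `[0, ∞]`. -/
def blissMass (p q : ℝ) (v : ℝ → ℝ) : ℝ≥0∞ :=
  ∫⁻ t in Ioi (0 : ℝ), ENNReal.ofReal (|v t| ^ q / t ^ (1 + q * ((p - 1) / p)))

/-- The constant `C(p, q)` in the Bliss inequality. -/
def blissConst (p q : ℝ) : ℝ :=
  (Real.Gamma (q / (q - p)) * Real.Gamma (p * (q - 1) / (q - p)) /
      Real.Gamma (p * q / (q - p))) ^ (1 / p - 1 / q) *
    (q * (p - 1) / p) ^ (1 / q)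

/-- The Bliss inequality for the function `v` and the exponents `p`, `q`. -/
def BlissInequality (p q : ℝ) (v : ℝ → ℝ) : Prop :=
  ENNReal.ofReal (blissConst p q) * blissMass p q v ^ (1 / q) ≤ blissEnergy p v ^ (1 / p)

/-! ### Homogeneous Sobolev spaces -/

/-- `φ ∈ C_c^∞(Ω)`. -/
structure IsTestFunction {N : ℕ} (Ω : Set (E N)) (φ : E N → ℝ) : Prop where
  smooth : ContDiff ℝ ∞ φ
  compactSupport : HasCompactSupport φ
  support_subset : tsupport φ ⊆ Ω

/-- `u` belongs to the homogeneous Sobolev space `Ẇ_0^{1,p}(Ω)`, the completion of `C_c^∞(Ω)` for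
the norm `‖∇ ·‖_{L^p(Ω)}`, and `G` is its (weak) gradient.

An element of the completion is realised as a function in the usual way: there are
`φ n ∈ C_c^∞(Ω)` with `∇ φ n → G` in `L^p(Ω)` and `φ n → u` in `L^1_loc(Ω)`. In particular `G` is
the distributional gradient of `u` on `Ω`, so it is determined by `u` almost everywhere. The
convergence in `L^1_loc` follows from the convergence of the gradients (by the Sobolev or the
Poincaré inequality) when `1 < p < N`, and for every `p` when `Ω` is bounded, so that in these
cases this is exactly the completion. -/
structure MemHomSobolev {N : ℕ} (p : ℝ) (Ω : Set (E N)) (u : E N → ℝ) (G : E N → E N) :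
    Prop where
  locallyIntegrableOn : LocallyIntegrableOn u Ω
  gradient_memLp : MemLp G (ENNReal.ofReal p) (volume.restrict Ω)
  approx : ∃ φ : ℕ → E N → ℝ, (∀ n, IsTestFunction Ω (φ n)) ∧
    Tendsto (fun n => eLpNorm (fun x => gradient (φ n) x - G x) (ENNReal.ofReal p)
      (volume.restrict Ω)) atTop (𝓝 0) ∧
    ∀ K : Set (E N), K ⊆ Ω → IsCompact K →
      Tendsto (fun n => ∫⁻ x in K, ENNReal.ofReal |φ n x - u x|) atTop (𝓝 0)

/-- `u` is radially symmetric on `Ω` (up to a null set). -/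
def IsRadialOn {N : ℕ} (Ω : Set (E N)) (u : E N → ℝ) : Prop :=
  ∃ f : ℝ → ℝ, ∀ᵐ x ∂(volume.restrict Ω), u x = f ‖x‖

/-- `u ∈ Ẇ_{0,rad}^{1,p}(Ω)` with gradient `G`. -/
def MemHomSobolevRad {N : ℕ} (p : ℝ) (Ω : Set (E N)) (u : E N → ℝ) (G : E N → E N) : Prop :=
  MemHomSobolev p Ω u G ∧ IsRadialOn Ω u

/-- `∫_Ω |∇u|^p dx`, where `G = ∇u`, as an element of `[0, ∞]`. -/
def gradEnergy {N : ℕ} (p : ℝ) (Ω : Set (E N)) (G : E N → E N) : ℝ≥0∞ :=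
  ∫⁻ x in Ω, ENNReal.ofReal (‖G x‖ ^ p)

/-! ### The Sobolev inequality -/

/-- The critical exponent `p^* = N p / (N - p)`. -/
def critExp (N : ℕ) (p : ℝ) : ℝ := N * p / (N - p)

/-- `∫_{ℝ^N} |u|^{p^*} dx`, as an element of `[0, ∞]`. -/
def sobolevMass {N : ℕ} (p : ℝ) (u : E N → ℝ) : ℝ≥0∞ :=
  ∫⁻ x, ENNReal.ofReal (|u x| ^ critExp N p)

/-- The constant `S_{N,p}`. -/
def sobolevConst (N : ℕ) (p : ℝ) : ℝ :=
  Real.pi ^ (p / 2) * N * ((N - p) / (p - 1)) ^ (p - 1) *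
    (Real.Gamma (N / p) * Real.Gamma (1 + N - N / p) /
      (Real.Gamma (1 + (N : ℝ) / 2) * Real.Gamma N)) ^ (p / N)

/-- The change of variables `t = (p-1)/(N-p) ω_{N-1}^{-1/(p-1)} r^{-(N-p)/(p-1)}`. -/
def sobolevVar (N : ℕ) (p r : ℝ) : ℝ :=
  (p - 1) / (N - p) * sphereArea N ^ (-(1 / (p - 1))) * r ^ (-((N - p) / (p - 1)))

/-- The Jacobian factor relating `∫ |u|^{p^*} dx` and the integral of `|v|^{p^*}` in the Bliss
inequality under the change of variables `sobolevVar`. -/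
def sobolevFactor (N : ℕ) (p : ℝ) : ℝ :=
  sphereArea N ^ (-(p / (N - p))) * ((p - 1) / (N - p)) ^ (p * (N - 1) / (N - p))

/-! ### The critical Hardy inequalities -/

/-- `∫_{B_1} |u|^q / (|x|^N (log 1/|x|)^{1 + q (N-1)/N}) dx`, as an element of `[0, ∞]`. -/
def critHardyMass {N : ℕ} (q : ℝ) (u : E N → ℝ) : ℝ≥0∞ :=
  ∫⁻ x in unitBall N, ENNReal.ofReal
    (|u x| ^ q / (‖x‖ ^ N * Real.log (1 / ‖x‖) ^ (1 + q * (((N : ℝ) - 1) / N))))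

/-- The constant `C(q)` of the generalized critical Hardy inequality. -/
def critHardyConst (N : ℕ) (q : ℝ) : ℝ :=
  sphereArea N ^ (1 - N / q) *
    (Real.Gamma (q / (q - N)) * Real.Gamma (N * (q - 1) / (q - N)) /
      Real.Gamma (N * q / (q - N))) ^ (1 - N / q) *
    (q * (N - 1) / N) ^ (N / q)

/-- The change of variables `t = ω_{N-1}^{-1/(N-1)} log (1/r)`. -/
def moserVar (N : ℕ) (r : ℝ) : ℝ :=
  sphereArea N ^ (-(1 / ((N : ℝ) - 1))) * Real.log (1 / r)

end BlissHardy

end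

noncomputable section

namespace BlissHardy

/-! ### The extremal densities and the Beta integral -/

/-! The Bliss inequality is proved by transporting mass onto the extremal function `t (1 +
t^r)^(-1/r)`, where `r = (q - p)/p`. Put `c = (p - 1)/p` and `κ = 1 + qc`, so that `κ + r = q`. Let
`V` be the primitive of a positive continuous `g`, scaled so that its mass on `[0, R]` is the whole
extremal mass. Let `T(t)` be the point up to which the extremal function carries the mass that `V`
carries on `[0, t]`. The quantity `V^κ t^(-κc) T^(-rc)`, plus `rc` times the extremal energy up to
`T`, plus `qc` times the mass up to `t`, minus `κ/p` times the energy of `V` up to `t`, is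
nonincreasing. This follows from Young's inequality for `g` and a weighted AM-GM inequality for `t
T'/T` (`bliss_pointwise`). The quantity has limit at most `0` as `t` tends to `0`, hence is
nonpositive, and letting `t` tend to `R` gives the sharp energy bound
(`extremalEnergy_le_of_mass_eq`). Beta integrals evaluate the extremal mass and energy. Homogeneity,
density in `L^p`, Fatou's lemma and `|v(t)| ≤ ∫_0^t |v'|` then give every admissible `v`.

For radial Sobolev functions the work lies in producing `v`. In polar coordinates the approximating
test functions converge, along almost every ray, well enough to make `u` minus the integral of its
radial derivative over the rest of the ray (`MemHomSobolev.ae_ray`). Since `u` is radial, a single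
good ray supplies a profile `g`. Uniqueness of weak gradients away from the origin then forces the
gradient to be `g(|x|) x/|x|` (`MemHomSobolevRad.exists_profile`). A decreasing variable `t =
θ(|x|)` with `θ' = -(ω r^(N-1))^(-1/(p-1))` preserves the energy exactly. It is a negative power of
`|x|` when `p < N` and a logarithm when `p = N`. The mass is only multiplied by a constant, so both
inequalities on radial functions are the Bliss inequality rewritten.

The Sobolev constant is sharp because the extremal profile is a pointwise limit of test functions,
obtained by cutting off its radial derivative, whose energies do not exceed the extremal energy
(`le_sobolevConst`). The limit `q → N` rests on a first-order Stirling estimate: the logarithmic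
divergences of the three Gamma factors cancel. Fatou's lemma along a sequence of exponents then
yields the critical Hardy inequality. -/

theorem hasDerivAt_rpow_div_one_add_rpow (r : ℝ) {s : ℝ} (hs : 0 < s) :
    HasDerivAt (fun s : ℝ => s ^ r / (1 + s ^ r)) (r * s ^ (r - 1) / (1 + s ^ r) ^ 2) s := by
  have h1 : HasDerivAt (fun s : ℝ => s ^ r) (r * s ^ (r - 1)) s :=
    Real.hasDerivAt_rpow_const (Or.inl hs.ne')
  exact (h1.div (h1.const_add 1) (by positivity)).congr_deriv (by ring)

theorem image_rpow_div_one_add_rpow {r : ℝ} (hr : 0 < r) :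
    (fun s : ℝ => s ^ r / (1 + s ^ r)) '' Ioi 0 = Ioo 0 1 := by
  ext y
  constructor
  · rintro ⟨s, hs, rfl⟩
    have : 0 < s ^ r := Real.rpow_pos_of_pos hs r
    exact ⟨by positivity, by rw [div_lt_one (by positivity)]; linarith⟩
  · rintro ⟨h0, h1⟩
    have h1' : 0 < 1 - y := by linarith
    refine ⟨(y / (1 - y)) ^ (1 / r), Real.rpow_pos_of_pos (by positivity) _, ?_⟩
    have : ((y / (1 - y)) ^ (1 / r)) ^ r = y / (1 - y) := by
      rw [← Real.rpow_mul (by positivity), one_div_mul_cancel hr.ne', Real.rpow_one]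
    simp only [this]
    field_simp
    ring

theorem injOn_rpow_div_one_add_rpow {r : ℝ} (hr : 0 < r) :
    InjOn (fun s : ℝ => s ^ r / (1 + s ^ r)) (Ioi 0) := by
  intro s hs t ht h
  have h1 : 0 < s ^ r := Real.rpow_pos_of_pos hs r
  have h2 : 0 < t ^ r := Real.rpow_pos_of_pos ht r
  have h3 : s ^ r = t ^ r := by
    simp only at h
    rw [div_eq_div_iff (by positivity) (by positivity)] at h
    linarith
  exact (Real.rpow_left_inj (le_of_lt hs) (le_of_lt ht) hr.ne').1 h3

/-- The substitution `x = s^r / (1 + s^r)` maps `(0, ∞)` onto `(0, 1)`. The formula is then the fact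
that the Beta density has total mass one. -/
theorem lintegral_rpow_mul_one_add_rpow {r a b : ℝ} (hr : 0 < r) (ha : 0 < a) (hb : 0 < b) :
    ∫⁻ s in Ioi (0 : ℝ), ENNReal.ofReal (s ^ (r * a - 1) * (1 + s ^ r) ^ (-(a + b))) =
      ENNReal.ofReal (1 / r * ProbabilityTheory.beta a b) := by
  have hB := ProbabilityTheory.beta_pos ha hb
  have h1 := ProbabilityTheory.lintegral_betaPDF_eq_one ha hb
  rw [ProbabilityTheory.lintegral_betaPDF, ← image_rpow_div_one_add_rpow hr,
    lintegral_image_eq_lintegral_abs_deriv_mul measurableSet_Ioi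
      (fun x hx => (hasDerivAt_rpow_div_one_add_rpow r hx).hasDerivWithinAt)
      (injOn_rpow_div_one_add_rpow hr)] at h1
  have h2 : ∫⁻ s in Ioi (0 : ℝ), ENNReal.ofReal (r / ProbabilityTheory.beta a b) *
      ENNReal.ofReal (s ^ (r * a - 1) * (1 + s ^ r) ^ (-(a + b))) = 1 := by
    rw [← h1]
    refine setLIntegral_congr_fun measurableSet_Ioi fun s hs => ?_
    have hs' : 0 < s := hs
    have hx : 0 < s ^ r := Real.rpow_pos_of_pos hs r
    have hy : 0 < 1 + s ^ r := by positivity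
    rw [← ENNReal.ofReal_mul (by positivity), ← ENNReal.ofReal_mul (abs_nonneg _)]
    congr 1
    have e1 : 1 - s ^ r / (1 + s ^ r) = (1 + s ^ r)⁻¹ := by field_simp; ring
    rw [abs_of_nonneg (by positivity), e1, Real.div_rpow hx.le hy.le, ← Real.rpow_mul hs'.le,
      Real.inv_rpow hy.le, ← Real.rpow_natCast (1 + s ^ r) 2]
    have e2 : s ^ (r * a - 1) = s ^ (r - 1) * s ^ (r * (a - 1)) := by
      rw [← Real.rpow_add hs']; congr 1; ring
    have e3 : (1 + s ^ r) ^ (-(a + b)) = ((1 + s ^ r) ^ ((2 : ℕ) : ℝ))⁻¹ *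
        ((1 + s ^ r) ^ (a - 1))⁻¹ * ((1 + s ^ r) ^ (b - 1))⁻¹ := by
      rw [← Real.rpow_neg hy.le, ← Real.rpow_neg hy.le, ← Real.rpow_neg hy.le,
        ← Real.rpow_add hy, ← Real.rpow_add hy]
      congr 1; push_cast; ring
    rw [e2, e3]
    field_simp
  rw [lintegral_const_mul' _ _ ENNReal.ofReal_ne_top] at h2
  rw [show 1 / r * ProbabilityTheory.beta a b = (r / ProbabilityTheory.beta a b)⁻¹ by
    rw [inv_div]; ring]
  rw [ENNReal.ofReal_inv_of_pos (by positivity)]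
  exact ENNReal.eq_inv_of_mul_eq_one_left (by rw [mul_comm]; exact h2)

/-- The derivative of the extremal function of the Bliss inequality, to the power `p`. -/
def extremalEnergyDensity (p q s : ℝ) : ℝ :=
  (1 + s ^ ((q - p) / p)) ^ (-(q / ((q - p) / p)))

/-- The integrand of `blissMass` at the extremal function of the Bliss inequality. -/
def extremalMassDensity (p q s : ℝ) : ℝ :=
  s ^ ((q - p) / p) * (1 + s ^ ((q - p) / p)) ^ (-(q / ((q - p) / p)))

/-- The energy of the extremal function of the Bliss inequality. -/
def extremalEnergy (p q : ℝ) : ℝ :=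
  Real.Gamma (q / (q - p)) * Real.Gamma (p * (q - 1) / (q - p)) / Real.Gamma (p * q / (q - p))

/-- The mass of the extremal function of the Bliss inequality. -/
def extremalMass (p q : ℝ) : ℝ := p / (q * (p - 1)) * extremalEnergy p q

section

variable {p q : ℝ}

theorem extremalEnergy_pos (hp : 1 < p) (hpq : p < q) : 0 < extremalEnergy p q := by
  have h1 : 0 < q - p := by linarith
  have h2 : 0 < q - 1 := by linarith
  have h3 : 0 < p := by linarith
  have h4 : 0 < q := by linarith
  exact div_pos (mul_pos (Real.Gamma_pos_of_pos (by positivity))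
    (Real.Gamma_pos_of_pos (by positivity))) (Real.Gamma_pos_of_pos (by positivity))

theorem extremalMass_pos (hp : 1 < p) (hpq : p < q) : 0 < extremalMass p q := by
  have h2 : 0 < p - 1 := by linarith
  have h3 : 0 < p := by linarith
  have h4 : 0 < q := by linarith
  have := extremalEnergy_pos hp hpq
  unfold extremalMass
  positivity

/-- The Beta integral with `a = p/(q - p)`: then `ra = 1`, no power of `s` stands in front, and `Γ(a
+ 1) = a Γ(a)` absorbs the factor `1/r = a`. -/
theorem lintegral_extremalEnergyDensity (hp : 1 < p) (hpq : p < q) :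
    ∫⁻ s in Ioi (0 : ℝ), ENNReal.ofReal (extremalEnergyDensity p q s) =
      ENNReal.ofReal (extremalEnergy p q) := by
  have h1 : 0 < q - p := by linarith
  have h2 : 0 < q - 1 := by linarith
  have h3 : 0 < p := by linarith
  have h4 : 0 < q := by linarith
  have := lintegral_rpow_mul_one_add_rpow (r := (q - p) / p) (a := p / (q - p))
    (b := p * (q - 1) / (q - p)) (by positivity) (by positivity) (by positivity)
  convert this using 2
  · funext s
    rw [show (q - p) / p * (p / (q - p)) - 1 = 0 by field_simp; ring, Real.rpow_zero, one_mul]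
    unfold extremalEnergyDensity
    congr 3
    field_simp
    ring
  · unfold extremalEnergy ProbabilityTheory.beta
    rw [show q / (q - p) = p / (q - p) + 1 by field_simp; ring,
      Real.Gamma_add_one (by positivity),
      show p / (q - p) + p * (q - 1) / (q - p) = p * q / (q - p) by field_simp; ring]
    field_simp

/-- The Beta integral with `a = q/(q - p)` and `b = q(p - 1)/(q - p)`. The relation `Γ(b + 1) = b
Γ(b)` produces the ratio `p/(q(p - 1))` between mass and energy. -/
theorem lintegral_extremalMassDensity (hp : 1 < p) (hpq : p < q) :
    ∫⁻ s in Ioi (0 : ℝ), ENNReal.ofReal (extremalMassDensity p q s) =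
      ENNReal.ofReal (extremalMass p q) := by
  have h1 : 0 < q - p := by linarith
  have h2 : 0 < p - 1 := by linarith
  have h3 : 0 < p := by linarith
  have h4 : 0 < q := by linarith
  have := lintegral_rpow_mul_one_add_rpow (r := (q - p) / p) (a := q / (q - p))
    (b := q * (p - 1) / (q - p)) (by positivity) (by positivity) (by positivity)
  convert this using 2
  · funext s
    unfold extremalMassDensity
    congr 3
    · field_simp
    · field_simp
      ring
  · unfold extremalMass extremalEnergy ProbabilityTheory.beta
    rw [show p * (q - 1) / (q - p) = q * (p - 1) / (q - p) + 1 by field_simp; ring,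
      Real.Gamma_add_one (by positivity),
      show q / (q - p) + q * (p - 1) / (q - p) = p * q / (q - p) by field_simp; ring]
    field_simp

theorem extremalEnergyDensity_pos {s : ℝ} (hs : 0 ≤ s) : 0 < extremalEnergyDensity p q s :=
  Real.rpow_pos_of_pos (by have := Real.rpow_nonneg hs ((q - p) / p); linarith) _

theorem extremalMassDensity_eq (s : ℝ) :
    extremalMassDensity p q s = s ^ ((q - p) / p) * extremalEnergyDensity p q s := rfl

theorem extremalMassDensity_pos {s : ℝ} (hs : 0 < s) : 0 < extremalMassDensity p q s :=
  mul_pos (Real.rpow_pos_of_pos hs _) (extremalEnergyDensity_pos hs.le)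

theorem continuousOn_extremalEnergyDensity (hp : 1 < p) (hpq : p < q) :
    ContinuousOn (extremalEnergyDensity p q) (Ici 0) := by
  have hr : 0 < (q - p) / p := div_pos (by linarith) (by linarith)
  refine ContinuousOn.rpow_const (continuousOn_const.add
    (Real.continuous_rpow_const hr.le).continuousOn) fun s hs => Or.inl ?_
  have := Real.rpow_nonneg (show (0 : ℝ) ≤ s from hs) ((q - p) / p)
  positivity

theorem continuousOn_extremalMassDensity (hp : 1 < p) (hpq : p < q) :
    ContinuousOn (extremalMassDensity p q) (Ici 0) := by
  have hr : 0 < (q - p) / p := div_pos (by linarith) (by linarith)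
  exact (Real.continuous_rpow_const hr.le).continuousOn.mul
    (continuousOn_extremalEnergyDensity hp hpq)

theorem integrableOn_of_lintegral_eq_ofReal {f : ℝ → ℝ} {c : ℝ} (hf : ContinuousOn f (Ici 0))
    (h0 : ∀ s, 0 < s → 0 < f s)
    (h : ∫⁻ s in Ioi (0 : ℝ), ENNReal.ofReal (f s) = ENNReal.ofReal c) :
    IntegrableOn f (Ioi 0) := by
  refine ⟨(hf.mono Ioi_subset_Ici_self).aestronglyMeasurable measurableSet_Ioi, ?_⟩
  rw [hasFiniteIntegral_iff_ofReal]
  · rw [h]; exact ENNReal.ofReal_lt_top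
  · filter_upwards [ae_restrict_mem measurableSet_Ioi] with s hs
    exact (h0 s hs).le

theorem integral_Ioi_of_lintegral_eq_ofReal {f : ℝ → ℝ} {c : ℝ} (hf : ContinuousOn f (Ici 0))
    (h0 : ∀ s, 0 < s → 0 < f s) (hc : 0 ≤ c)
    (h : ∫⁻ s in Ioi (0 : ℝ), ENNReal.ofReal (f s) = ENNReal.ofReal c) :
    ∫ s in Ioi (0 : ℝ), f s = c := by
  rw [integral_eq_lintegral_of_nonneg_ae, h, ENNReal.toReal_ofReal hc]
  · filter_upwards [ae_restrict_mem measurableSet_Ioi] with s hs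
    exact (h0 s hs).le
  · exact (hf.mono Ioi_subset_Ici_self).aestronglyMeasurable measurableSet_Ioi

end

/-! ### The sharp Bliss inequality for positive continuous derivatives -/

section

variable {p q : ℝ}

/-- The hypothesis `hD` is the differentiated transport equation, with `D = T'`. It makes the
geometric mean in the AM-GM step equal to the sum of the mass density and the transported extremal
energy density. -/
theorem bliss_amgm_identity (hp : 1 < p) (hpq : p < q) {V t T D : ℝ} (hV : 0 < V) (ht : 0 < t)
    (hT : 0 < T)
    (hD : D * extremalMassDensity p q T = V ^ q * t ^ (-(1 + q * ((p - 1) / p)))) :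
    V ^ (1 + q * ((p - 1) / p)) * t ^ (-((1 + q * ((p - 1) / p)) * ((p - 1) / p)) - 1) *
        T ^ (-((q - p) / p * ((p - 1) / p))) * (t * D / T) ^ ((q - p) / p / q) =
      V ^ q * t ^ (-(1 + q * ((p - 1) / p))) + D * extremalEnergyDensity p q T := by
  have h0 : 0 < p := by linarith
  have h1 : 0 < q := by linarith
  have h2 : 0 < q - p := by linarith
  have hTr : 0 < T ^ ((q - p) / p) := Real.rpow_pos_of_pos hT _
  have hB : 0 < 1 + T ^ ((q - p) / p) := by positivity
  have hE := extremalEnergyDensity_pos (p := p) (q := q) hT.le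
  have hM := extremalMassDensity_pos (p := p) (q := q) hT
  have hX : D * extremalEnergyDensity p q T =
      V ^ q * t ^ (-(1 + q * ((p - 1) / p))) * (T ^ ((q - p) / p))⁻¹ := by
    rw [← hD, extremalMassDensity_eq]; field_simp
  have hD' : D = V ^ q * t ^ (-(1 + q * ((p - 1) / p))) * (T ^ ((q - p) / p))⁻¹ *
      (1 + T ^ ((q - p) / p)) ^ (q / ((q - p) / p)) := by
    rw [← hX, extremalEnergyDensity, Real.rpow_neg hB.le]
    field_simp
  have hsum : V ^ q * t ^ (-(1 + q * ((p - 1) / p))) + D * extremalEnergyDensity p q T =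
      V ^ q * t ^ (-(1 + q * ((p - 1) / p))) * (T ^ ((q - p) / p))⁻¹ *
        (1 + T ^ ((q - p) / p)) := by
    rw [hX]; field_simp; ring
  rw [hsum, hD']
  -- Both sides are now monomials in `V`, `t`, `T` and `1 + T^r`. In logarithms, with `b` for that
  -- of `1 + T^r`, only an identity between exponents remains.
  obtain ⟨b, hb⟩ : ∃ b, 1 + T ^ ((q - p) / p) = Real.exp b := ⟨_, (Real.exp_log hB).symm⟩
  rw [hb]
  rw [← Real.exp_log hV, ← Real.exp_log hT, ← Real.exp_log ht]
  simp only [← Real.exp_mul, ← Real.exp_add, ← Real.exp_neg, ← Real.exp_sub]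
  congr 1
  field_simp
  ring

/-- This is the sign of the derivative of the monotone quantity: the first three terms come from the
product rule for `V^κ t^(-κc) T^(-rc)`. Young bounds the term containing `g` by `(κ/p) g^p + κcX`,
and AM-GM bounds the two negative terms by `-qc(J + X)`. Since `κ + r = q`, all multiples of `J` and
`X` cancel. -/
theorem bliss_pointwise (hp : 1 < p) (hpq : p < q) {V t T D g : ℝ} (hV : 0 < V) (ht : 0 < t)
    (hT : 0 < T) (hg : 0 < g)
    (hD : D * extremalMassDensity p q T = V ^ q * t ^ (-(1 + q * ((p - 1) / p)))) :
    (g * (1 + q * ((p - 1) / p)) * V ^ (q * ((p - 1) / p))) *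
          t ^ (-((1 + q * ((p - 1) / p)) * ((p - 1) / p))) * T ^ (-((q - p) / p * ((p - 1) / p))) +
        V ^ (1 + q * ((p - 1) / p)) * (-((1 + q * ((p - 1) / p)) * ((p - 1) / p)) *
          t ^ (-((1 + q * ((p - 1) / p)) * ((p - 1) / p)) - 1)) *
          T ^ (-((q - p) / p * ((p - 1) / p))) +
        V ^ (1 + q * ((p - 1) / p)) * t ^ (-((1 + q * ((p - 1) / p)) * ((p - 1) / p))) *
          (D * -((q - p) / p * ((p - 1) / p)) * T ^ (-((q - p) / p * ((p - 1) / p)) - 1)) +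
        (q - p) / p * ((p - 1) / p) * (extremalEnergyDensity p q T * D) +
        q * ((p - 1) / p) * (V ^ q * t ^ (-(1 + q * ((p - 1) / p)))) ≤
      (1 + q * ((p - 1) / p)) / p * g ^ p := by
  have hid := bliss_amgm_identity hp hpq hV ht hT hD
  have h0 : 0 < p := by linarith
  have h1 : 0 < q := by linarith
  have h2 : 0 < q - p := by linarith
  have h3 : 0 < p - 1 := by linarith
  have hM := extremalMassDensity_pos (p := p) (q := q) hT
  have hDpos : 0 < D := by
    rw [← eq_div_iff hM.ne'] at hD
    rw [hD]; positivity
  set c := (p - 1) / p with hc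
  have hcpos : 0 < c := by positivity
  set κ := 1 + q * c with hκ
  set r := (q - p) / p with hr
  have hrpos : 0 < r := by positivity
  have hκpos : 0 < κ := by positivity
  have hκr : κ + r = q := by rw [hκ, hr, hc]; field_simp; ring
  set X := extremalEnergyDensity p q T * D with hX
  have hX' : X = V ^ q * t ^ (-κ) * T ^ (-r) := by
    rw [← hD, extremalMassDensity_eq, Real.rpow_neg hT.le]
    have : T ^ r ≠ 0 := (Real.rpow_pos_of_pos hT r).ne'
    rw [← hr, hX]
    field_simp
  have hXpos : 0 < X := by rw [hX']; positivity
  set J := V ^ q * t ^ (-κ) with hJ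
  set Y := V ^ κ * t ^ (-(κ * c) - 1) * T ^ (-(r * c)) with hY
  have hYpos : 0 < Y := by positivity
  -- Equality holds when `t D = T`, in particular when the transport map is a dilation.
  have amgm : 1 ^ (κ / q) * (t * D / T) ^ (r / q) ≤ κ / q * 1 + r / q * (t * D / T) :=
    Real.geom_mean_le_arith_mean2_weighted (by positivity) (by positivity) zero_le_one
      (by positivity) (by rw [← add_div, hκr, div_self h1.ne'])
  rw [Real.one_rpow, one_mul] at amgm
  have amgm2 : q * (J + X) ≤ κ * Y + r * Y * (t * D / T) := by
    have := mul_le_mul_of_nonneg_left amgm (by positivity : 0 ≤ q * Y)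
    have e1 : q * Y * (t * D / T) ^ (r / q) = q * (J + X) := by
      rw [mul_assoc, hid, hX, mul_comm D]
    have e2 : q * Y * (κ / q * 1 + r / q * (t * D / T)) = κ * Y + r * Y * (t * D / T) := by
      field_simp
    linarith
  have hconj : p.HolderConjugate (p / (p - 1)) := Real.HolderConjugate.conjExponent hp
  have young := Real.young_inequality_of_nonneg hg.le (Real.rpow_nonneg hXpos.le c) hconj
  have e3 : (X ^ c) ^ (p / (p - 1)) / (p / (p - 1)) = c * X := by
    rw [← Real.rpow_mul hXpos.le, hc, div_mul_div_cancel₀ h0.ne', div_self h3.ne', Real.rpow_one]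
    field_simp
  rw [e3] at young
  have e4 : V ^ (q * c) * t ^ (-(κ * c)) * T ^ (-(r * c)) = X ^ c := by
    rw [hX', Real.mul_rpow (by positivity) (by positivity), hJ,
      Real.mul_rpow (by positivity) (by positivity), ← Real.rpow_mul hV.le, ← Real.rpow_mul ht.le,
      ← Real.rpow_mul hT.le]
    simp only [neg_mul]
  have e5 : V ^ κ * t ^ (-(κ * c)) * T ^ (-(r * c) - 1) = Y * (t / T) := by
    rw [hY, Real.rpow_sub_one hT.ne', Real.rpow_sub_one ht.ne']
    field_simp
  have e6 : g * κ * V ^ (q * c) * t ^ (-(κ * c)) * T ^ (-(r * c)) = κ * (g * X ^ c) := by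
    rw [← e4]; ring
  have e7 : V ^ κ * (-(κ * c) * t ^ (-(κ * c) - 1)) * T ^ (-(r * c)) = -(c * (κ * Y)) := by
    rw [hY]; ring
  have e8 : V ^ κ * t ^ (-(κ * c)) * (D * -(r * c) * T ^ (-(r * c) - 1)) =
      -(c * (r * Y * (t * D / T))) := by
    have : V ^ κ * t ^ (-(κ * c)) * (D * -(r * c) * T ^ (-(r * c) - 1)) =
      (V ^ κ * t ^ (-(κ * c)) * T ^ (-(r * c) - 1)) * (D * -(r * c)) := by ring
    rw [this, e5]; field_simp
  rw [e6, e7, e8]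
  have y2 := mul_le_mul_of_nonneg_left young hκpos.le
  have a2 := mul_le_mul_of_nonneg_left amgm2 hcpos.le
  have : κ * c * X + r * c * X = q * c * X := by rw [← hκr]; ring
  have e9 : κ * (g ^ p / p + c * X) = κ / p * g ^ p + κ * c * X := by ring
  nlinarith

/-- The mass of the extremal function on `[0, T]`. -/
def extremalMassTo (p q T : ℝ) : ℝ := ∫ s in (0 : ℝ)..T, extremalMassDensity p q s

/-- The energy of the extremal function on `[0, T]`. -/
def extremalEnergyTo (p q T : ℝ) : ℝ := ∫ s in (0 : ℝ)..T, extremalEnergyDensity p q s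

theorem intervalIntegrable_of_continuousOn_Ici {f : ℝ → ℝ} (hf : ContinuousOn f (Ici 0)) {a b : ℝ}
    (ha : 0 ≤ a) (hb : 0 ≤ b) : IntervalIntegrable f volume a b :=
  (hf.mono fun _ hx => le_trans (le_min ha hb) hx.1).intervalIntegrable

theorem hasDerivAt_integral_of_continuousOn_Ici {f : ℝ → ℝ} (hf : ContinuousOn f (Ici 0)) {T : ℝ}
    (hT : 0 < T) : HasDerivAt (fun T => ∫ s in (0 : ℝ)..T, f s) (f T) T :=
  intervalIntegral.integral_hasDerivAt_right
    (intervalIntegrable_of_continuousOn_Ici hf le_rfl hT.le)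
    ((hf.mono Ioi_subset_Ici_self).stronglyMeasurableAtFilter isOpen_Ioi T hT)
    (hf.continuousAt (Ici_mem_nhds hT))

theorem strictMonoOn_extremalMassTo (hp : 1 < p) (hpq : p < q) :
    StrictMonoOn (extremalMassTo p q) (Ici 0) := by
  intro a ha b hb hab
  have hc := continuousOn_extremalMassDensity hp hpq
  have h := intervalIntegral.integral_add_adjacent_intervals
    (intervalIntegrable_of_continuousOn_Ici hc le_rfl ha)
    (intervalIntegrable_of_continuousOn_Ici hc ha hb)
  have h2 : 0 < ∫ s in a..b, extremalMassDensity p q s :=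
    intervalIntegral.intervalIntegral_pos_of_pos_on
      (intervalIntegrable_of_continuousOn_Ici hc ha hb)
      (fun x hx => extremalMassDensity_pos (lt_of_le_of_lt ha hx.1)) hab
  unfold extremalMassTo
  linarith

theorem tendsto_extremalMassTo (hp : 1 < p) (hpq : p < q) :
    Tendsto (extremalMassTo p q) atTop (𝓝 (extremalMass p q)) := by
  rw [← integral_Ioi_of_lintegral_eq_ofReal (continuousOn_extremalMassDensity hp hpq)
    (fun s hs => extremalMassDensity_pos hs) (extremalMass_pos hp hpq).le
    (lintegral_extremalMassDensity hp hpq)]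
  exact intervalIntegral_tendsto_integral_Ioi 0 (integrableOn_of_lintegral_eq_ofReal
    (continuousOn_extremalMassDensity hp hpq) (fun s hs => extremalMassDensity_pos hs)
    (lintegral_extremalMassDensity hp hpq)) tendsto_id

theorem tendsto_extremalEnergyTo (hp : 1 < p) (hpq : p < q) :
    Tendsto (extremalEnergyTo p q) atTop (𝓝 (extremalEnergy p q)) := by
  rw [← integral_Ioi_of_lintegral_eq_ofReal (continuousOn_extremalEnergyDensity hp hpq)
    (fun s hs => extremalEnergyDensity_pos hs.le) (extremalEnergy_pos hp hpq).le
    (lintegral_extremalEnergyDensity hp hpq)]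
  exact intervalIntegral_tendsto_integral_Ioi 0 (integrableOn_of_lintegral_eq_ofReal
    (continuousOn_extremalEnergyDensity hp hpq) (fun s hs => extremalEnergyDensity_pos hs.le)
    (lintegral_extremalEnergyDensity hp hpq)) tendsto_id

theorem extremalMassTo_zero : extremalMassTo p q 0 = 0 := intervalIntegral.integral_same

theorem extremalMassTo_lt (hp : 1 < p) (hpq : p < q) {T : ℝ} (hT : 0 ≤ T) :
    extremalMassTo p q T < extremalMass p q := by
  have hm := strictMonoOn_extremalMassTo hp hpq
  have h1 : extremalMassTo p q T < extremalMassTo p q (T + 1) :=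
    hm hT (show (0 : ℝ) ≤ T + 1 by linarith) (by linarith)
  refine h1.trans_le (ge_of_tendsto (tendsto_extremalMassTo hp hpq) ?_)
  filter_upwards [eventually_ge_atTop (T + 1)] with S hS
  exact hm.monotoneOn (show (0 : ℝ) ≤ T + 1 by linarith) (show (0 : ℝ) ≤ S by linarith) hS

theorem exists_extremalMassTo_eq (hp : 1 < p) (hpq : p < q) {y : ℝ}
    (hy : y ∈ Ioo 0 (extremalMass p q)) : ∃ T, 0 < T ∧ extremalMassTo p q T = y := by
  obtain ⟨S, hS1, hS2⟩ := ((tendsto_extremalMassTo hp hpq).eventually (lt_mem_nhds hy.2)).and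
    (eventually_gt_atTop 0) |>.exists
  have hc : ContinuousOn (extremalMassTo p q) (Icc 0 S) := by
    have := intervalIntegral.continuousOn_primitive_interval (a := 0) (b := S)
      (f := extremalMassDensity p q) (μ := volume) (by
        rw [uIcc_of_le hS2.le]
        exact ((continuousOn_extremalMassDensity hp hpq).mono
          Icc_subset_Ici_self).integrableOn_compact isCompact_Icc)
    rwa [uIcc_of_le hS2.le] at this
  obtain ⟨T, hT1, hT2⟩ := intermediate_value_Icc hS2.le hc
    (show y ∈ Icc _ _ from ⟨by rw [extremalMassTo_zero]; exact hy.1.le, hS1.le⟩)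
  refine ⟨T, lt_of_le_of_ne hT1.1 ?_, hT2⟩
  rintro rfl
  rw [extremalMassTo_zero] at hT2
  exact hy.1.ne hT2

/-- The extremal mass has a differentiable inverse. -/
theorem exists_inverse_extremalMassTo (hp : 1 < p) (hpq : p < q) :
    ∃ S : ℝ → ℝ, ∀ y ∈ Ioo 0 (extremalMass p q), 0 < S y ∧ extremalMassTo p q (S y) = y ∧
      HasDerivAt S (extremalMassDensity p q (S y))⁻¹ y := by
  choose! S hS using fun y (hy : y ∈ Ioo 0 (extremalMass p q)) =>
    exists_extremalMassTo_eq hp hpq hy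
  have hm := strictMonoOn_extremalMassTo hp hpq
  refine ⟨S, fun y hy => ⟨(hS y hy).1, (hS y hy).2, ?_⟩⟩
  have hpos := (hS y hy).1
  refine HasDerivAt.of_local_left_inverse ?_
    (hasDerivAt_integral_of_continuousOn_Ici (continuousOn_extremalMassDensity hp hpq) hpos)
    (extremalMassDensity_pos hpos).ne' ?_
  · rw [ContinuousAt, tendsto_order]
    constructor
    · intro a ha
      -- Strict monotonicity is available on `[0, ∞)` only, so a possibly negative `a` is replaced
      -- by `max a 0`.
      have hlt : extremalMassTo p q (max a 0) < y := by
        rw [← (hS y hy).2]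
        exact hm (show (0 : ℝ) ≤ max a 0 from le_max_right _ _) hpos.le (max_lt ha hpos)
      filter_upwards [lt_mem_nhds hlt, Ioo_mem_nhds hy.1 hy.2] with z hz hz'
      rw [← (hS z hz').2, hm.lt_iff_lt (show (0 : ℝ) ≤ max a 0 from le_max_right _ _)
        (hS z hz').1.le] at hz
      exact (le_max_left _ _).trans_lt hz
    · intro a ha
      have hlt : y < extremalMassTo p q a := by
        rw [← (hS y hy).2]
        exact hm hpos.le (hpos.trans ha).le ha
      filter_upwards [gt_mem_nhds hlt, Ioo_mem_nhds hy.1 hy.2] with z hz hz'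
      rwa [← (hS z hz').2, hm.lt_iff_lt (hS z hz').1.le (hpos.trans ha).le] at hz
  · filter_upwards [Ioo_mem_nhds hy.1 hy.2] with z hz
    exact (hS z hz).2

/-- The energy density is at most one, so the mass density is at most `T^r` on `[0, T]`. This keeps
the transport map from being too small near `0`, where it enters with a negative exponent. -/
theorem extremalMassTo_le_rpow (hp : 1 < p) (hpq : p < q) {T : ℝ} (hT : 0 < T) :
    extremalMassTo p q T ≤ T ^ (q / p) := by
  have h0 : 0 < p := by linarith
  have hr : 0 < (q - p) / p := div_pos (by linarith) (by linarith)
  have : extremalMassTo p q T ≤ ∫ s in (0 : ℝ)..T, T ^ ((q - p) / p) := by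
    refine intervalIntegral.integral_mono_on hT.le (intervalIntegrable_of_continuousOn_Ici
      (continuousOn_extremalMassDensity hp hpq) le_rfl hT.le) (by simp) fun s hs => ?_
    rw [extremalMassDensity_eq]
    have h1 : extremalEnergyDensity p q s ≤ 1 := by
      refine Real.rpow_le_one_of_one_le_of_nonpos ?_ ?_
      · have := Real.rpow_nonneg hs.1 ((q - p) / p); linarith
      · have : 0 < q := by linarith
        rw [neg_nonpos]; positivity
    have h2 : s ^ ((q - p) / p) ≤ T ^ ((q - p) / p) := Real.rpow_le_rpow hs.1 hs.2 hr.le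
    calc _ ≤ s ^ ((q - p) / p) * 1 := by
          gcongr
          exact Real.rpow_nonneg hs.1 _
      _ ≤ _ := by rwa [mul_one]
  refine this.trans (le_of_eq ?_)
  rw [intervalIntegral.integral_const, sub_zero, smul_eq_mul, ← Real.rpow_one_add' hT.le]
  · congr 1; field_simp; ring
  · positivity

end

/-! ### The normalised sharp inequality on a finite interval. -/

section

variable {p q : ℝ}

theorem primitive_bounds {g : ℝ → ℝ} (hg : Continuous g) {R a b t : ℝ}
    (h : ∀ s ∈ Icc 0 R, a ≤ g s ∧ g s ≤ b) (ht : t ∈ Icc 0 R) :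
    a * t ≤ ∫ s in (0 : ℝ)..t, g s ∧ ∫ s in (0 : ℝ)..t, g s ≤ b * t := by
  have h1 := intervalIntegral.integral_mono_on (μ := volume) (f := fun _ => a) (g := g) ht.1 intervalIntegrable_const
    (hg.intervalIntegrable _ _) fun s hs => (h s ⟨hs.1, hs.2.trans ht.2⟩).1
  have h2 := intervalIntegral.integral_mono_on (μ := volume) (g := fun _ => b) (f := g) ht.1
    (hg.intervalIntegrable _ _) intervalIntegrable_const fun s hs => (h s ⟨hs.1, hs.2.trans ht.2⟩).2
  simp only [intervalIntegral.integral_const, sub_zero, smul_eq_mul] at h1 h2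
  constructor <;> linarith

theorem continuousOn_blissIntegrand {V : ℝ → ℝ} (hV : Continuous V) (hq : 0 < q) (k : ℝ) :
    ContinuousOn (fun s => V s ^ q * s ^ (-k)) (Ioi 0) :=
  (hV.continuousOn.rpow_const fun _ _ => Or.inr hq.le).mul
    (continuousOn_id.rpow_const fun _ hs => Or.inl (ne_of_gt hs))

/-- The linear bound on `V` beats the singular weight: since `q - κ = r > 0`, the integrand is at
most `b^q s^r`. -/
theorem intervalIntegrable_blissIntegrand (hp : 1 < p) (hpq : p < q) {V : ℝ → ℝ}
    (hV : Continuous V) {R b : ℝ} (hR : 0 < R)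
    (h : ∀ t ∈ Icc 0 R, 0 ≤ V t ∧ V t ≤ b * t) :
    IntervalIntegrable (fun s => V s ^ q * s ^ (-(1 + q * ((p - 1) / p)))) volume 0 R := by
  have h0 : 0 < p := by linarith
  have h1 : 0 < q := by linarith
  have hr : 0 < (q - p) / p := div_pos (by linarith) h0
  have hb : 0 ≤ b := by
    have := h R ⟨hR.le, le_rfl⟩
    exact nonneg_of_mul_nonneg_left (this.1.trans this.2) hR
  rw [intervalIntegrable_iff_integrableOn_Ioc_of_le hR.le]
  have hint : IntegrableOn (fun s : ℝ => b ^ q * s ^ ((q - p) / p)) (Ioc 0 R) := by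
    rw [← intervalIntegrable_iff_integrableOn_Ioc_of_le hR.le]
    exact (continuous_const.mul (Real.continuous_rpow_const hr.le)).intervalIntegrable _ _
  refine hint.mono' (((continuousOn_blissIntegrand hV h1 _).mono
    fun s hs => hs.1).aestronglyMeasurable measurableSet_Ioc) ?_
  filter_upwards [ae_restrict_mem measurableSet_Ioc] with s hs
  have hs0 : 0 < s := hs.1
  have hv := h s ⟨hs.1.le, hs.2⟩
  rw [Real.norm_of_nonneg (mul_nonneg (Real.rpow_nonneg hv.1 _) (Real.rpow_nonneg hs0.le _))]
  calc V s ^ q * s ^ (-(1 + q * ((p - 1) / p)))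
      ≤ (b * s) ^ q * s ^ (-(1 + q * ((p - 1) / p))) := by
        gcongr
        · exact hv.1
        · exact hv.2
    _ = b ^ q * s ^ ((q - p) / p) := by
        rw [Real.mul_rpow hb hs0.le, mul_assoc, ← Real.rpow_add hs0]
        congr 2; field_simp; ring

theorem extremalEnergyTo_le (hp : 1 < p) (hpq : p < q) {T : ℝ} (hT : 0 ≤ T) :
    extremalEnergyTo p q T ≤ T := by
  have h0 : 0 < p := by linarith
  have hr : 0 < (q - p) / p := div_pos (by linarith) (by linarith)
  have := intervalIntegral.integral_mono_on (g := fun _ => (1 : ℝ)) hT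
    (intervalIntegrable_of_continuousOn_Ici (continuousOn_extremalEnergyDensity hp hpq) le_rfl hT)
    (by simp) fun s hs => ?_
  · simpa using! this
  · refine Real.rpow_le_one_of_one_le_of_nonpos ?_ ?_
    · have := Real.rpow_nonneg hs.1 ((q - p) / p); linarith
    · have : 0 < q := by linarith
      rw [neg_nonpos]; positivity

/-- The Bliss inequality on `[0, R]` for positive continuous derivatives, when the mass is
normalised to be that of the extremal function. -/
theorem extremalEnergy_le_of_mass_eq (hp : 1 < p) (hpq : p < q) {g : ℝ → ℝ} (hg : Continuous g)
    (hpos : ∀ t, 0 < g t) {R : ℝ} (hR : 0 < R)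
    (hmass : ∫ t in (0 : ℝ)..R,
      (∫ s in (0 : ℝ)..t, g s) ^ q * t ^ (-(1 + q * ((p - 1) / p))) = extremalMass p q) :
    extremalEnergy p q ≤ ∫ t in (0 : ℝ)..R, g t ^ p := by
  have h0 : 0 < p := by linarith
  have h1 : 0 < q := by linarith
  have h2 : 0 < q - p := by linarith
  have h3 : 0 < p - 1 := by linarith
  obtain ⟨S, hS⟩ := exists_inverse_extremalMassTo hp hpq
  -- bounds for `g`
  obtain ⟨a, ha, hab⟩ : ∃ a, 0 < a ∧ ∀ s ∈ Icc 0 R, a ≤ g s := by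
    obtain ⟨x, hx, hx'⟩ := isCompact_Icc.exists_isMinOn (nonempty_Icc.2 hR.le) hg.continuousOn
    exact ⟨g x, hpos x, fun s hs => hx' hs⟩
  obtain ⟨b, hb⟩ : ∃ b, ∀ s ∈ Icc 0 R, g s ≤ b := by
    obtain ⟨x, hx, hx'⟩ := isCompact_Icc.exists_isMaxOn (nonempty_Icc.2 hR.le) hg.continuousOn
    exact ⟨g x, fun s hs => hx' hs⟩
  have hbpos : 0 < b := (hpos 0).trans_le (hb 0 ⟨le_rfl, hR.le⟩)
  set V : ℝ → ℝ := fun t => ∫ s in (0 : ℝ)..t, g s with hVdef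
  have hVd : ∀ t, HasDerivAt V (g t) t := fun t => hg.integral_hasStrictDerivAt 0 t |>.hasDerivAt
  have hVc : Continuous V := continuous_iff_continuousAt.2 fun t => (hVd t).continuousAt
  have hVb : ∀ t ∈ Icc 0 R, a * t ≤ V t ∧ V t ≤ b * t := fun t ht =>
    primitive_bounds hg (fun s hs => ⟨hab s hs, hb s hs⟩) ht
  have hVpos : ∀ t ∈ Ioo 0 R, 0 < V t := fun t ht =>
    (mul_pos ha ht.1).trans_le (hVb t ⟨ht.1.le, ht.2.le⟩).1
  set c := (p - 1) / p with hc
  have hcpos : 0 < c := by positivity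
  set κ := 1 + q * c with hκ
  have hκpos : 0 < κ := by positivity
  set f : ℝ → ℝ := fun s => V s ^ q * s ^ (-κ) with hf
  have hfpos : ∀ t ∈ Ioo 0 R, 0 < f t := fun t ht =>
    mul_pos (Real.rpow_pos_of_pos (hVpos t ht) _) (Real.rpow_pos_of_pos ht.1 _)
  have hfc : ContinuousOn f (Ioi 0) := continuousOn_blissIntegrand hVc h1 κ
  have hfi : IntervalIntegrable f volume 0 R :=
    intervalIntegrable_blissIntegrand hp hpq hVc hR fun t ht =>
      ⟨(mul_nonneg ha.le ht.1).trans (hVb t ht).1, (hVb t ht).2⟩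
  have hfi' : ∀ s ∈ Icc 0 R, ∀ t ∈ Icc 0 R, IntervalIntegrable f volume s t := fun s hs t ht =>
    hfi.mono_set (uIcc_subset_uIcc (by rwa [uIcc_of_le hR.le]) (by rwa [uIcc_of_le hR.le]))
  have h0mem : (0 : ℝ) ∈ Icc 0 R := ⟨le_rfl, hR.le⟩
  set j : ℝ → ℝ := fun t => ∫ s in (0 : ℝ)..t, f s with hj
  have hjR : j R = extremalMass p q := hmass
  have hjc : ContinuousOn j (Icc 0 R) := by
    have := intervalIntegral.continuousOn_primitive_interval (a := 0) (b := R) (f := f)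
      (μ := volume) (by
        rw [uIcc_of_le hR.le, integrableOn_Icc_iff_integrableOn_Ioc,
          ← intervalIntegrable_iff_integrableOn_Ioc_of_le hR.le]
        exact hfi)
    rwa [uIcc_of_le hR.le] at this
  have hjmono : StrictMonoOn j (Icc 0 R) := by
    intro s hs t ht hst
    have h := intervalIntegral.integral_add_adjacent_intervals (hfi' 0 h0mem s hs) (hfi' s hs t ht)
    have : 0 < ∫ x in s..t, f x := intervalIntegral.intervalIntegral_pos_of_pos_on
      (hfi' s hs t ht) (fun x hx => hfpos x ⟨hs.1.trans_lt hx.1, hx.2.trans_le ht.2⟩) hst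
    simp only [hj]
    linarith
  have hj0 : j 0 = 0 := intervalIntegral.integral_same
  have hjmem : ∀ t ∈ Ioo 0 R, j t ∈ Ioo 0 (extremalMass p q) := fun t ht =>
    ⟨by rw [← hj0]; exact hjmono h0mem ⟨ht.1.le, ht.2.le⟩ ht.1,
      by rw [← hjR]; exact hjmono ⟨ht.1.le, ht.2.le⟩ ⟨hR.le, le_rfl⟩ ht.2⟩
  have hjd : ∀ t ∈ Ioo 0 R, HasDerivAt j (f t) t := fun t ht =>
    intervalIntegral.integral_hasDerivAt_right (hfi' 0 h0mem t ⟨ht.1.le, ht.2.le⟩)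
      (hfc.stronglyMeasurableAtFilter isOpen_Ioi t ht.1) (hfc.continuousAt (Ioi_mem_nhds ht.1))
  -- The transport map: the extremal function has on `[0, T t]` the mass that `V` has on `[0, t]`.
  set T : ℝ → ℝ := fun t => S (j t) with hT
  have hTpos : ∀ t ∈ Ioo 0 R, 0 < T t := fun t ht => (hS _ (hjmem t ht)).1
  have hTj : ∀ t ∈ Ioo 0 R, extremalMassTo p q (T t) = j t := fun t ht => (hS _ (hjmem t ht)).2.1
  set D : ℝ → ℝ := fun t => (extremalMassDensity p q (T t))⁻¹ * f t with hD
  have hTd : ∀ t ∈ Ioo 0 R, HasDerivAt T (D t) t := fun t ht =>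
    (hS _ (hjmem t ht)).2.2.comp t (hjd t ht)
  have hDm : ∀ t ∈ Ioo 0 R, D t * extremalMassDensity p q (T t) = V t ^ q * t ^ (-κ) := by
    intro t ht
    have := (extremalMassDensity_pos (p := p) (q := q) (hTpos t ht)).ne'
    simp only [hD, hf]
    field_simp
  set r := (q - p) / p with hr
  have hrpos : 0 < r := by positivity
  set Φ : ℝ → ℝ := fun t => V t ^ κ * t ^ (-(κ * c)) * T t ^ (-(r * c)) with hΦ
  set W : ℝ → ℝ := fun t => ∫ s in (0 : ℝ)..t, g s ^ p with hW
  have hgp : Continuous fun s => g s ^ p := hg.rpow_const fun s => Or.inr h0.le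
  have hWd : ∀ t, HasDerivAt W (g t ^ p) t := fun t =>
    hgp.integral_hasStrictDerivAt 0 t |>.hasDerivAt
  have hWmono : ∀ s t, s ≤ t → W s ≤ W t := by
    intro s t hst
    have h := intervalIntegral.integral_add_adjacent_intervals
      (hgp.intervalIntegrable (μ := volume) 0 s) (hgp.intervalIntegrable s t)
    have : 0 ≤ ∫ x in s..t, g x ^ p :=
      intervalIntegral.integral_nonneg hst fun x _ => Real.rpow_nonneg (hpos x).le _
    simp only [hW]
    linarith
  have hW0 : W 0 = 0 := intervalIntegral.integral_same
  -- The coefficients `rc`, `qc` and `κ/p` are those for which the densities cancel in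
  -- `bliss_pointwise`.
  set Ψ : ℝ → ℝ := fun t =>
    Φ t + r * c * extremalEnergyTo p q (T t) + q * c * j t - κ / p * W t with hΨ
  have hΨd : ∀ t ∈ Ioo 0 R, ∃ d ≤ 0, HasDerivAt Ψ d t := by
    intro t ht
    have hVt := hVpos t ht
    have ht0 := ht.1
    have hTt := hTpos t ht
    have d1 := (hVd t).rpow_const (p := κ) (Or.inl hVt.ne')
    have d2 : HasDerivAt (fun s : ℝ => s ^ (-(κ * c))) (-(κ * c) * t ^ (-(κ * c) - 1)) t :=
      Real.hasDerivAt_rpow_const (Or.inl ht0.ne')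
    have d3 := (hTd t ht).rpow_const (p := -(r * c)) (Or.inl hTt.ne')
    have d4 := ((hasDerivAt_integral_of_continuousOn_Ici
      (continuousOn_extremalEnergyDensity hp hpq) hTt).comp t (hTd t ht)).const_mul (r * c)
    have d5 := (hjd t ht).const_mul (q * c)
    have d6 := (hWd t).const_mul (κ / p)
    have d := ((((d1.mul d2).mul d3).add d4).add d5).sub d6
    refine ⟨_, ?_, d⟩
    have key := bliss_pointwise hp hpq hVt ht0 hTt (hpos t) (hDm t ht)
    have e : κ - 1 = q * c := by rw [hκ]; ring
    rw [← hc, ← hr, ← hκ] at key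
    simp only [e, Pi.mul_apply, hf]
    linarith
  have hΨanti : ∀ s ∈ Ioo 0 R, ∀ t ∈ Ioo 0 R, s ≤ t → Ψ t ≤ Ψ s := by
    choose! d hd hd' using hΨd
    have : AntitoneOn Ψ (Ioo 0 R) := by
      refine antitoneOn_of_deriv_nonpos (convex_Ioo 0 R)
        (fun t ht => (hd' t ht).continuousAt.continuousWithinAt) ?_ ?_
      · rw [interior_Ioo]
        exact fun t ht => (hd' t ht).differentiableAt.differentiableWithinAt
      · rw [interior_Ioo]
        intro t ht
        rw [(hd' t ht).deriv]
        exact hd t ht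
    exact fun s hs t ht => this hs ht
  -- behaviour of `Ψ` at `0`
  obtain ⟨C, hC0, hC⟩ : ∃ C, 0 < C ∧ ∀ t ∈ Ioo 0 R, C * t ≤ T t := by
    -- From `V s ≥ a s` the transported mass is at least `a^q (p/q) t^(q/p)`, and it is at most
    -- `T(t)^(q/p)`. Taking the power `p/q` gives this constant.
    refine ⟨(a ^ q * (p / q)) ^ (p / q), by positivity, fun t ht => ?_⟩
    have ht0 := ht.1
    have htm : t ∈ Icc 0 R := ⟨ht.1.le, ht.2.le⟩
    have hl : a ^ q * (p / q) * t ^ (q / p) ≤ j t := by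
      have hint : ∫ s in (0 : ℝ)..t, a ^ q * s ^ r = a ^ q * (p / q) * t ^ (q / p) := by
        rw [intervalIntegral.integral_const_mul, integral_rpow (Or.inl (by linarith))]
        have e1 : r + 1 = q / p := by rw [hr]; field_simp; ring
        rw [e1, Real.zero_rpow (by positivity)]
        field_simp
        ring
      rw [← hint]
      refine intervalIntegral.integral_mono_on_of_le_Ioo ht.1.le
        ((continuous_const.mul (Real.continuous_rpow_const hrpos.le)).intervalIntegrable _ _)
        (hfi' 0 h0mem t htm) fun s hs => ?_
      have hs0 : 0 < s := hs.1
      have hsm : s ∈ Icc 0 R := ⟨hs.1.le, hs.2.le.trans htm.2⟩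
      calc a ^ q * s ^ r = (a * s) ^ q * s ^ (-κ) := by
            rw [Real.mul_rpow ha.le hs0.le, mul_assoc, ← Real.rpow_add hs0]
            congr 2; rw [hr, hκ, hc]; field_simp; ring
        _ ≤ V s ^ q * s ^ (-κ) := by
            gcongr
            exact (hVb s hsm).1
    have hu := extremalMassTo_le_rpow hp hpq (hTpos t ht)
    rw [hTj t ht] at hu
    have hle := hl.trans hu
    have := Real.rpow_le_rpow (by positivity) hle (by positivity : 0 ≤ p / q)
    rw [← Real.rpow_mul (hTpos t ht).le, Real.mul_rpow (by positivity) (by positivity),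
      ← Real.rpow_mul ht0.le, show q / p * (p / q) = 1 by field_simp, Real.rpow_one,
      Real.rpow_one] at this
    exact this
  have hΦle : ∀ t ∈ Ioo 0 R, Φ t ≤ b ^ κ * C ^ (-(r * c)) * t := by
    intro t ht
    have ht0 := ht.1
    have htm : t ∈ Icc 0 R := ⟨ht.1.le, ht.2.le⟩
    have l1 : V t ^ κ ≤ (b * t) ^ κ :=
      Real.rpow_le_rpow (hVpos t ht).le (hVb t htm).2 hκpos.le
    have l2 : T t ^ (-(r * c)) ≤ (C * t) ^ (-(r * c)) :=
      Real.rpow_le_rpow_of_nonpos (by positivity) (hC t ht) (by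
        rw [neg_nonpos]; positivity)
    have hTt := hTpos t ht
    calc Φ t ≤ (b * t) ^ κ * t ^ (-(κ * c)) * (C * t) ^ (-(r * c)) := by
          simp only [hΦ]
          gcongr
      _ = b ^ κ * C ^ (-(r * c)) * (t ^ κ * t ^ (-(κ * c)) * t ^ (-(r * c))) := by
          rw [Real.mul_rpow hbpos.le ht0.le, Real.mul_rpow hC0.le ht0.le]; ring
      _ = b ^ κ * C ^ (-(r * c)) * t := by
          rw [← Real.rpow_add ht0, ← Real.rpow_add ht0]
          -- Equivalently `κ/p = 1 + rc`, because `1 - c = 1/p`. Hence `Φ` is at most linear near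
          -- `0`.
          have : κ + -(κ * c) + -(r * c) = 1 := by
            rw [hκ, hr, hc]; field_simp; ring
          rw [this, Real.rpow_one]
  have hjlim : Tendsto j (𝓝[>] 0) (𝓝 0) := by
    have h := hjc 0 h0mem
    rw [ContinuousWithinAt, hj0] at h
    exact h.mono_left (nhdsWithin_le_iff.2 (mem_of_superset
      (inter_mem self_mem_nhdsWithin (mem_nhdsWithin_of_mem_nhds (Iio_mem_nhds hR)))
      fun x hx => ⟨le_of_lt hx.1, le_of_lt hx.2⟩))
  have hev : ∀ᶠ t in 𝓝[>] (0 : ℝ), t ∈ Ioo 0 R := Ioo_mem_nhdsGT hR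
  have hTlim : Tendsto T (𝓝[>] 0) (𝓝 0) := by
    rw [tendsto_order]
    constructor
    · intro x hx
      filter_upwards [hev] with t ht
      exact hx.trans (hTpos t ht)
    · intro x hx
      have hmono := strictMonoOn_extremalMassTo hp hpq
      have hx' : 0 < extremalMassTo p q x := by
        rw [← extremalMassTo_zero (p := p) (q := q)]
        exact hmono (show (0 : ℝ) ≤ 0 from le_rfl) hx.le hx
      filter_upwards [hev, hjlim.eventually (gt_mem_nhds hx')] with t ht htj
      rwa [← hTj t ht, hmono.lt_iff_lt (hTpos t ht).le hx.le] at htj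
  have hΨle : ∀ t ∈ Ioo 0 R, Ψ t ≤ 0 := by
    intro t ht
    have hlim : Tendsto (fun s => b ^ κ * C ^ (-(r * c)) * s + r * c * T s + q * c * j s)
        (𝓝[>] 0) (𝓝 (b ^ κ * C ^ (-(r * c)) * 0 + r * c * 0 + q * c * 0)) :=
      ((tendsto_nhdsWithin_of_tendsto_nhds tendsto_id).const_mul _ |>.add
        (hTlim.const_mul _)).add (hjlim.const_mul _)
    simp only [mul_zero, add_zero] at hlim
    refine ge_of_tendsto hlim ?_
    filter_upwards [Ioo_mem_nhdsGT ht.1] with s hs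
    have hsm : s ∈ Ioo 0 R := ⟨hs.1, hs.2.trans ht.2⟩
    refine (hΨanti s hsm t ht hs.2.le).trans ?_
    have l1 := hΦle s hsm
    have l2 := extremalEnergyTo_le hp hpq (hTpos s hsm).le
    have l3 : 0 ≤ W s := by rw [← hW0]; exact hWmono _ _ hs.1.le
    have l4 : r * c * extremalEnergyTo p q (T s) ≤ r * c * T s := by gcongr
    have l5 : 0 ≤ κ / p * W s := by positivity
    simp only [hΨ]
    linarith
  -- conclusion
  have hfin : ∀ x, 0 < x →
      r * c * extremalEnergyTo p q x + q * c * extremalMassTo p q x ≤ κ / p * W R := by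
    intro x hx
    have hmono := strictMonoOn_extremalMassTo hp hpq
    have hx' : 0 < extremalMassTo p q x := by
      rw [← extremalMassTo_zero (p := p) (q := q)]
      exact hmono (show (0 : ℝ) ≤ 0 from le_rfl) hx.le hx
    obtain ⟨t, ht, hjt⟩ := intermediate_value_Ioo hR.le hjc
      (show extremalMassTo p q x ∈ Ioo (j 0) (j R) by
        rw [hj0, hjR]; exact ⟨hx', extremalMassTo_lt hp hpq hx.le⟩)
    have hTx : T t = x := by
      refine hmono.injOn (hTpos t ht).le hx.le ?_
      rw [hTj t ht, hjt]
    have l1 := hΨle t ht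
    have l2 : 0 ≤ Φ t := by
      have := hVpos t ht; have := hTpos t ht; have := ht.1
      simp only [hΦ]; positivity
    have l3 : κ / p * W t ≤ κ / p * W R := by
      have := hWmono t R ht.2.le
      gcongr
    simp only [hΨ] at l1
    rw [hTx, hjt] at l1
    linarith
  have hlim := le_of_tendsto (((tendsto_extremalEnergyTo hp hpq).const_mul (r * c)).add
    ((tendsto_extremalMassTo hp hpq).const_mul (q * c)))
    (eventually_atTop.2 ⟨1, fun x hx => hfin x (by linarith)⟩)
  -- Here `qc` times the extremal mass is the extremal energy, and `rc + 1 = κ/p`.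
  have e1 : r * c * extremalEnergy p q + q * c * extremalMass p q = κ / p * extremalEnergy p q := by
    rw [extremalMass, hκ, hr, hc]; field_simp; ring
  rw [e1] at hlim
  exact le_of_mul_le_mul_left hlim (by positivity)

end

/-! ### The Bliss inequality -/

section

variable {p q : ℝ}

theorem blissConst_eq (p q : ℝ) :
    blissConst p q = extremalEnergy p q ^ (1 / p - 1 / q) * (q * (p - 1) / p) ^ (1 / q) := rfl

theorem blissConst_pos (hp : 1 < p) (hpq : p < q) : 0 < blissConst p q := by
  have h0 : 0 < p := by linarith
  have h1 : 0 < q := by linarith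
  have h3 : 0 < p - 1 := by linarith
  have hA := extremalEnergy_pos hp hpq
  rw [blissConst_eq]
  positivity

/-- Equality in the Bliss inequality for the extremal function. It identifies the constant here and
is used again for the sharpness of the Sobolev constant. -/
theorem blissConst_mul_extremalMass (hp : 1 < p) (hpq : p < q) :
    blissConst p q * extremalMass p q ^ (1 / q) = extremalEnergy p q ^ (1 / p) := by
  have h0 : 0 < p := by linarith
  have h1 : 0 < q := by linarith
  have h3 : 0 < p - 1 := by linarith
  have hA := extremalEnergy_pos hp hpq
  rw [blissConst_eq, extremalMass, Real.mul_rpow (by positivity) hA.le,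
    Real.rpow_sub hA,
    show p / (q * (p - 1)) = (q * (p - 1) / p)⁻¹ by field_simp, Real.inv_rpow (by positivity)]
  have : 0 < (q * (p - 1) / p) ^ (1 / q) := by positivity
  have : 0 < extremalEnergy p q ^ (1 / q) := by positivity
  field_simp

/-- Both sides are homogeneous of degree one in `g`, so multiplication by a constant reduces to the
normalised mass. Zero mass is trivial. -/
theorem bliss_of_continuous_pos (hp : 1 < p) (hpq : p < q) {g : ℝ → ℝ} (hg : Continuous g)
    (hpos : ∀ t, 0 < g t) {R : ℝ} (hR : 0 < R) :
    blissConst p q * (∫ t in (0 : ℝ)..R,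
        (∫ s in (0 : ℝ)..t, g s) ^ q * t ^ (-(1 + q * ((p - 1) / p)))) ^ (1 / q) ≤
      (∫ t in (0 : ℝ)..R, g t ^ p) ^ (1 / p) := by
  have h0 : 0 < p := by linarith
  have h1 : 0 < q := by linarith
  have hA := extremalEnergy_pos hp hpq
  have hM := extremalMass_pos hp hpq
  have hC := blissConst_pos hp hpq
  have hVnn : ∀ t, 0 ≤ t → 0 ≤ ∫ s in (0 : ℝ)..t, g s := fun t ht =>
    intervalIntegral.integral_nonneg ht fun s _ => (hpos s).le
  set m := ∫ t in (0 : ℝ)..R,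
        (∫ s in (0 : ℝ)..t, g s) ^ q * t ^ (-(1 + q * ((p - 1) / p))) with hm
  have hE : 0 ≤ ∫ t in (0 : ℝ)..R, g t ^ p :=
    intervalIntegral.integral_nonneg hR.le fun s _ => Real.rpow_nonneg (hpos s).le _
  have hmnn : 0 ≤ m := intervalIntegral.integral_nonneg hR.le fun s hs =>
    mul_nonneg (Real.rpow_nonneg (hVnn s hs.1) _) (Real.rpow_nonneg hs.1 _)
  rcases hmnn.eq_or_lt with hm0 | hmpos
  · rw [← hm0, Real.zero_rpow (by positivity), mul_zero]
    exact Real.rpow_nonneg hE _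
  set l := (extremalMass p q / m) ^ (1 / q) with hl
  have hlpos : 0 < l := by positivity
  have key := extremalEnergy_le_of_mass_eq hp hpq (g := fun s => l * g s)
    (continuous_const.mul hg) (fun t => mul_pos hlpos (hpos t)) hR (by
      have e : ∫ t in (0 : ℝ)..R, (∫ s in (0 : ℝ)..t, l * g s) ^ q *
          t ^ (-(1 + q * ((p - 1) / p))) = l ^ q * m := by
        rw [hm, ← intervalIntegral.integral_const_mul]
        refine intervalIntegral.integral_congr fun t ht => ?_
        rw [uIcc_of_le hR.le] at ht
        simp only [intervalIntegral.integral_const_mul]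
        rw [Real.mul_rpow hlpos.le (hVnn t ht.1), mul_assoc]
      rw [e, hl, ← Real.rpow_mul (by positivity), one_div_mul_cancel h1.ne', Real.rpow_one]
      field_simp)
  have e2 : ∫ t in (0 : ℝ)..R, (l * g t) ^ p = l ^ p * ∫ t in (0 : ℝ)..R, g t ^ p := by
    rw [← intervalIntegral.integral_const_mul]
    refine intervalIntegral.integral_congr fun t _ => ?_
    exact Real.mul_rpow hlpos.le (hpos t).le
  rw [e2] at key
  have k2 := Real.rpow_le_rpow hA.le key (by positivity : 0 ≤ 1 / p)
  rw [← blissConst_mul_extremalMass hp hpq, Real.mul_rpow (by positivity) hE,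
    ← Real.rpow_mul hlpos.le, mul_one_div_cancel h0.ne', Real.rpow_one, hl,
    Real.div_rpow hM.le hmpos.le] at k2
  have hMq : 0 < extremalMass p q ^ (1 / q) := by positivity
  have hmq : 0 < m ^ (1 / q) := by positivity
  rw [div_mul_eq_mul_div, le_div_iff₀ hmq] at k2
  nlinarith

/-- The integrand of `blissMass` with values in `[0, ∞]`. -/
theorem ofReal_blissIntegrand {v t : ℝ} (ht : 0 < t) (k : ℝ) (hv : 0 ≤ v) :
    |v| ^ q / t ^ k = v ^ q * t ^ (-k) := by
  rw [abs_of_nonneg hv, Real.rpow_neg ht.le, div_eq_mul_inv]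

theorem eLpNorm_ofReal_eq (h0 : 0 < p) (g : ℝ → ℝ) (μ : Measure ℝ) :
    eLpNorm g (ENNReal.ofReal p) μ = (∫⁻ t, ENNReal.ofReal (|g t| ^ p) ∂μ) ^ (1 / p) := by
  rw [eLpNorm_eq_lintegral_rpow_enorm_toReal (by simpa using h0) ENNReal.ofReal_ne_top,
    ENNReal.toReal_ofReal h0.le]
  congr 1
  refine lintegral_congr fun t => ?_
  rw [← Real.enorm_abs, Real.enorm_of_nonneg (abs_nonneg _),
    ENNReal.ofReal_rpow_of_nonneg (abs_nonneg _) h0.le]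

theorem lintegral_bliss_of_continuous_pos (hp : 1 < p) (hpq : p < q) {g : ℝ → ℝ}
    (hg : Continuous g) (hpos : ∀ t, 0 < g t) {R : ℝ} (hR : 0 < R) :
    ENNReal.ofReal (blissConst p q) * (∫⁻ t in Ioc 0 R,
        ENNReal.ofReal (|∫ s in (0 : ℝ)..t, g s| ^ q / t ^ (1 + q * ((p - 1) / p)))) ^ (1 / q) ≤
      eLpNorm g (ENNReal.ofReal p) (volume.restrict (Ioc 0 R)) := by
  have h0 : 0 < p := by linarith
  have h1 : 0 < q := by linarith
  have hVc : Continuous fun t => ∫ s in (0 : ℝ)..t, g s :=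
    continuous_iff_continuousAt.2 fun t =>
      (hg.integral_hasStrictDerivAt 0 t).hasDerivAt.continuousAt
  have hVnn : ∀ t, 0 ≤ t → 0 ≤ ∫ s in (0 : ℝ)..t, g s := fun t ht =>
    intervalIntegral.integral_nonneg ht fun s _ => (hpos s).le
  obtain ⟨b, hb⟩ : ∃ b, ∀ s ∈ Icc 0 R, g s ≤ b := by
    obtain ⟨x, hx, hx'⟩ := isCompact_Icc.exists_isMaxOn (nonempty_Icc.2 hR.le) hg.continuousOn
    exact ⟨g x, fun s hs => hx' hs⟩
  have hint := intervalIntegrable_blissIntegrand hp hpq hVc hR fun t ht =>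
    ⟨hVnn t ht.1, (primitive_bounds hg (fun s hs => ⟨(hpos s).le, hb s hs⟩) ht).2⟩
  have e1 : ∫⁻ t in Ioc 0 R,
      ENNReal.ofReal (|∫ s in (0 : ℝ)..t, g s| ^ q / t ^ (1 + q * ((p - 1) / p))) =
      ENNReal.ofReal (∫ t in (0 : ℝ)..R,
        (∫ s in (0 : ℝ)..t, g s) ^ q * t ^ (-(1 + q * ((p - 1) / p)))) := by
    rw [intervalIntegral.integral_of_le hR.le, ofReal_integral_eq_lintegral_ofReal
      ((intervalIntegrable_iff_integrableOn_Ioc_of_le hR.le).1 hint)]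
    · refine setLIntegral_congr_fun measurableSet_Ioc fun t ht => ?_
      rw [ofReal_blissIntegrand ht.1 _ (hVnn t ht.1.le)]
    · filter_upwards [ae_restrict_mem measurableSet_Ioc] with t ht
      exact mul_nonneg (Real.rpow_nonneg (hVnn t ht.1.le) _) (Real.rpow_nonneg ht.1.le _)
  have hgp : Continuous fun s => g s ^ p := hg.rpow_const fun s => Or.inr h0.le
  have e2 : ∫⁻ t in Ioc 0 R, ENNReal.ofReal (|g t| ^ p) =
      ENNReal.ofReal (∫ t in (0 : ℝ)..R, g t ^ p) := by
    rw [intervalIntegral.integral_of_le hR.le, ofReal_integral_eq_lintegral_ofReal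
      ((intervalIntegrable_iff_integrableOn_Ioc_of_le hR.le).1 (hgp.intervalIntegrable _ _))]
    · exact lintegral_congr fun t => by rw [abs_of_pos (hpos t)]
    · exact Eventually.of_forall fun t => Real.rpow_nonneg (hpos t).le _
  rw [eLpNorm_ofReal_eq h0, e1, e2, ENNReal.ofReal_rpow_of_nonneg _ (by positivity),
    ENNReal.ofReal_rpow_of_nonneg _ (by positivity),
    ← ENNReal.ofReal_mul (blissConst_pos hp hpq).le]
  · exact ENNReal.ofReal_le_ofReal (bliss_of_continuous_pos hp hpq hg hpos hR)
  · exact intervalIntegral.integral_nonneg hR.le fun s _ => Real.rpow_nonneg (hpos s).le _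
  · exact intervalIntegral.integral_nonneg hR.le fun s hs =>
      mul_nonneg (Real.rpow_nonneg (hVnn s hs.1) _) (Real.rpow_nonneg hs.1 _)

/-- A Fatou argument for inequalities `c * m ^ a ≤ e`. -/
theorem mul_lintegral_rpow_le_of_tendsto {α : Type*} [MeasurableSpace α] {μ : Measure α}
    {f : ℕ → α → ℝ≥0∞} {F : α → ℝ≥0∞} {c e : ℝ≥0∞} {a : ℝ} {E : ℕ → ℝ≥0∞} (ha : 0 < a)
    (hc : c ≠ 0) (hc' : c ≠ ⊤) (hf : ∀ n, AEMeasurable (f n) μ)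
    (hlim : ∀ᵐ x ∂μ, Tendsto (fun n => f n x) atTop (𝓝 (F x)))
    (hle : ∀ n, c * (∫⁻ x, f n x ∂μ) ^ a ≤ E n) (hE : Tendsto E atTop (𝓝 e)) :
    c * (∫⁻ x, F x ∂μ) ^ a ≤ e := by
  have h1 : ∫⁻ x, F x ∂μ ≤ liminf (fun n => ∫⁻ x, f n x ∂μ) atTop := by
    calc ∫⁻ x, F x ∂μ = ∫⁻ x, liminf (fun n => f n x) atTop ∂μ := by
          refine lintegral_congr_ae ?_
          filter_upwards [hlim] with x hx
          exact hx.liminf_eq.symm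
      _ ≤ _ := lintegral_liminf_le' hf
  have h2 : ∀ n, ∫⁻ x, f n x ∂μ ≤ (E n / c) ^ (1 / a) := by
    intro n
    have : (∫⁻ x, f n x ∂μ) ^ a ≤ E n / c := by
      rw [ENNReal.le_div_iff_mul_le (Or.inl hc) (Or.inl hc'), mul_comm]
      exact hle n
    calc ∫⁻ x, f n x ∂μ = ((∫⁻ x, f n x ∂μ) ^ a) ^ (1 / a) := by
          rw [← ENNReal.rpow_mul, mul_one_div_cancel ha.ne', ENNReal.rpow_one]
      _ ≤ _ := ENNReal.rpow_le_rpow this (by positivity)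
  have h3 : Tendsto (fun n => (E n / c) ^ (1 / a)) atTop (𝓝 ((e / c) ^ (1 / a))) := by
    refine (ENNReal.continuous_rpow_const.tendsto _).comp ?_
    exact ENNReal.Tendsto.div_const hE (Or.inr hc)
  have h4 : ∫⁻ x, F x ∂μ ≤ (e / c) ^ (1 / a) := by
    refine h1.trans ?_
    rw [← h3.liminf_eq]
    exact liminf_le_liminf (Eventually.of_forall h2)
  calc c * (∫⁻ x, F x ∂μ) ^ a ≤ c * ((e / c) ^ (1 / a)) ^ a := by gcongr
    _ = c * (e / c) := by
        rw [← ENNReal.rpow_mul, one_div_mul_cancel ha.ne', ENNReal.rpow_one]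
    _ ≤ e := ENNReal.mul_div_le

/-- Positive continuous functions approximate `w` in `L^p`. Their primitives converge pointwise, so
Fatou handles the mass while the norms converge. -/
theorem lintegral_bliss_of_memLp (hp : 1 < p) (hpq : p < q) {w : ℝ → ℝ} {R : ℝ} (hR : 0 < R)
    (hw : MemLp w (ENNReal.ofReal p) (volume.restrict (Ioc 0 R))) (hw0 : ∀ t, 0 ≤ w t) :
    ENNReal.ofReal (blissConst p q) * (∫⁻ t in Ioc 0 R,
        ENNReal.ofReal (|∫ s in (0 : ℝ)..t, w s| ^ q / t ^ (1 + q * ((p - 1) / p)))) ^ (1 / q) ≤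
      eLpNorm w (ENNReal.ofReal p) (volume.restrict (Ioc 0 R)) := by
  have h0 : 0 < p := by linarith
  have h1 : 0 < q := by linarith
  set μ : Measure ℝ := volume.restrict (Ioc 0 R) with hμ
  have hp1 : (1 : ℝ≥0∞) ≤ ENNReal.ofReal p := by
    rw [ENNReal.one_le_ofReal]; exact hp.le
  have hεpos : ∀ n : ℕ, 0 < 1 / ((n : ℝ) + 1) := fun n => by positivity
  choose g hgc hg hgcont hgmem using fun n : ℕ =>
    hw.exists_hasCompactSupport_eLpNorm_sub_le ENNReal.ofReal_ne_top
      (ε := ENNReal.ofReal (1 / ((n : ℝ) + 1))) (by simpa using hεpos n)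
  -- The absolute value costs nothing in `L^p` distance because `w ≥ 0`, and the added constant
  -- makes the approximant strictly positive.
  set h : ℕ → ℝ → ℝ := fun n t => |g n t| + 1 / ((n : ℝ) + 1) with hh
  have hhc : ∀ n, Continuous (h n) := fun n => (hgcont n).abs.add continuous_const
  have hhpos : ∀ n t, 0 < h n t := fun n t => add_pos_of_nonneg_of_pos (abs_nonneg _) (hεpos n)
  set δ : ℕ → ℝ≥0∞ := fun n => ENNReal.ofReal (1 / ((n : ℝ) + 1)) +
    ENNReal.ofReal (1 / ((n : ℝ) + 1)) * μ univ ^ (1 / p) with hδ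
  have hdiff : ∀ n, eLpNorm (h n - w) (ENNReal.ofReal p) μ ≤ δ n := by
    intro n
    have e : h n - w = (fun t => |g n t| - |w t|) + fun _ => 1 / ((n : ℝ) + 1) := by
      funext t
      simp only [hh, Pi.sub_apply, Pi.add_apply, abs_of_nonneg (hw0 t)]
      ring
    rw [e]
    refine (eLpNorm_add_le ?_ aestronglyMeasurable_const hp1).trans ?_
    · exact (hgcont n).abs.aestronglyMeasurable.sub hw.1.norm
    · refine add_le_add ?_ ?_
      · refine le_trans (eLpNorm_mono_real (g := fun t => ‖(w - g n) t‖) fun t => ?_) ?_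
        · rw [Real.norm_eq_abs, Pi.sub_apply, Real.norm_eq_abs, abs_sub_comm (w t)]
          exact abs_abs_sub_abs_le _ _
        · rw [eLpNorm_norm]
          exact hg n
      · rw [eLpNorm_const' _ (by simpa using h0) ENNReal.ofReal_ne_top,
          ENNReal.toReal_ofReal h0.le, Real.enorm_of_nonneg (hεpos n).le]
  have hδlim : Tendsto δ atTop (𝓝 0) := by
    have l : Tendsto (fun n : ℕ => ENNReal.ofReal (1 / ((n : ℝ) + 1))) atTop (𝓝 0) := by
      rw [← ENNReal.ofReal_zero]
      exact ENNReal.tendsto_ofReal tendsto_one_div_add_atTop_nhds_zero_nat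
    have hfin : μ univ ^ (1 / p) ≠ ⊤ :=
      ENNReal.rpow_ne_top_of_nonneg (by positivity) (measure_ne_top μ _)
    simpa [hδ] using l.add (ENNReal.Tendsto.mul_const l (Or.inr hfin))
  have hhi : ∀ n, Integrable (h n) μ := fun n =>
    ((intervalIntegrable_iff_integrableOn_Ioc_of_le hR.le).1
      ((hhc n).intervalIntegrable _ _))
  have hwi : Integrable w μ := hw.integrable hp1
  -- On a bounded interval `L^p` convergence implies `L^1` convergence, which is what the primitives
  -- need.
  have hL1 : Tendsto (fun n => eLpNorm (h n - w) 1 μ) atTop (𝓝 0) := by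
    refine tendsto_of_tendsto_of_tendsto_of_le_of_le tendsto_const_nhds
      (h := fun n => δ n * μ univ ^ (1 / (1 : ℝ≥0∞).toReal - 1 / (ENNReal.ofReal p).toReal)) ?_
      (fun _ => zero_le) fun n => ?_
    · have hfin : μ univ ^ (1 / (1 : ℝ≥0∞).toReal - 1 / (ENNReal.ofReal p).toReal) ≠ ⊤ := by
        refine ENNReal.rpow_ne_top_of_nonneg ?_ (measure_ne_top μ _)
        rw [ENNReal.toReal_ofReal h0.le, ENNReal.toReal_one, div_one, sub_nonneg,
          div_le_one h0]
        exact hp.le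
      simpa using ENNReal.Tendsto.mul_const hδlim (Or.inr hfin)
    · refine (eLpNorm_le_eLpNorm_mul_rpow_measure_univ hp1
        ((hhi n).1.sub hw.1)).trans ?_
      exact mul_le_mul' (hdiff n) le_rfl
  have hVlim : ∀ t ∈ Ioc 0 R, Tendsto (fun n => ∫ s in (0 : ℝ)..t, h n s) atTop
      (𝓝 (∫ s in (0 : ℝ)..t, w s)) := by
    intro t ht
    have := tendsto_setIntegral_of_L1' w hwi.1 (Eventually.of_forall hhi) hL1 (Ioc 0 t)
    rw [hμ, Measure.restrict_restrict measurableSet_Ioc,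
      inter_eq_self_of_subset_left (Ioc_subset_Ioc_right ht.2)] at this
    simpa only [intervalIntegral.integral_of_le ht.1.le] using this
  refine mul_lintegral_rpow_le_of_tendsto (μ := μ)
    (f := fun n t => ENNReal.ofReal
      (|∫ s in (0 : ℝ)..t, h n s| ^ q / t ^ (1 + q * ((p - 1) / p))))
    (E := fun n => eLpNorm w (ENNReal.ofReal p) μ + δ n) (by positivity)
    (by simpa using blissConst_pos hp hpq) ENNReal.ofReal_ne_top ?_ ?_ ?_ ?_
  · intro n
    have hVc : Continuous fun t => ∫ s in (0 : ℝ)..t, h n s :=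
      continuous_iff_continuousAt.2 fun t =>
        ((hhc n).integral_hasStrictDerivAt 0 t).hasDerivAt.continuousAt
    have : Measurable fun t => |∫ s in (0 : ℝ)..t, h n s| ^ q / t ^ (1 + q * ((p - 1) / p)) :=
      (hVc.abs.measurable.pow_const _).div (measurable_id.pow_const _)
    exact this.ennreal_ofReal.aemeasurable
  · filter_upwards [ae_restrict_mem measurableSet_Ioc] with t ht
    refine ENNReal.tendsto_ofReal (Tendsto.div_const ?_ _)
    exact ((hVlim t ht).abs).rpow_const (Or.inr h1.le)
  · intro n
    refine (lintegral_bliss_of_continuous_pos hp hpq (hhc n) (hhpos n) hR).trans ?_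
    have e : h n = w + (h n - w) := by simp
    conv_lhs => rw [e]
    exact (eLpNorm_add_le hw.1 ((hhi n).1.sub hw.1) hp1).trans (by gcongr; exact hdiff n)
  · simpa using hδlim.const_add (eLpNorm w (ENNReal.ofReal p) μ)

theorem setLIntegral_Ioi_le_of_forall_Ioc {f : ℝ → ℝ≥0∞} {b : ℝ≥0∞}
    (h : ∀ R, 0 < R → ∫⁻ t in Ioc 0 R, f t ≤ b) : ∫⁻ t in Ioi 0, f t ≤ b := by
  have hU : Ioi (0 : ℝ) = ⋃ n : ℕ, Ioc 0 ((n : ℝ) + 1) := by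
    ext x
    simp only [mem_Ioi, mem_iUnion, mem_Ioc]
    refine ⟨fun hx => ?_, fun ⟨_, hx, _⟩ => hx⟩
    obtain ⟨n, hn⟩ := exists_nat_ge x
    exact ⟨n, hx, by linarith⟩
  rw [hU, setLIntegral_iUnion_of_directed]
  · exact iSup_le fun n => h _ (by positivity)
  · refine Monotone.directed_le fun m n hmn => Ioc_subset_Ioc_right ?_
    have : (m : ℝ) ≤ n := by exact_mod_cast hmn
    linarith

/-- Replacing `v` by the primitive of `|v'|` keeps the energy and does not decrease the mass. The
bounds on `(0, R]` are uniform in `R`. -/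
theorem BlissAdmissible.blissInequality (hp : 1 < p) (hpq : p < q) {v : ℝ → ℝ}
    (hv : BlissAdmissible p v) : BlissInequality p q v := by
  have h0 : 0 < p := by linarith
  have h1 : 0 < q := by linarith
  have hC := blissConst_pos hp hpq
  have hq : 0 < 1 / q := by positivity
  have hC0 : ENNReal.ofReal (blissConst p q) ≠ 0 := by simpa using hC
  unfold BlissInequality blissEnergy
  rw [← eLpNorm_ofReal_eq h0]
  set e := eLpNorm (deriv v) (ENNReal.ofReal p) (volume.restrict (Ioi 0)) with he
  suffices hs : blissMass p q v ≤ (e / ENNReal.ofReal (blissConst p q)) ^ q by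
    calc _ ≤ ENNReal.ofReal (blissConst p q) *
          ((e / ENNReal.ofReal (blissConst p q)) ^ q) ^ (1 / q) := by gcongr
      _ = ENNReal.ofReal (blissConst p q) * (e / ENNReal.ofReal (blissConst p q)) := by
          rw [← ENNReal.rpow_mul, mul_one_div_cancel h1.ne', ENNReal.rpow_one]
      _ ≤ e := ENNReal.mul_div_le
  refine setLIntegral_Ioi_le_of_forall_Ioc fun R hR => ?_
  have hmem : MemLp (fun t => |deriv v t|) (ENNReal.ofReal p) (volume.restrict (Ioc 0 R)) :=
    (hv.deriv_memLp.mono_measure (Measure.restrict_mono Ioc_subset_Ioi_self le_rfl)).abs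
  have hb := lintegral_bliss_of_memLp hp hpq hR hmem fun t => abs_nonneg _
  have hle : ∫⁻ t in Ioc 0 R, ENNReal.ofReal (|v t| ^ q / t ^ (1 + q * ((p - 1) / p))) ≤
      ∫⁻ t in Ioc 0 R, ENNReal.ofReal
        (|(∫ s in (0 : ℝ)..t, |deriv v s|)| ^ q / t ^ (1 + q * ((p - 1) / p))) := by
    refine setLIntegral_mono' measurableSet_Ioc fun t ht => ?_
    have ht0 : 0 < t := ht.1
    have hvt : |v t| ≤ |(∫ s in (0 : ℝ)..t, |deriv v s|)| := by
      have := (hv.absCont t ht0.le).integral_deriv_eq_sub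
      rw [hv.map_zero, sub_zero] at this
      rw [← this]
      exact (intervalIntegral.abs_integral_le_integral_abs ht0.le).trans (le_abs_self _)
    refine ENNReal.ofReal_le_ofReal ?_
    gcongr
  have hn : eLpNorm (fun t => |deriv v t|) (ENNReal.ofReal p) (volume.restrict (Ioc 0 R)) ≤ e := by
    have : eLpNorm (fun t => |deriv v t|) (ENNReal.ofReal p) (volume.restrict (Ioc 0 R)) =
        eLpNorm (deriv v) (ENNReal.ofReal p) (volume.restrict (Ioc 0 R)) :=
      eLpNorm_norm (deriv v)
    rw [this]
    exact eLpNorm_mono_measure _ (Measure.restrict_mono Ioc_subset_Ioi_self le_rfl)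
  refine hle.trans ?_
  have key := ENNReal.rpow_le_rpow ((ENNReal.le_div_iff_mul_le (Or.inl hC0)
    (Or.inl ENNReal.ofReal_ne_top)).2 ((mul_comm _ _).trans_le (hb.trans hn))) h1.le
  rwa [← ENNReal.rpow_mul, one_div_mul_cancel h1.ne', ENNReal.rpow_one] at key

end

/-! ### Polar coordinates -/

section

variable {N : ℕ}

/-- The surface measure on the unit sphere of `ℝ^N`. -/
abbrev sphereMeasure (N : ℕ) : Measure (Metric.sphere (0 : E N) 1) :=
  (volume : Measure (E N)).toSphere

theorem nontrivial_euclidean (hN : 0 < N) : Nontrivial (E N) := by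
  have : Nonempty (Fin N) := ⟨⟨0, hN⟩⟩
  infer_instance

theorem lintegral_polar (hN : 0 < N) {F : E N → ℝ≥0∞} (hF : Measurable F) :
    ∫⁻ x, F x = ∫⁻ σ, (∫⁻ r in Ioi (0 : ℝ), ENNReal.ofReal (r ^ (N - 1)) * F (r • (σ : E N)))
      ∂(sphereMeasure N) := by
  have := nontrivial_euclidean hN
  have hmp := (volume : Measure (E N)).measurePreserving_homeomorphUnitSphereProd
  rw [finrank_euclideanSpace_fin] at hmp
  have hFm : Measurable fun z : Metric.sphere (0 : E N) 1 × Ioi (0 : ℝ) =>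
      F ((z.2 : ℝ) • (z.1 : E N)) :=
    hF.comp ((measurable_subtype_coe.comp measurable_snd).smul
      (measurable_subtype_coe.comp measurable_fst))
  calc ∫⁻ x, F x = ∫⁻ x in ({0}ᶜ : Set (E N)), F x := by rw [restrict_compl_singleton]
    _ = ∫⁻ x : ({0}ᶜ : Set (E N)), F x ∂(Measure.comap Subtype.val volume) := by
        rw [lintegral_subtype_comap (measurableSet_singleton _).compl]
    _ = ∫⁻ x : ({0}ᶜ : Set (E N)), F (((homeomorphUnitSphereProd (E N) x).2 : ℝ) •
          ((homeomorphUnitSphereProd (E N) x).1 : E N)) ∂(Measure.comap Subtype.val volume) := by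
        refine lintegral_congr fun x => ?_
        congr 1
        have hx : ‖(x : E N)‖ ≠ 0 := norm_ne_zero_iff.2 x.2
        simp [smul_smul, hx]
    _ = ∫⁻ z, F ((z.2 : ℝ) • (z.1 : E N))
          ∂((sphereMeasure N).prod (Measure.volumeIoiPow (N - 1))) :=
        hmp.lintegral_comp hFm
    _ = _ := by
        rw [lintegral_prod _ hFm.aemeasurable]
        refine lintegral_congr fun σ => ?_
        change ∫⁻ y : Ioi (0 : ℝ), F ((y : ℝ) • (σ : E N)) ∂(Measure.volumeIoiPow (N - 1)) = _
        rw [Measure.volumeIoiPow, lintegral_withDensity_eq_lintegral_mul _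
          ((measurable_subtype_coe.pow_const _).ennreal_ofReal)
          (g := fun y : Ioi (0 : ℝ) => F ((y : ℝ) • (σ : E N)))
          (hF.comp (measurable_subtype_coe.smul_const _)), ← lintegral_subtype_comap
          measurableSet_Ioi]
        rfl

theorem sphereMeasure_univ (N : ℕ) :
    sphereMeasure N univ = ENNReal.ofReal (sphereArea N) := by
  rw [sphereArea, ENNReal.ofReal_toReal (measure_ne_top _ _)]

theorem sphereArea_pos (hN : 0 < N) : 0 < sphereArea N := by
  have := nontrivial_euclidean hN
  refine ENNReal.toReal_pos ?_ (measure_ne_top _ _)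
  rw [ne_eq, Measure.measure_univ_eq_zero]
  exact Measure.toSphere_ne_zero _

theorem lintegral_radial (hN : 0 < N) {F : ℝ → ℝ≥0∞} (hF : Measurable F) :
    ∫⁻ x : E N, F ‖x‖ =
      ENNReal.ofReal (sphereArea N) * ∫⁻ r in Ioi (0 : ℝ), ENNReal.ofReal (r ^ (N - 1)) * F r := by
  rw [lintegral_polar hN (F := fun x => F ‖x‖) (hF.comp measurable_norm)]
  have : ∀ σ : Metric.sphere (0 : E N) 1,
      ∫⁻ r in Ioi (0 : ℝ), ENNReal.ofReal (r ^ (N - 1)) * F ‖r • (σ : E N)‖ =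
      ∫⁻ r in Ioi (0 : ℝ), ENNReal.ofReal (r ^ (N - 1)) * F r := by
    intro σ
    refine setLIntegral_congr_fun measurableSet_Ioi fun r hr => ?_
    have : ‖(σ : E N)‖ = 1 := norm_eq_of_mem_sphere σ
    simp only [norm_smul, this, mul_one, Real.norm_of_nonneg (le_of_lt hr)]
  simp only [this, lintegral_const, sphereMeasure_univ]
  rw [mul_comm]

/-- Radial integrals over the radially symmetric set `{x | ‖x‖ ∈ I}`. -/
theorem setLIntegral_radial (hN : 0 < N) {F : ℝ → ℝ≥0∞} (hF : Measurable F) {I : Set ℝ}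
    (hI : MeasurableSet I) {Ω : Set (E N)} (hΩ : ∀ x, x ∈ Ω ↔ ‖x‖ ∈ I) :
    ∫⁻ x in Ω, F ‖x‖ = ENNReal.ofReal (sphereArea N) *
      ∫⁻ r in I ∩ Ioi (0 : ℝ), ENNReal.ofReal (r ^ (N - 1)) * F r := by
  have hΩ' : Ω = norm ⁻¹' I := by ext x; exact hΩ x
  have hm : MeasurableSet Ω := hΩ' ▸ measurable_norm hI
  rw [← lintegral_indicator hm]
  have h1 : ∀ x, Ω.indicator (fun x => F ‖x‖) x = I.indicator F ‖x‖ := by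
    intro x
    by_cases h : x ∈ Ω
    · rw [indicator_of_mem h, indicator_of_mem ((hΩ x).1 h)]
    · rw [indicator_of_notMem h, indicator_of_notMem (fun h' => h ((hΩ x).2 h'))]
  simp only [h1]
  rw [lintegral_radial hN (hF.indicator hI), ← Measure.restrict_restrict hI,
    ← lintegral_indicator hI]
  congr 1
  refine lintegral_congr fun r => ?_
  by_cases h : r ∈ I <;> simp [h]

/-- In polar coordinates the indicator of a null set integrates to zero on almost every ray, and the
weight `r^(N-1)` is positive there. -/
theorem ae_polar (hN : 0 < N) {P : E N → Prop} (h : ∀ᵐ x, P x) :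
    ∀ᵐ σ : Metric.sphere (0 : E N) 1 ∂(sphereMeasure N),
      ∀ᵐ r ∂(volume.restrict (Ioi (0 : ℝ))), P (r • (σ : E N)) := by
  obtain ⟨s, hs, hsm, hs0⟩ := exists_measurable_superset_of_null (ae_iff.1 h)
  have h1 := lintegral_polar hN (measurable_one.indicator hsm : Measurable (s.indicator 1))
  have h1' : ∫⁻ x, s.indicator (1 : E N → ℝ≥0∞) x = 0 := by rw [lintegral_indicator_one hsm, hs0]
  rw [h1'] at h1
  have hFm : Measurable (Function.uncurry fun (σ : Metric.sphere (0 : E N) 1) (r : ℝ) =>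
      ENNReal.ofReal (r ^ (N - 1)) * s.indicator (1 : E N → ℝ≥0∞) (r • (σ : E N))) := by
    refine Measurable.mul ?_ ?_
    · exact (measurable_snd.pow_const _).ennreal_ofReal
    · exact (measurable_one.indicator hsm).comp
        (measurable_snd.smul (measurable_subtype_coe.comp measurable_fst))
  have h2 := (lintegral_eq_zero_iff hFm.lintegral_prod_right).1 h1.symm
  filter_upwards [h2] with σ hσ
  have h3 := (lintegral_eq_zero_iff (hFm.comp measurable_prodMk_left)).1 hσ
  filter_upwards [h3, ae_restrict_mem measurableSet_Ioi] with r hr hr0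
  have hr0' : 0 < r := hr0
  by_contra hP
  have hmem : r • (σ : E N) ∈ s := hs hP
  simp [hmem] at hr
  have : 0 < r ^ (N - 1) := by positivity
  linarith

theorem ae_norm_of_ae (hN : 0 < N) {P : ℝ → Prop}
    (h : ∀ᵐ r ∂(volume.restrict (Ioi (0 : ℝ))), P r) : ∀ᵐ x : E N, P ‖x‖ := by
  have := nontrivial_euclidean hN
  rw [ae_restrict_iff' measurableSet_Ioi] at h
  obtain ⟨s, hs, hsm, hs0⟩ := exists_measurable_superset_of_null (ae_iff.1 h)
  have h1 := lintegral_radial hN (measurable_one.indicator hsm : Measurable (s.indicator 1))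
  have h2 : ∫⁻ r in Ioi (0 : ℝ), ENNReal.ofReal (r ^ (N - 1)) * s.indicator 1 r = 0 := by
    rw [lintegral_eq_zero_iff (f := fun r : ℝ => ENNReal.ofReal (r ^ (N - 1)) * s.indicator 1 r)
      (((measurable_id.pow_const _).ennreal_ofReal).mul (measurable_one.indicator hsm))]
    refine ae_restrict_of_ae ?_
    filter_upwards [measure_eq_zero_iff_ae_notMem.1 hs0] with r hr
    simp [hr]
  rw [h2, mul_zero, lintegral_eq_zero_iff (f := fun x : E N => s.indicator (1 : ℝ → ℝ≥0∞) ‖x‖)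
    ((measurable_one.indicator hsm).comp measurable_norm)] at h1
  have h0 : ∀ᵐ x : E N, x ≠ 0 := by
    rw [ae_iff]; simp
  filter_upwards [h1, h0] with x hx hx0
  by_contra hP
  have hmem : ‖x‖ ∈ s := hs (by
    simp only [mem_ofPred_eq, Classical.not_imp]
    exact ⟨norm_pos_iff.2 hx0, hP⟩)
  simp [hmem] at hx

end

/-! ### Weak gradients -/

section

variable {N : ℕ}

/-- `G` is the distributional gradient of `u` on `U`. -/
def IsWeakGradientOn (U : Set (E N)) (u : E N → ℝ) (G : E N → E N) : Prop :=
  ∀ ψ : E N → ℝ, ContDiff ℝ ∞ ψ → HasCompactSupport ψ → tsupport ψ ⊆ U → ∀ e : E N,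
    ∫ x, ψ x * inner ℝ (G x) e = -∫ x, u x * fderiv ℝ ψ x e

theorem tendsto_integral_mul_of_L1_on_support {h : E N → ℝ} (hc : Continuous h) {K : Set (E N)}
    (hK : IsCompact K) (hsupp : ∀ x, x ∉ K → h x = 0) {A : ℕ → E N → ℝ} {B : E N → ℝ}
    (hA : ∀ n, IntegrableOn (A n) K) (hB : AEStronglyMeasurable B (volume.restrict K))
    (hlim : Tendsto (fun n => ∫⁻ x in K, ‖A n x - B x‖ₑ) atTop (𝓝 0)) :
    Tendsto (fun n => ∫ x, h x * A n x) atTop (𝓝 (∫ x, h x * B x)) := by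
  have hset : ∀ F : E N → ℝ, ∫ x, h x * F x = ∫ x in K, h x * F x := fun F =>
    (setIntegral_eq_integral_of_forall_compl_eq_zero fun x hx => by
      rw [hsupp x hx, zero_mul]).symm
  simp only [hset]
  obtain ⟨C, hC⟩ := hK.exists_bound_of_continuousOn hc.continuousOn
  refine tendsto_integral_of_L1 _ (hc.aestronglyMeasurable.mul hB)
    (Eventually.of_forall fun n => (hA n).continuousOn_mul hc.continuousOn hK) ?_
  refine tendsto_of_tendsto_of_tendsto_of_le_of_le tendsto_const_nhds
    (h := fun n => ENNReal.ofReal C * ∫⁻ x in K, ‖A n x - B x‖ₑ) ?_ (fun _ => zero_le)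
    fun n => ?_
  · simpa using ENNReal.Tendsto.const_mul hlim (Or.inr ENNReal.ofReal_ne_top)
  · beta_reduce
    rw [← lintegral_const_mul' _ _ ENNReal.ofReal_ne_top]
    refine setLIntegral_mono' hK.measurableSet fun x hx => ?_
    rw [Pi.mul_apply, ← mul_sub, enorm_mul]
    gcongr
    rw [← ofReal_norm]
    exact ENNReal.ofReal_le_ofReal (hC x hx)

/-- Integration by parts with regularity of `Φ` required only on the support of `ψ`. This allows
radial functions that are singular at the origin. -/
theorem integral_mul_inner_eq_neg {ψ Φ : E N → ℝ} {Γ : E N → E N} (hψ : ContDiff ℝ ∞ ψ)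
    (hψc : HasCompactSupport ψ) (hd : ∀ x ∈ tsupport ψ, HasGradientAt Φ (Γ x) x)
    (hΓ : ContinuousOn Γ (tsupport ψ)) (e : E N) :
    ∫ x, ψ x * inner ℝ (Γ x) e = -∫ x, Φ x * fderiv ℝ ψ x e := by
  have hK : IsCompact (tsupport ψ) := hψc
  have hΦ : ContinuousOn Φ (tsupport ψ) := fun x hx =>
    (hd x hx).differentiableAt.continuousAt.continuousWithinAt
  have hfd : ∀ x ∈ tsupport ψ, fderiv ℝ Φ x e = inner ℝ (Γ x) e := fun x hx => by
    rw [(hd x hx).hasFDerivAt.fderiv]; rfl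
  have hψ0 : ∀ x, x ∉ tsupport ψ → ψ x = 0 := fun x hx => image_eq_zero_of_notMem_tsupport hx
  have hψ' : Continuous fun x => fderiv ℝ ψ x e :=
    (hψ.continuous_fderiv (by simp)).clm_apply continuous_const
  have hψ'0 : ∀ x, x ∉ tsupport ψ → fderiv ℝ ψ x e = 0 := fun x hx => by
    rw [image_eq_zero_of_notMem_tsupport (f := fderiv ℝ ψ)
      (fun h => hx (tsupport_fderiv_subset ℝ h))]
    rfl
  have hint : ∀ {F : E N → ℝ}, ContinuousOn F (tsupport ψ) → (∀ x, x ∉ tsupport ψ → F x = 0) →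
      Integrable F := fun hF h0 =>
    (integrableOn_iff_integrable_of_support_subset fun x hx => by
      by_contra hx'; exact hx (h0 x hx')).1 (hF.integrableOn_compact hK)
  have key := integral_mul_fderiv_eq_neg_fderiv_mul_of_integrable (μ := volume) (f := ψ) (g := Φ)
    (v := e) (hint (hψ'.continuousOn.mul hΦ) fun x hx => by simp [hψ'0 x hx])
    ((hint (F := fun x => ψ x * inner ℝ (Γ x) e)
      (hψ.continuous.continuousOn.mul (hΓ.inner continuousOn_const))
      fun x hx => by simp [hψ0 x hx]).congr (Eventually.of_forall fun x => by
        by_cases hx : x ∈ tsupport ψ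
        · simp only [hfd x hx]
        · simp only [hψ0 x hx, zero_mul]))
    (hint (hψ.continuous.continuousOn.mul hΦ) fun x hx => by simp [hψ0 x hx])
    (fun x _ => hψ.differentiable (by simp) x) (fun x hx => (hd x hx).differentiableAt)
  calc ∫ x, ψ x * inner ℝ (Γ x) e = ∫ x, ψ x * fderiv ℝ Φ x e := by
        refine integral_congr_ae (Eventually.of_forall fun x => ?_)
        by_cases hx : x ∈ tsupport ψ
        · simp only [hfd x hx]
        · simp only [hψ0 x hx, zero_mul]
    _ = -∫ x, fderiv ℝ ψ x e * Φ x := key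
    _ = _ := by simp only [mul_comm]

/-- Weak gradients are closed under local `L^1` convergence. The approximants may depend on the
compact set, so no global approximation of a radial primitive is needed. -/
theorem isWeakGradientOn_of_tendsto {U : Set (E N)} {u : E N → ℝ} {G : E N → E N}
    (h : ∀ K : Set (E N), IsCompact K → K ⊆ U →
      AEStronglyMeasurable u (volume.restrict K) ∧ AEStronglyMeasurable G (volume.restrict K) ∧
      ∃ (Φ : ℕ → E N → ℝ) (Γ : ℕ → E N → E N),
        (∀ n, ∀ x ∈ K, HasGradientAt (Φ n) (Γ n x) x) ∧ (∀ n, ContinuousOn (Γ n) K) ∧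
        Tendsto (fun n => ∫⁻ x in K, ‖Φ n x - u x‖ₑ) atTop (𝓝 0) ∧
        Tendsto (fun n => ∫⁻ x in K, ‖Γ n x - G x‖ₑ) atTop (𝓝 0)) :
    IsWeakGradientOn U u G := by
  intro ψ hψ hψc hψU e
  have hK : IsCompact (tsupport ψ) := hψc
  obtain ⟨hu, hG, Φ, Γ, hd, hΓ, hΦl, hΓl⟩ := h _ hK hψU
  have hψ' : Continuous fun x => fderiv ℝ ψ x e :=
    (hψ.continuous_fderiv (by simp)).clm_apply continuous_const
  have hψ'0 : ∀ x, x ∉ tsupport ψ → fderiv ℝ ψ x e = 0 := fun x hx => by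
    rw [image_eq_zero_of_notMem_tsupport (f := fderiv ℝ ψ)
      (fun h => hx (tsupport_fderiv_subset ℝ h))]
    rfl
  have hΦc : ∀ n, ContinuousOn (Φ n) (tsupport ψ) := fun n x hx =>
    (hd n x hx).differentiableAt.continuousAt.continuousWithinAt
  have l1 := tendsto_integral_mul_of_L1_on_support (h := ψ) hψ.continuous hK
    (fun x hx => image_eq_zero_of_notMem_tsupport hx) (A := fun n x => inner ℝ (Γ n x) e)
    (B := fun x => inner ℝ (G x) e)
    (fun n => ((hΓ n).inner continuousOn_const).integrableOn_compact hK)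
    (hG.inner_const) (by
      refine tendsto_of_tendsto_of_tendsto_of_le_of_le tendsto_const_nhds
        (h := fun n => ‖e‖ₑ * ∫⁻ x in tsupport ψ, ‖Γ n x - G x‖ₑ) ?_ (fun _ => zero_le)
        fun n => ?_
      · simpa using ENNReal.Tendsto.const_mul hΓl (Or.inr enorm_ne_top)
      · beta_reduce
        rw [← lintegral_const_mul' _ _ enorm_ne_top]
        refine lintegral_mono fun x => ?_
        rw [← inner_sub_left, ← ofReal_norm, ← ofReal_norm,
          ← ofReal_norm, ← ENNReal.ofReal_mul (norm_nonneg _), mul_comm]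
        exact ENNReal.ofReal_le_ofReal (norm_inner_le_norm _ _))
  have l2 := tendsto_integral_mul_of_L1_on_support (h := fun x => fderiv ℝ ψ x e) hψ' hK hψ'0
    (A := Φ) (B := u) (fun n => (hΦc n).integrableOn_compact hK) hu hΦl
  have e1 : ∀ n, ∫ x, ψ x * inner ℝ (Γ n x) e = -∫ x, fderiv ℝ ψ x e * Φ n x := fun n => by
    rw [integral_mul_inner_eq_neg hψ hψc (hd n) (hΓ n) e]
    simp only [mul_comm]
  simp only [e1] at l1
  have := tendsto_nhds_unique l1 l2.neg
  rw [this]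
  simp only [mul_comm]

/-- The fundamental lemma of the calculus of variations, applied to each coordinate of `G - F`. -/
theorem IsWeakGradientOn.ae_eq {U : Set (E N)} (hU : IsOpen U) {u : E N → ℝ} {G F : E N → E N}
    (hG : IsWeakGradientOn U u G) (hF : IsWeakGradientOn U u F) (hGi : LocallyIntegrableOn G U)
    (hFi : LocallyIntegrableOn F U) : ∀ᵐ x, x ∈ U → G x = F x := by
  have hmul : ∀ {H : E N → E N}, LocallyIntegrableOn H U → ∀ ψ : E N → ℝ, Continuous ψ →
      HasCompactSupport ψ → tsupport ψ ⊆ U → ∀ e,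
      Integrable fun x => ψ x * inner ℝ (H x) e := by
    intro H hH ψ hψ hψc hψU e
    have hK : IsCompact (tsupport ψ) := hψc
    refine (integrableOn_iff_integrable_of_support_subset (s := tsupport ψ) fun x hx => ?_).1 ?_
    · by_contra hx'
      exact hx (by simp [image_eq_zero_of_notMem_tsupport hx'])
    · have h1 := hH.integrableOn_compact_subset hψU hK
      have h2 : IntegrableOn (fun x => inner ℝ (H x) e) (tsupport ψ) := h1.inner_const e
      exact h2.continuousOn_mul hψ.continuousOn hK
  have key : ∀ i : Fin N, ∀ᵐ x, x ∈ U →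
      inner ℝ (G x - F x) (EuclideanSpace.single i (1 : ℝ)) = 0 := by
    intro i
    refine hU.ae_eq_zero_of_integral_contDiff_smul_eq_zero ?_ fun ψ hψ hψc hψU => ?_
    · rw [locallyIntegrableOn_iff hU.isLocallyClosed]
      intro K hKU hK
      exact ((hGi.integrableOn_compact_subset hKU hK).sub
        (hFi.integrableOn_compact_subset hKU hK)).inner_const _
    · simp only [smul_eq_mul, inner_sub_left, mul_sub]
      rw [integral_sub (hmul hGi ψ hψ.continuous hψc hψU _)
        (hmul hFi ψ hψ.continuous hψc hψU _), hG ψ hψ hψc hψU, hF ψ hψ hψc hψU, sub_self]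
  filter_upwards [ae_all_iff.2 key] with x hx hxU
  have h0 : G x - F x = 0 := by
    ext i
    have := hx i hxU
    rw [EuclideanSpace.inner_single_right] at this
    simpa using this
  exact sub_eq_zero.1 h0

theorem hasGradientAt_norm {x : E N} (hx : x ≠ 0) :
    HasGradientAt (fun x : E N => ‖x‖) (‖x‖⁻¹ • x) x := by
  have hn : ‖x‖ ≠ 0 := norm_ne_zero_iff.2 hx
  have h := (hasStrictFDerivAt_norm_sq x).hasFDerivAt.sqrt (by positivity)
  rw [hasGradientAt_iff_hasFDerivAt]
  have e : (fun x : E N => √(‖x‖ ^ 2)) = fun x => ‖x‖ := by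
    funext y; exact Real.sqrt_sq (norm_nonneg y)
  rw [e] at h
  refine h.congr_fderiv ?_
  ext y
  rw [Real.sqrt_sq (norm_nonneg x)]
  simp
  ring

theorem hasGradientAt_comp_norm {f : ℝ → ℝ} {f' : ℝ} {x : E N} (hx : x ≠ 0)
    (hf : HasDerivAt f f' ‖x‖) :
    HasGradientAt (fun x : E N => f ‖x‖) (f' • (‖x‖⁻¹ • x)) x := by
  rw [hasGradientAt_iff_hasFDerivAt]
  have h := hf.comp_hasFDerivAt x (hasGradientAt_norm hx).hasFDerivAt
  exact h.congr_fderiv (by simp)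

theorem norm_radial_unit {x : E N} (hx : x ≠ 0) (a : ℝ) : ‖a • (‖x‖⁻¹ • x)‖ = |a| := by
  have hn : ‖x‖ ≠ 0 := norm_ne_zero_iff.2 hx
  rw [norm_smul, norm_smul, norm_inv, norm_norm, inv_mul_cancel₀ hn, mul_one, Real.norm_eq_abs]

end

/-! ### Weak gradients of Sobolev functions and of radial primitives. -/

section

variable {N : ℕ}

theorem HasGradientAt.of_contDiff {φ : E N → ℝ} (hφ : ContDiff ℝ ∞ φ) (x : E N) :
    HasGradientAt φ (gradient φ x) x :=
  (hφ.differentiable (by simp) x).hasGradientAt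

theorem continuous_gradient {φ : E N → ℝ} (hφ : ContDiff ℝ ∞ φ) : Continuous (gradient φ) :=
  (InnerProductSpace.toDual ℝ (E N)).symm.continuous.comp (hφ.continuous_fderiv (by simp))

theorem gradient_eq_zero_of_notMem_tsupport {φ : E N → ℝ} {x : E N} (hx : x ∉ tsupport φ) :
    gradient φ x = 0 := by
  rw [gradient, image_eq_zero_of_notMem_tsupport (f := fderiv ℝ φ)
    (fun h => hx (tsupport_fderiv_subset ℝ h)), map_zero]

/-- On a compact set Hölder's inequality turns the `L^p` convergence of the gradients into `L^1`
convergence. -/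
theorem MemHomSobolev.isWeakGradientOn {p : ℝ} (hp : 1 ≤ p) {Ω : Set (E N)} {u : E N → ℝ}
    {G : E N → E N} (h : MemHomSobolev p Ω u G) : IsWeakGradientOn Ω u G := by
  obtain ⟨φ, hφ, hG, hu⟩ := h.approx
  refine isWeakGradientOn_of_tendsto fun K hK hKΩ => ⟨?_, ?_, φ, fun n => gradient (φ n), ?_, ?_,
    ?_, ?_⟩
  · exact (h.locallyIntegrableOn.integrableOn_compact_subset hKΩ hK).aestronglyMeasurable
  · exact h.gradient_memLp.1.mono_set hKΩ
  · exact fun n x _ => HasGradientAt.of_contDiff (hφ n).smooth x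
  · exact fun n => (continuous_gradient (hφ n).smooth).continuousOn
  · simpa only [← Real.enorm_abs (_ - _), Real.enorm_of_nonneg (abs_nonneg _)] using hu K hKΩ hK
  · have hp1 : (1 : ℝ≥0∞) ≤ ENNReal.ofReal p := by
      rw [ENNReal.one_le_ofReal]; exact hp
    have hp0 : 0 < p := by linarith
    have : IsFiniteMeasure (volume.restrict K) :=
      ⟨by rw [Measure.restrict_apply_univ]; exact hK.measure_lt_top⟩
    have hfin : (volume.restrict K) univ ^
        (1 / (1 : ℝ≥0∞).toReal - 1 / (ENNReal.ofReal p).toReal) ≠ ⊤ := by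
      refine ENNReal.rpow_ne_top_of_nonneg ?_ (measure_ne_top _ _)
      rw [ENNReal.toReal_ofReal hp0.le, ENNReal.toReal_one, div_one, sub_nonneg, div_le_one hp0]
      exact hp
    have hlim := ENNReal.Tendsto.mul_const hG (Or.inr hfin)
    rw [zero_mul] at hlim
    refine tendsto_of_tendsto_of_tendsto_of_le_of_le tendsto_const_nhds hlim
      (fun _ => zero_le) fun n => ?_
    beta_reduce
    rw [← eLpNorm_one_eq_lintegral_enorm]
    refine (eLpNorm_le_eLpNorm_mul_rpow_measure_univ hp1
      ((continuous_gradient (hφ n).smooth).aestronglyMeasurable.sub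
        (h.gradient_memLp.1.mono_set hKΩ))).trans ?_
    exact mul_le_mul' (eLpNorm_mono_measure _ (Measure.restrict_mono hKΩ le_rfl)) le_rfl

/-- The radial function with radial derivative `g` that vanishes at infinity. -/
def tailIntegral (g : ℝ → ℝ) (r : ℝ) : ℝ := -∫ s in Ioi r, g s

theorem tailIntegral_eq_sub {g : ℝ → ℝ} {a b r : ℝ} (hg : IntegrableOn g (Ioi a)) (har : a ≤ r)
    (hrb : r ≤ b) : tailIntegral g r = tailIntegral g b - ∫ s in r..b, g s := by
  have hi : IntegrableOn g (Ioi r) := hg.mono_set (Ioi_subset_Ioi har)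
  have := setIntegral_union (Ioc_disjoint_Ioi le_rfl) measurableSet_Ioi
    (hi.mono_set (Ioc_subset_Ioi_self : Ioc r b ⊆ Ioi r)) (hi.mono_set (Ioi_subset_Ioi hrb))
  rw [Ioc_union_Ioi_eq_Ioi hrb, ← intervalIntegral.integral_of_le hrb] at this
  unfold tailIntegral
  rw [this]
  ring

theorem continuousOn_tailIntegral {g : ℝ → ℝ} {a : ℝ} (hg : IntegrableOn g (Ioi a)) :
    ContinuousOn (tailIntegral g) (Ici a) := by
  have h : ∀ r ∈ Ici a, tailIntegral g r = tailIntegral g a + ∫ s in a..r, g s := by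
    intro r hr
    rw [tailIntegral_eq_sub hg le_rfl hr]
    ring
  refine ContinuousOn.congr (f := fun r => tailIntegral g a + ∫ s in a..r, g s) ?_ h
  refine continuousOn_const.add ?_
  intro r hr
  have hr' : a ≤ r := hr
  have h1 := intervalIntegral.continuousOn_primitive_interval (a := a) (b := r + 1)
    (f := g) (μ := volume) (by
      rw [uIcc_of_le (by linarith), integrableOn_Icc_iff_integrableOn_Ioc]
      exact hg.mono_set Ioc_subset_Ioi_self)
  rw [uIcc_of_le (by linarith)] at h1
  refine (h1 r ⟨hr', by linarith⟩).mono_of_mem_nhdsWithin ?_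
  filter_upwards [self_mem_nhdsWithin, mem_nhdsWithin_of_mem_nhds (Iio_mem_nhds
    (show r < r + 1 by linarith))] with x hx hx'
  exact ⟨hx, le_of_lt hx'⟩

/-- A compact set avoiding the origin lies in an annulus. There `g` is approximated in `L^1` by
continuous functions, whose radial primitives are classically differentiable. -/
theorem isWeakGradientOn_tailIntegral (hN : 0 < N) {g : ℝ → ℝ} (hgm : Measurable g)
    (hg : ∀ a, 0 < a → IntegrableOn g (Ioi a)) :
    IsWeakGradientOn ({0}ᶜ : Set (E N)) (fun x => tailIntegral g ‖x‖)
      (fun x => g ‖x‖ • (‖x‖⁻¹ • x)) := by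
  refine isWeakGradientOn_of_tendsto fun K hK hK0 => ?_
  obtain ⟨a, b, ha, hab, hKab⟩ : ∃ a b, 0 < a ∧ a ≤ b ∧ ∀ x ∈ K, ‖x‖ ∈ Icc a b := by
    rcases K.eq_empty_or_nonempty with rfl | hne
    · exact ⟨1, 1, one_pos, le_rfl, by simp⟩
    obtain ⟨x, hx, hx'⟩ := hK.exists_isMinOn hne continuous_norm.continuousOn
    obtain ⟨y, hy, hy'⟩ := hK.exists_isMaxOn hne continuous_norm.continuousOn
    exact ⟨‖x‖, ‖y‖, norm_pos_iff.2 (hK0 hx), hy' hx, fun z hz => ⟨hx' hz, hy' hz⟩⟩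
  have hKne : ∀ x ∈ K, x ≠ 0 := fun x hx => hK0 hx
  have hgi : IntegrableOn g (Icc a b) := by
    rw [integrableOn_Icc_iff_integrableOn_Ioc]
    exact (hg a ha).mono_set Ioc_subset_Ioi_self
  choose γ _ hγ hγc _ using fun n : ℕ => Integrable.exists_hasCompactSupport_lintegral_sub_le hgi
    (ε := ENNReal.ofReal (1 / ((n : ℝ) + 1))) (by simp; positivity)
  have hε : Tendsto (fun n : ℕ => ENNReal.ofReal (1 / ((n : ℝ) + 1))) atTop (𝓝 0) := by
    rw [← ENNReal.ofReal_zero]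
    exact ENNReal.tendsto_ofReal tendsto_one_div_add_atTop_nhds_zero_nat
  -- Anchoring at the outer radius `b` leaves only the integral of `g - γ n` over `(r, b]` as error,
  -- which is uniformly small.
  set f : ℕ → ℝ → ℝ := fun n r => tailIntegral g b + ∫ s in b..r, γ n s with hf
  have hfd : ∀ n r, HasDerivAt (f n) (γ n r) r := fun n r =>
    ((hγc n).integral_hasStrictDerivAt b r).hasDerivAt.const_add _
  have hcont : ContinuousOn (fun x : E N => tailIntegral g ‖x‖) K :=
    (continuousOn_tailIntegral (hg a ha)).comp continuous_norm.continuousOn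
      fun x hx => (hKab x hx).1
  refine ⟨hcont.aestronglyMeasurable hK.measurableSet, ?_, fun n x => f n ‖x‖,
    fun n x => γ n ‖x‖ • (‖x‖⁻¹ • x), ?_, ?_, ?_, ?_⟩
  · have : Measurable fun x : E N => g ‖x‖ • (‖x‖⁻¹ • x) :=
      (hgm.comp measurable_norm).smul (measurable_norm.inv.smul measurable_id)
    exact this.aestronglyMeasurable
  · exact fun n x hx => hasGradientAt_comp_norm (hKne x hx) (hfd n _)
  · exact fun n => ((hγc n).comp continuous_norm).continuousOn.smul
      ((continuous_norm.continuousOn.inv₀ fun x hx => norm_ne_zero_iff.2 (hKne x hx)).smul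
        continuousOn_id)
  · have hle : ∀ n, ∀ r ∈ Icc a b, ‖f n r - tailIntegral g r‖ₑ ≤
        ENNReal.ofReal (1 / ((n : ℝ) + 1)) := by
      intro n r hr
      have hi1 : IntervalIntegrable g volume r b := by
        rw [intervalIntegrable_iff_integrableOn_Ioc_of_le hr.2]
        exact hgi.mono_set (Ioc_subset_Icc_self.trans (Icc_subset_Icc_left hr.1))
      have e : f n r - tailIntegral g r = ∫ s in Ioc r b, (g s - γ n s) := by
        simp only [hf]
        rw [tailIntegral_eq_sub (hg a ha) hr.1 hr.2, intervalIntegral.integral_symm,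
          ← intervalIntegral.integral_of_le hr.2,
          intervalIntegral.integral_sub hi1 ((hγc n).intervalIntegrable _ _)]
        ring
      rw [e]
      refine (enorm_integral_le_lintegral_enorm _).trans (le_trans ?_ (hγ n))
      exact lintegral_mono_set (Ioc_subset_Icc_self.trans (Icc_subset_Icc_left hr.1))
    refine tendsto_of_tendsto_of_tendsto_of_le_of_le tendsto_const_nhds
      (h := fun n : ℕ => ENNReal.ofReal (1 / ((n : ℝ) + 1)) * volume K) ?_ (fun _ => zero_le)
      fun n => ?_
    · simpa using ENNReal.Tendsto.mul_const hε (Or.inr hK.measure_lt_top.ne)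
    · beta_reduce
      rw [← setLIntegral_const]
      exact setLIntegral_mono' hK.measurableSet fun x hx => hle n _ (hKab x hx)
  · refine tendsto_of_tendsto_of_tendsto_of_le_of_le tendsto_const_nhds
      (h := fun n : ℕ => ENNReal.ofReal (sphereArea N) * (ENNReal.ofReal (b ^ (N - 1)) *
        ENNReal.ofReal (1 / ((n : ℝ) + 1)))) ?_ (fun _ => zero_le) fun n => ?_
    · have := ENNReal.Tendsto.const_mul (a := ENNReal.ofReal (sphereArea N))
        (ENNReal.Tendsto.const_mul (a := ENNReal.ofReal (b ^ (N - 1))) hε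
        (Or.inr ENNReal.ofReal_ne_top)) (Or.inr ENNReal.ofReal_ne_top)
      simpa using this
    · beta_reduce
      calc ∫⁻ x in K, ‖γ n ‖x‖ • (‖x‖⁻¹ • x) - g ‖x‖ • (‖x‖⁻¹ • x)‖ₑ
          = ∫⁻ x in K, ‖g ‖x‖ - γ n ‖x‖‖ₑ := by
            refine setLIntegral_congr_fun hK.measurableSet fun x hx => ?_
            rw [← sub_smul, ← ofReal_norm, norm_radial_unit (hKne x hx), abs_sub_comm,
              ← Real.norm_eq_abs, ofReal_norm]
        _ ≤ ∫⁻ x in (norm ⁻¹' (Icc a b) : Set (E N)), ‖g ‖x‖ - γ n ‖x‖‖ₑ :=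
            lintegral_mono_set hKab
        _ = ENNReal.ofReal (sphereArea N) * ∫⁻ r in Icc a b ∩ Ioi (0 : ℝ),
              ENNReal.ofReal (r ^ (N - 1)) * ‖g r - γ n r‖ₑ :=
            setLIntegral_radial hN (F := fun r => ‖g r - γ n r‖ₑ)
              (hgm.sub (hγc n).measurable).enorm measurableSet_Icc fun x => Iff.rfl
        _ ≤ _ := by
            gcongr
            calc ∫⁻ r in Icc a b ∩ Ioi (0 : ℝ), ENNReal.ofReal (r ^ (N - 1)) * ‖g r - γ n r‖ₑ
                ≤ ∫⁻ r in Icc a b, ENNReal.ofReal (r ^ (N - 1)) * ‖g r - γ n r‖ₑ :=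
                  lintegral_mono_set inter_subset_left
              _ ≤ ∫⁻ r in Icc a b, ENNReal.ofReal (b ^ (N - 1)) * ‖g r - γ n r‖ₑ := by
                  refine setLIntegral_mono' measurableSet_Icc fun r hr => ?_
                  gcongr
                  · exact ha.le.trans hr.1
                  · exact hr.2
              _ = ENNReal.ofReal (b ^ (N - 1)) * ∫⁻ r in Icc a b, ‖g r - γ n r‖ₑ :=
                  lintegral_const_mul' _ _ ENNReal.ofReal_ne_top
              _ ≤ _ := by gcongr; exact hγ n

end

/-! ### Radial elements of the homogeneous Sobolev space -/

section

/-- Fatou's lemma, replacing the extraction of an almost everywhere convergent subsequence. -/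
theorem ae_liminf_eq_zero {α : Type*} [MeasurableSpace α] {μ : Measure α} {A : ℕ → α → ℝ≥0∞}
    (hA : ∀ n, Measurable (A n)) (h : Tendsto (fun n => ∫⁻ x, A n x ∂μ) atTop (𝓝 0)) :
    ∀ᵐ x ∂μ, liminf (fun n => A n x) atTop = 0 := by
  have h1 : ∫⁻ x, liminf (fun n => A n x) atTop ∂μ ≤ 0 := by
    rw [← h.liminf_eq]
    exact lintegral_liminf_le hA
  exact (lintegral_eq_zero_iff (Measurable.liminf hA)).1 (le_antisymm h1 zero_le)

/-- The weighted energy `∫_0^∞ r^{N-1} |F(r)|^p dr`. -/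
def radialEnergy (N : ℕ) (p : ℝ) (F : ℝ → ℝ) : ℝ≥0∞ :=
  ∫⁻ r in Ioi (0 : ℝ), ENNReal.ofReal (r ^ (N - 1)) * ‖F r‖ₑ ^ p

/-- The weight that controls `∫_a^∞ |F|` by the radial energy of `F`. -/
def tailWeight (N : ℕ) (p : ℝ) (I : Set ℝ) (a : ℝ) : ℝ≥0∞ :=
  ∫⁻ r in I ∩ Ioi a, ENNReal.ofReal (r ^ (-(((N - 1 : ℕ) : ℝ) / (p - 1))))

variable {N : ℕ} {p : ℝ} {I : Set ℝ}

/-- Hölder after inserting `r^(k/p) r^(-k/p)` with `k = N - 1`. The conjugate power of the second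
factor is the tail weight. -/
theorem lintegral_Ioi_enorm_le (hp : 1 < p) (hI : MeasurableSet I) {F : ℝ → ℝ} (hF : Measurable F)
    (hFI : ∀ r, r ∉ I → F r = 0) {a : ℝ} (ha : 0 < a) :
    ∫⁻ r in Ioi a, ‖F r‖ₑ ≤
      radialEnergy N p F ^ (1 / p) * tailWeight N p I a ^ (1 / (p / (p - 1))) := by
  have h0 : 0 < p := by linarith
  have h3 : 0 < p - 1 := by linarith
  have hconj : p.HolderConjugate (p / (p - 1)) := Real.HolderConjugate.conjExponent hp
  set k : ℝ := ((N - 1 : ℕ) : ℝ) with hk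
  have hIm : MeasurableSet (I ∩ Ioi a) := hI.inter measurableSet_Ioi
  have e1 : ∫⁻ r in Ioi a, ‖F r‖ₑ = ∫⁻ r in I ∩ Ioi a, ‖F r‖ₑ := by
    rw [← Measure.restrict_restrict hI, ← lintegral_indicator hI]
    refine lintegral_congr fun r => ?_
    by_cases h : r ∈ I
    · rw [indicator_of_mem h]
    · rw [indicator_of_notMem h, hFI r h, enorm_zero]
  have e2 : ∫⁻ r in I ∩ Ioi a, ‖F r‖ₑ = ∫⁻ r in I ∩ Ioi a,
      ((fun r => ENNReal.ofReal (r ^ (k / p)) * ‖F r‖ₑ) *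
        fun r => ENNReal.ofReal (r ^ (-(k / p)))) r := by
    refine setLIntegral_congr_fun hIm fun r hr => ?_
    have hr0 : 0 < r := ha.trans hr.2
    simp only [Pi.mul_apply]
    rw [mul_right_comm, ← ENNReal.ofReal_mul (by positivity), ← Real.rpow_add hr0, add_neg_cancel,
      Real.rpow_zero, ENNReal.ofReal_one, one_mul]
  rw [e1, e2]
  refine (ENNReal.lintegral_mul_le_Lp_mul_Lq _ hconj
    (((measurable_id.pow_const _).ennreal_ofReal.mul hF.enorm).aemeasurable)
    (measurable_id.pow_const _).ennreal_ofReal.aemeasurable).trans ?_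
  refine mul_le_mul' (ENNReal.rpow_le_rpow ?_ (by positivity)) (ENNReal.rpow_le_rpow ?_ ?_)
  · refine le_trans (le_of_eq ?_) (lintegral_mono_set
      (inter_subset_right.trans (Ioi_subset_Ioi ha.le) : I ∩ Ioi a ⊆ Ioi 0))
    refine setLIntegral_congr_fun hIm fun r hr => ?_
    have hr0 : 0 < r := ha.trans hr.2
    simp only [Pi.mul_apply, id]
    rw [ENNReal.mul_rpow_of_nonneg _ _ h0.le, ENNReal.ofReal_rpow_of_nonneg (by positivity) h0.le,
      ← Real.rpow_mul hr0.le, div_mul_cancel₀ _ h0.ne', hk, Real.rpow_natCast]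
  · refine le_of_eq (setLIntegral_congr_fun hIm fun r hr => ?_)
    have hr0 : 0 < r := ha.trans hr.2
    have : 0 ≤ p / (p - 1) := by positivity
    simp only [id]
    rw [ENNReal.ofReal_rpow_of_nonneg (by positivity) this, ← Real.rpow_mul hr0.le]
    congr 2
    rw [← hk]
    field_simp
  · positivity

theorem integrableOn_of_radialEnergy_lt_top (hp : 1 < p) (hI : MeasurableSet I) {F : ℝ → ℝ}
    (hF : Measurable F) (hFI : ∀ r, r ∉ I → F r = 0) (hE : radialEnergy N p F < ⊤) {a : ℝ}
    (ha : 0 < a) (hW : tailWeight N p I a < ⊤) : IntegrableOn F (Ioi a) := by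
  have h0 : 0 < p := by linarith
  have h3 : 0 < p - 1 := by linarith
  refine ⟨hF.aestronglyMeasurable, ?_⟩
  refine (lintegral_Ioi_enorm_le (N := N) hp hI hF hFI ha).trans_lt ?_
  exact ENNReal.mul_lt_top (ENNReal.rpow_lt_top_of_nonneg (by positivity) hE.ne)
    (ENNReal.rpow_lt_top_of_nonneg (by positivity) hW.ne)

theorem tailIntegral_sub {f g : ℝ → ℝ} {r : ℝ} (hf : IntegrableOn f (Ioi r))
    (hg : IntegrableOn g (Ioi r)) :
    tailIntegral f r - tailIntegral g r = tailIntegral (fun s => f s - g s) r := by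
  unfold tailIntegral
  rw [integral_sub hf hg]
  ring

/-- The `L^1` distance from `U` to the tail integral of `γ` is bounded by an expression in the
`n`-th error that vanishes with it. A zero `liminf` makes that error arbitrarily small for some `n`.
-/
theorem ae_eq_tailIntegral_of_liminf (hp : 1 < p) (hI : MeasurableSet I) {a b : ℝ} (ha : 0 < a)
    (hW : tailWeight N p I a < ⊤) {h' : ℕ → ℝ → ℝ} {γ U : ℝ → ℝ}
    (hh : ∀ n, Measurable (h' n)) (hhi : ∀ n, IntegrableOn (h' n) (Ioi a)) (hγ : Measurable γ)
    (hU : Measurable U) (hhI : ∀ n r, r ∉ I → h' n r = 0) (hγI : ∀ r, r ∉ I → γ r = 0)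
    (hE : radialEnergy N p γ < ⊤)
    (hlim : liminf (fun n => radialEnergy N p (fun r => h' n r - γ r) +
      ∫⁻ r in Icc a b, ENNReal.ofReal (r ^ (N - 1)) * ‖tailIntegral (h' n) r - U r‖ₑ) atTop = 0) :
    ∀ᵐ r ∂(volume.restrict (Icc a b)), U r = tailIntegral γ r := by
  have h0 : 0 < p := by linarith
  have h3 : 0 < p - 1 := by linarith
  have hγi := integrableOn_of_radialEnergy_lt_top hp hI hγ hγI hE ha hW
  have hmeas : AEMeasurable (fun r => U r - tailIntegral γ r) (volume.restrict (Icc a b)) :=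
    hU.aemeasurable.sub (((continuousOn_tailIntegral hγi).mono Icc_subset_Ici_self).aemeasurable
      measurableSet_Icc)
  set X : ℕ → ℝ≥0∞ := fun n => radialEnergy N p (fun r => h' n r - γ r) +
      ∫⁻ r in Icc a b, ENNReal.ofReal (r ^ (N - 1)) * ‖tailIntegral (h' n) r - U r‖ₑ with hX
  set w : ℝ≥0∞ := tailWeight N p I a ^ (1 / (p / (p - 1))) with hw
  have hwfin : w ≠ ⊤ := (ENNReal.rpow_lt_top_of_nonneg (by positivity) hW.ne).ne
  -- On `[a, b]` the weight `r^(N-1)` is at least `a^(N-1)`, so it can be removed at the cost of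
  -- `c`.
  set c : ℝ≥0∞ := (ENNReal.ofReal (a ^ (N - 1)))⁻¹ with hc
  have hcpos : ENNReal.ofReal (a ^ (N - 1)) ≠ 0 := by simp; positivity
  have hcfin : c ≠ ⊤ := ENNReal.inv_ne_top.2 hcpos
  have hle : ∀ n, ∫⁻ r in Icc a b, ‖U r - tailIntegral γ r‖ₑ ≤
      c * X n + X n ^ (1 / p) * w * volume (Icc a b) := by
    intro n
    have hsubi : IntegrableOn (fun s => h' n s - γ s) (Ioi a) := (hhi n).sub hγi
    have hcont : AEMeasurable (fun r => ‖tailIntegral (h' n) r - U r‖ₑ)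
        (volume.restrict (Icc a b)) :=
      ((((continuousOn_tailIntegral (hhi n)).mono Icc_subset_Ici_self).aemeasurable
        measurableSet_Icc).sub hU.aemeasurable).enorm
    calc ∫⁻ r in Icc a b, ‖U r - tailIntegral γ r‖ₑ
        ≤ ∫⁻ r in Icc a b, (‖tailIntegral (h' n) r - U r‖ₑ +
            radialEnergy N p (fun r => h' n r - γ r) ^ (1 / p) * w) := by
          refine setLIntegral_mono' measurableSet_Icc fun r hr => ?_
          have e : U r - tailIntegral γ r = -(tailIntegral (h' n) r - U r) +
              tailIntegral (fun s => h' n s - γ s) r := by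
            rw [← tailIntegral_sub ((hhi n).mono_set (Ioi_subset_Ioi hr.1))
              (hγi.mono_set (Ioi_subset_Ioi hr.1))]
            ring
          rw [e]
          refine (enorm_add_le _ _).trans ?_
          rw [enorm_neg]
          gcongr
          unfold tailIntegral
          rw [enorm_neg]
          refine (enorm_integral_le_lintegral_enorm _).trans ?_
          refine (lintegral_mono_set (Ioi_subset_Ioi hr.1)).trans ?_
          exact lintegral_Ioi_enorm_le hp hI ((hh n).sub hγ)
            (fun s hs => by rw [Pi.sub_apply, hhI n s hs, hγI s hs, sub_zero]) ha
      _ = (∫⁻ r in Icc a b, ‖tailIntegral (h' n) r - U r‖ₑ) +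
            radialEnergy N p (fun r => h' n r - γ r) ^ (1 / p) * w * volume (Icc a b) := by
          rw [lintegral_add_left' hcont, setLIntegral_const]
      _ ≤ _ := by
          have l1 : ∫⁻ r in Icc a b, ‖tailIntegral (h' n) r - U r‖ₑ ≤ c * X n := by
            calc ∫⁻ r in Icc a b, ‖tailIntegral (h' n) r - U r‖ₑ
                ≤ ∫⁻ r in Icc a b, c * (ENNReal.ofReal (r ^ (N - 1)) *
                    ‖tailIntegral (h' n) r - U r‖ₑ) := by
                  refine setLIntegral_mono' measurableSet_Icc fun r hr => ?_
                  rw [← mul_assoc]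
                  have : 1 ≤ c * ENNReal.ofReal (r ^ (N - 1)) := by
                    rw [← ENNReal.inv_mul_cancel hcpos ENNReal.ofReal_ne_top]
                    gcongr
                    exact hr.1
                  calc _ = 1 * ‖tailIntegral (h' n) r - U r‖ₑ := (one_mul _).symm
                    _ ≤ _ := by gcongr
              _ = c * ∫⁻ r in Icc a b, ENNReal.ofReal (r ^ (N - 1)) *
                    ‖tailIntegral (h' n) r - U r‖ₑ := lintegral_const_mul' _ _ hcfin
              _ ≤ _ := by gcongr; exact le_add_self
          gcongr
          exact le_self_add
  have hzero : ∫⁻ r in Icc a b, ‖U r - tailIntegral γ r‖ₑ = 0 := by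
    by_contra hne
    have hlim0 : Tendsto (fun x : ℝ≥0∞ => c * x + x ^ (1 / p) * w * volume (Icc a b)) (𝓝 0)
        (𝓝 0) := by
      have t1 : Tendsto (fun x : ℝ≥0∞ => c * x) (𝓝 0) (𝓝 0) := by
        simpa using ENNReal.Tendsto.const_mul (tendsto_id (x := 𝓝 (0 : ℝ≥0∞))) (Or.inr hcfin)
      have t2 : Tendsto (fun x : ℝ≥0∞ => x ^ (1 / p)) (𝓝 0) (𝓝 0) := by
        have := (ENNReal.continuous_rpow_const (y := 1 / p)).tendsto 0
        rwa [ENNReal.zero_rpow_of_pos (by positivity)] at this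
      have t3 : Tendsto (fun x : ℝ≥0∞ => x ^ (1 / p) * w) (𝓝 0) (𝓝 0) := by
        simpa using ENNReal.Tendsto.mul_const t2 (Or.inr hwfin)
      have t4 := ENNReal.Tendsto.mul_const t3
        (Or.inr (measure_Icc_lt_top (μ := volume) (a := a) (b := b)).ne)
      rw [zero_mul] at t4
      simpa using t1.add t4
    have hev := hlim0.eventually (gt_mem_nhds (pos_iff_ne_zero.2 hne))
    rw [ENNReal.nhds_zero_basis.eventually_iff] at hev
    obtain ⟨η, hη, hev⟩ := hev
    have hfreq : ∃ᶠ n in atTop, X n < η := by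
      refine frequently_lt_of_liminf_lt (by isBoundedDefault) ?_
      rw [hlim]; exact hη
    obtain ⟨n, hn⟩ := hfreq.exists
    exact absurd (hle n) (not_le.2 (hev hn))
  have := (lintegral_eq_zero_iff' hmeas.enorm).1 hzero
  filter_upwards [this] with r hr
  simpa [sub_eq_zero] using hr

end

/-! ### Sobolev functions along rays. -/

section

variable {N : ℕ} {p : ℝ} {I : Set ℝ}

/-- A test function restricted to a ray. -/
theorem tailIntegral_ray {φ : E N → ℝ} (hφ : ContDiff ℝ ∞ φ) (hφc : HasCompactSupport φ)
    {σ : E N} (hσ : ‖σ‖ = 1) (r : ℝ) :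
    tailIntegral (fun s => inner ℝ (gradient φ (s • σ)) σ) r = φ (r • σ) := by
  have hσ0 : σ ≠ 0 := by rintro rfl; simp at hσ
  have hc : ContDiff ℝ 1 fun s : ℝ => φ (s • σ) :=
    (hφ.of_le (by simp)).comp (contDiff_id.smul contDiff_const)
  have hcs : HasCompactSupport fun s : ℝ => φ (s • σ) :=
    hφc.comp_isClosedEmbedding (isClosedEmbedding_smul_left hσ0)
  have hd : deriv (fun s : ℝ => φ (s • σ)) = fun s => inner ℝ (gradient φ (s • σ)) σ := by
    funext s
    have h1 : HasDerivAt (fun s : ℝ => s • σ) σ s := by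
      simpa using (hasDerivAt_id s).smul_const σ
    have h2 := (HasGradientAt.of_contDiff hφ (s • σ)).hasFDerivAt.comp_hasDerivAt s h1
    have h3 : HasDerivAt (fun s : ℝ => φ (s • σ)) _ s := h2
    rw [h3.deriv]
    rfl
  have := hcs.integral_Ioi_deriv_eq hc r
  rw [hd] at this
  unfold tailIntegral
  rw [this, neg_neg]

theorem norm_smul_sphere {σ : E N} (hσ : ‖σ‖ = 1) {s : ℝ} (hs : 0 ≤ s) : ‖s • σ‖ = s := by
  rw [norm_smul, hσ, mul_one, Real.norm_of_nonneg hs]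

theorem enorm_inner_sphere_le {σ : E N} (hσ : ‖σ‖ = 1) (x : E N) : ‖inner ℝ x σ‖ₑ ≤ ‖x‖ₑ := by
  rw [← ofReal_norm, ← ofReal_norm]
  refine ENNReal.ofReal_le_ofReal ((norm_inner_le_norm _ _).trans ?_)
  rw [hσ, mul_one]

theorem tendsto_lintegral_of_tendsto_eLpNorm (hp : 0 < p) {α F : Type*} [MeasurableSpace α]
    [NormedAddCommGroup F] {μ : Measure α} {f : ℕ → α → F}
    (h : Tendsto (fun n => eLpNorm (f n) (ENNReal.ofReal p) μ) atTop (𝓝 0)) :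
    Tendsto (fun n => ∫⁻ x, ‖f n x‖ₑ ^ p ∂μ) atTop (𝓝 0) := by
  have e : ∀ n, ∫⁻ x, ‖f n x‖ₑ ^ p ∂μ = eLpNorm (f n) (ENNReal.ofReal p) μ ^ p := by
    intro n
    rw [eLpNorm_eq_lintegral_rpow_enorm_toReal (by simpa using hp) ENNReal.ofReal_ne_top,
      ENNReal.toReal_ofReal hp.le, ← ENNReal.rpow_mul, one_div_mul_cancel hp.ne', ENNReal.rpow_one]
  simp only [e]
  have := ((ENNReal.continuous_rpow_const (y := p)).tendsto 0).comp h
  rwa [ENNReal.zero_rpow_of_pos hp] at this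

/-- The radial derivative of a function along the ray of direction `σ`, when its gradient is `G`
on `{x | ‖x‖ ∈ I}`. -/
def rayDerivative (I : Set ℝ) (G : E N → E N) (σ : E N) : ℝ → ℝ :=
  (I ∩ Ioi 0).indicator fun s => inner ℝ (G (s • σ)) σ

theorem measurable_rayDerivative (hI : MeasurableSet I) {G : E N → E N} (hG : Measurable G)
    (σ : E N) : Measurable (rayDerivative I G σ) :=
  ((hG.comp (measurable_id.smul_const σ)).inner_const).indicator (hI.inter measurableSet_Ioi)

/-- Because `|G · σ| ≤ |G|`. Integrated over the sphere, the right side is the full energy in polar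
coordinates. -/
theorem radialEnergy_rayDerivative_le (hp : 0 < p) {Ω : Set (E N)} (hΩ : ∀ x, x ∈ Ω ↔ ‖x‖ ∈ I)
    {G : E N → E N} {σ : E N} (hσ : ‖σ‖ = 1) :
    radialEnergy N p (rayDerivative I G σ) ≤ ∫⁻ r in Ioi (0 : ℝ), ENNReal.ofReal (r ^ (N - 1)) *
      Ω.indicator (fun x => ‖G x‖ₑ ^ p) (r • σ) := by
  refine setLIntegral_mono' measurableSet_Ioi fun r hr => ?_
  have hr0 : 0 < r := hr
  refine mul_le_mul' le_rfl ?_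
  by_cases h : r ∈ I
  · have hm : r • σ ∈ Ω := by rw [hΩ, norm_smul_sphere hσ hr0.le]; exact h
    rw [rayDerivative, indicator_of_mem (show r ∈ I ∩ Ioi 0 from ⟨h, hr⟩), indicator_of_mem hm]
    exact ENNReal.rpow_le_rpow (enorm_inner_sphere_le hσ _) hp.le
  · rw [rayDerivative, indicator_of_notMem (fun h' => h h'.1), enorm_zero,
      ENNReal.zero_rpow_of_pos hp]
    exact zero_le

theorem rayDerivative_sub (G F : E N → E N) (σ : E N) (r : ℝ) :
    rayDerivative I G σ r - rayDerivative I F σ r = rayDerivative I (fun x => G x - F x) σ r := by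
  unfold rayDerivative
  by_cases h : r ∈ I ∩ Ioi 0
  · simp only [indicator_of_mem h, inner_sub_left]
  · simp only [indicator_of_notMem h, sub_zero]

/-- Cutting the ray derivative off outside `I` changes nothing, since the gradient of a test
function vanishes outside `Ω`. -/
theorem tailIntegral_rayDerivative {Ω : Set (E N)} (hΩ : ∀ x, x ∈ Ω ↔ ‖x‖ ∈ I) {φ : E N → ℝ}
    (hφ : IsTestFunction Ω φ) {σ : E N} (hσ : ‖σ‖ = 1) {r : ℝ} (hr : 0 < r) :
    tailIntegral (rayDerivative I (gradient φ) σ) r = φ (r • σ) := by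
  rw [← tailIntegral_ray hφ.smooth hφ.compactSupport hσ r]
  unfold tailIntegral
  congr 1
  refine setIntegral_congr_fun measurableSet_Ioi fun s hs => ?_
  have hs0 : 0 < s := hr.trans hs
  by_cases h : s ∈ I
  · rw [rayDerivative, indicator_of_mem (show s ∈ I ∩ Ioi 0 from ⟨h, hs0⟩)]
  · rw [rayDerivative, indicator_of_notMem (fun h' => h h'.1),
      gradient_eq_zero_of_notMem_tsupport, inner_zero_left]
    intro h'
    have := (hΩ _).1 (hφ.support_subset h')
    rw [norm_smul_sphere hσ hs0.le] at this
    exact h this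

theorem integrableOn_rayDerivative (hI : MeasurableSet I) {Ω : Set (E N)} {φ : E N → ℝ}
    (hφ : IsTestFunction Ω φ) {σ : E N} (hσ : ‖σ‖ = 1) (a : ℝ) :
    IntegrableOn (rayDerivative I (gradient φ) σ) (Ioi a) := by
  have hσ0 : σ ≠ 0 := by rintro rfl; simp at hσ
  have hc : Continuous fun s : ℝ => inner ℝ (gradient φ (s • σ)) σ :=
    ((continuous_gradient hφ.smooth).comp (continuous_id.smul continuous_const)).inner
      continuous_const
  have hcs : HasCompactSupport (gradient φ) := hφ.compactSupport.mono' fun x hx => by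
    by_contra h
    exact hx (gradient_eq_zero_of_notMem_tsupport h)
  have hcs' : HasCompactSupport fun s : ℝ => inner ℝ (gradient φ (s • σ)) σ :=
    (hcs.comp_isClosedEmbedding (isClosedEmbedding_smul_left hσ0)).comp_left
      (g := fun y => inner ℝ y σ) (inner_zero_left _)
  exact ((hc.integrable_of_hasCompactSupport hcs').indicator
    (hI.inter measurableSet_Ioi)).integrableOn

/-- Almost every ray is a good ray: along it, `u` is the integral of its radial derivative. -/
theorem MemHomSobolev.ae_ray (hN : 0 < N) (hp : 1 < p) (hI : IsOpen I) {Ω : Set (E N)}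
    (hΩ : ∀ x, x ∈ Ω ↔ ‖x‖ ∈ I) (hW : ∀ a, 0 < a → tailWeight N p I a < ⊤) {u : E N → ℝ}
    {G : E N → E N} (hum : Measurable u) (hGm : Measurable G) (h : MemHomSobolev p Ω u G) :
    ∀ᵐ σ : Metric.sphere (0 : E N) 1 ∂(sphereMeasure N),
      radialEnergy N p (rayDerivative I G σ) < ⊤ ∧
      ∀ᵐ r ∂(volume.restrict (I ∩ Ioi (0 : ℝ))),
        u (r • (σ : E N)) = tailIntegral (rayDerivative I G σ) r := by
  have h0 : 0 < p := by linarith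
  have hΩ' : Ω = norm ⁻¹' I := by ext x; exact hΩ x
  have hΩo : IsOpen Ω := hΩ' ▸ hI.preimage continuous_norm
  obtain ⟨φ, hφ, hG, hu⟩ := h.approx
  have hray : ∀ {F : E N → ℝ≥0∞}, Measurable F → Measurable fun σ : Metric.sphere (0 : E N) 1 =>
      ∫⁻ r in Ioi (0 : ℝ), ENNReal.ofReal (r ^ (N - 1)) * F (r • (σ : E N)) := by
    intro F hF
    have hm : Measurable (Function.uncurry fun (σ : Metric.sphere (0 : E N) 1) (r : ℝ) =>
        ENNReal.ofReal (r ^ (N - 1)) * F (r • (σ : E N))) :=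
      ((measurable_snd.pow_const _).ennreal_ofReal).mul
        (hF.comp (measurable_snd.smul (measurable_subtype_coe.comp measurable_fst)))
    exact hm.lintegral_prod_right
  have hgm : ∀ n, Measurable (gradient (φ n)) := fun n =>
    (continuous_gradient (hφ n).smooth).measurable
  -- finiteness of the energy
  have hfin : ∀ᵐ σ : Metric.sphere (0 : E N) 1 ∂(sphereMeasure N),
      radialEnergy N p (rayDerivative I G σ) < ⊤ := by
    have hFm : Measurable (Ω.indicator fun x => ‖G x‖ₑ ^ p) :=
      (hGm.enorm.pow_const _).indicator hΩo.measurableSet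
    have h1 : ∫⁻ x, Ω.indicator (fun x => ‖G x‖ₑ ^ p) x ≠ ⊤ := by
      rw [lintegral_indicator hΩo.measurableSet]
      have := lintegral_rpow_enorm_lt_top_of_eLpNorm_lt_top (by simpa using h0)
        ENNReal.ofReal_ne_top h.gradient_memLp.2
      rw [ENNReal.toReal_ofReal h0.le] at this
      exact this.ne
    rw [lintegral_polar hN hFm] at h1
    filter_upwards [ae_lt_top (hray hFm) h1] with σ hσ
    exact (radialEnergy_rayDerivative_le h0 hΩ (norm_eq_of_mem_sphere σ)).trans_lt hσ
  -- convergence on compact intervals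
  have hint : ∀ a b : ℝ, 0 < a → Icc a b ⊆ I →
      ∀ᵐ σ : Metric.sphere (0 : E N) 1 ∂(sphereMeasure N),
        radialEnergy N p (rayDerivative I G σ) < ⊤ →
        ∀ᵐ r ∂(volume.restrict (Icc a b)),
          u (r • (σ : E N)) = tailIntegral (rayDerivative I G σ) r := by
    intro a b ha hab
    set K : Set (E N) := norm ⁻¹' (Icc a b) with hK
    have hKm : MeasurableSet K := measurable_norm measurableSet_Icc
    have hKc : IsCompact K := by
      refine Metric.isCompact_of_isClosed_isBounded (isClosed_Icc.preimage continuous_norm) ?_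
      refine (Metric.isBounded_closedBall (x := (0 : E N)) (r := b)).subset fun x hx => ?_
      simpa using hx.2
    have hKΩ : K ⊆ Ω := fun x hx => (hΩ x).2 (hab hx)
    have hA1 : ∀ n, Measurable (Ω.indicator fun x => ‖gradient (φ n) x - G x‖ₑ ^ p) := fun n =>
      (((hgm n).sub hGm).enorm.pow_const _).indicator hΩo.measurableSet
    have hA2 : ∀ n, Measurable (K.indicator fun x => ‖φ n x - u x‖ₑ) := fun n =>
      ((hφ n).smooth.continuous.measurable.sub hum).enorm.indicator hKm
    -- Gradient and function errors are summed, so that one `liminf` on a ray controls both along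
    -- the same indices.
    have hlim : Tendsto (fun n => ∫⁻ σ : Metric.sphere (0 : E N) 1,
        ((∫⁻ r in Ioi (0 : ℝ), ENNReal.ofReal (r ^ (N - 1)) *
          Ω.indicator (fun x => ‖gradient (φ n) x - G x‖ₑ ^ p) (r • (σ : E N))) +
        (∫⁻ r in Ioi (0 : ℝ), ENNReal.ofReal (r ^ (N - 1)) *
          K.indicator (fun x => ‖φ n x - u x‖ₑ) (r • (σ : E N)))) ∂(sphereMeasure N))
        atTop (𝓝 0) := by
      have e : ∀ n, ∫⁻ σ : Metric.sphere (0 : E N) 1,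
        ((∫⁻ r in Ioi (0 : ℝ), ENNReal.ofReal (r ^ (N - 1)) *
          Ω.indicator (fun x => ‖gradient (φ n) x - G x‖ₑ ^ p) (r • (σ : E N))) +
        (∫⁻ r in Ioi (0 : ℝ), ENNReal.ofReal (r ^ (N - 1)) *
          K.indicator (fun x => ‖φ n x - u x‖ₑ) (r • (σ : E N)))) ∂(sphereMeasure N) =
          (∫⁻ x in Ω, ‖gradient (φ n) x - G x‖ₑ ^ p) + ∫⁻ x in K, ‖φ n x - u x‖ₑ := by
        intro n
        rw [lintegral_add_left (hray (hA1 n)), ← lintegral_polar hN (hA1 n),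
          ← lintegral_polar hN (hA2 n), lintegral_indicator hΩo.measurableSet,
          lintegral_indicator hKm]
      simp only [e]
      have t2 := hu K hKΩ hKc
      simp only [← Real.norm_eq_abs, ofReal_norm] at t2
      simpa using (tendsto_lintegral_of_tendsto_eLpNorm h0 hG).add t2
    filter_upwards [ae_liminf_eq_zero (fun n => (hray (hA1 n)).add (hray (hA2 n))) hlim]
      with σ hσ hσfin
    have hσ1 : ‖(σ : E N)‖ = 1 := norm_eq_of_mem_sphere σ
    refine ae_eq_tailIntegral_of_liminf (N := N) (I := I) hp hI.measurableSet ha (hW a ha)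
      (h' := fun n => rayDerivative I (gradient (φ n)) σ)
      (fun n => measurable_rayDerivative hI.measurableSet (hgm n) _)
      (fun n => integrableOn_rayDerivative hI.measurableSet (hφ n) hσ1 a)
      (measurable_rayDerivative hI.measurableSet hGm _)
      (hum.comp (measurable_id.smul_const (σ : E N)))
      (fun n r hr => indicator_of_notMem (fun h' => hr h'.1) _)
      (fun r hr => indicator_of_notMem (fun h' => hr h'.1) _) hσfin ?_
    refine le_antisymm ?_ zero_le
    rw [← hσ]
    refine liminf_le_liminf (Eventually.of_forall fun n => add_le_add ?_ ?_)
    · simp only [rayDerivative_sub]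
      exact radialEnergy_rayDerivative_le h0 hΩ hσ1
    · have hsub : Icc a b ⊆ Ioi 0 := fun r hr => ha.trans_le hr.1
      refine le_trans (le_of_eq ?_) (lintegral_mono_set hsub)
      refine setLIntegral_congr_fun measurableSet_Icc fun r hr => ?_
      have hr0 : 0 < r := hsub hr
      have hm : r • (σ : E N) ∈ K := by
        rw [hK, mem_preimage, norm_smul_sphere hσ1 hr0.le]; exact hr
      beta_reduce
      rw [tailIntegral_rayDerivative hΩ (hφ n) hσ1 hr0, indicator_of_mem hm]
  -- Rational endpoints leave only countably many exceptional null sets of directions, while the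
  -- corresponding intervals still cover `I ∩ (0, ∞)`.
  have hall : ∀ᵐ σ : Metric.sphere (0 : E N) 1 ∂(sphereMeasure N), ∀ a b : ℚ, (0 : ℝ) < a →
      Icc (a : ℝ) b ⊆ I → radialEnergy N p (rayDerivative I G σ) < ⊤ →
        ∀ᵐ r ∂(volume.restrict (Icc (a : ℝ) b)),
          u (r • (σ : E N)) = tailIntegral (rayDerivative I G σ) r := by
    rw [ae_all_iff]; intro a
    rw [ae_all_iff]; intro b
    by_cases ha : (0 : ℝ) < a
    · by_cases hab : Icc (a : ℝ) b ⊆ I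
      · filter_upwards [hint a b ha hab] with σ hσ _ _ using hσ
      · exact Eventually.of_forall fun σ _ h' => absurd h' hab
    · exact Eventually.of_forall fun σ h' => absurd h' ha
  filter_upwards [hfin, hall] with σ hσ1 hσ2
  refine ⟨hσ1, ?_⟩
  have hcover : I ∩ Ioi (0 : ℝ) ⊆ ⋃ q : {q : ℚ × ℚ // (0 : ℝ) < q.1 ∧ Icc (q.1 : ℝ) q.2 ⊆ I},
      Icc (q.1.1 : ℝ) q.1.2 := by
    rintro r ⟨hr, hr0⟩
    have hr0' : 0 < r := hr0
    obtain ⟨ε, hε, hball⟩ := Metric.isOpen_iff.1 hI r hr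
    obtain ⟨a, ha1, ha2⟩ := exists_rat_btwn (show max 0 (r - ε) < r from max_lt hr0' (by linarith))
    obtain ⟨b, hb1, hb2⟩ := exists_rat_btwn (show r < r + ε by linarith)
    rw [max_lt_iff] at ha1
    refine mem_iUnion.2 ⟨⟨(a, b), ha1.1, fun s hs => hball ?_⟩, ha2.le, hb1.le⟩
    rw [Metric.mem_ball, Real.dist_eq, abs_lt]
    constructor <;> linarith [hs.1, hs.2]
  refine ae_restrict_of_ae_restrict_of_subset hcover ?_
  rw [ae_restrict_iUnion_iff]
  exact fun q => hσ2 q.1.1 q.1.2 q.2.1 q.2.2 hσ1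

end

/-! ### The radial profile of a Sobolev function and its gradient. -/

section

variable {N : ℕ} {p : ℝ} {I : Set ℝ}

theorem MemHomSobolev.congr {Ω : Set (E N)} {u u' : E N → ℝ}
    {G G' : E N → E N} (h : MemHomSobolev p Ω u G) (hu : u =ᵐ[volume.restrict Ω] u')
    (hG : G =ᵐ[volume.restrict Ω] G') : MemHomSobolev p Ω u' G' := by
  obtain ⟨φ, hφ, hGl, hul⟩ := h.approx
  refine ⟨?_, h.gradient_memLp.ae_eq hG, φ, hφ, ?_, ?_⟩
  · intro x hx
    obtain ⟨s, hs, hi⟩ := h.locallyIntegrableOn x hx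
    refine ⟨s ∩ Ω, inter_mem hs self_mem_nhdsWithin, ?_⟩
    exact (hi.mono_set inter_subset_left).congr_fun_ae
      (ae_restrict_of_ae_restrict_of_subset inter_subset_right hu)
  · refine hGl.congr fun n => eLpNorm_congr_ae ?_
    filter_upwards [hG] with x hx
    rw [hx]
  · intro K hKΩ hK
    refine (hul K hKΩ hK).congr fun n => lintegral_congr_ae ?_
    filter_upwards [ae_restrict_of_ae_restrict_of_subset hKΩ hu] with x hx
    rw [hx]

theorem IsWeakGradientOn.mono {U V : Set (E N)} (hUV : U ⊆ V) {u : E N → ℝ} {G : E N → E N}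
    (h : IsWeakGradientOn V u G) : IsWeakGradientOn U u G :=
  fun ψ hψ hψc hψU e => h ψ hψ hψc (hψU.trans hUV) e

theorem IsWeakGradientOn.congr {U : Set (E N)} {u u' : E N → ℝ} {G : E N → E N}
    (h : IsWeakGradientOn U u G) (hu : ∀ᵐ x, x ∈ U → u x = u' x) : IsWeakGradientOn U u' G := by
  intro ψ hψ hψc hψU e
  rw [h ψ hψ hψc hψU e]
  congr 1
  refine integral_congr_ae ?_
  filter_upwards [hu] with x hx
  by_cases hxU : x ∈ U
  · rw [hx hxU]
  · rw [image_eq_zero_of_notMem_tsupport (f := fderiv ℝ ψ)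
      (fun h => hxU (hψU (tsupport_fderiv_subset ℝ h)))]
    simp

theorem locallyIntegrableOn_of_memLp (hp : 1 ≤ p) {Ω U : Set (E N)} (hU : IsOpen U) (hUΩ : U ⊆ Ω)
    {G : E N → E N} (h : MemLp G (ENNReal.ofReal p) (volume.restrict Ω)) :
    LocallyIntegrableOn G U := by
  rw [locallyIntegrableOn_iff hU.isLocallyClosed]
  intro K hKU hK
  have : IsFiniteMeasure (volume.restrict K) :=
    ⟨by rw [Measure.restrict_apply_univ]; exact hK.measure_lt_top⟩
  exact (h.mono_measure (Measure.restrict_mono (hKU.trans hUΩ) le_rfl)).integrable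
    (by rw [ENNReal.one_le_ofReal]; exact hp)

theorem ae_ne_zero (hN : 0 < N) : ∀ᵐ x : E N, x ≠ 0 := by
  have := nontrivial_euclidean hN
  rw [ae_iff]; simp

theorem lintegral_radial_gradient (hN : 0 < N) (hI : MeasurableSet I) {Ω : Set (E N)}
    (hΩ : ∀ x, x ∈ Ω ↔ ‖x‖ ∈ I) (hp : 0 < p) {g : ℝ → ℝ} (hg : Measurable g)
    (hgI : ∀ r, r ∉ I → g r = 0) :
    ∫⁻ x in Ω, ‖g ‖x‖ • (‖x‖⁻¹ • x)‖ₑ ^ p =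
      ENNReal.ofReal (sphereArea N) * radialEnergy N p g := by
  have h1 : ∫⁻ x in Ω, ‖g ‖x‖ • (‖x‖⁻¹ • x)‖ₑ ^ p = ∫⁻ x in Ω, ‖g ‖x‖‖ₑ ^ p := by
    refine lintegral_congr_ae (ae_restrict_of_ae ?_)
    filter_upwards [ae_ne_zero hN] with x hx
    rw [← ofReal_norm, norm_radial_unit hx, ← Real.norm_eq_abs, ofReal_norm]
  rw [h1, setLIntegral_radial hN (F := fun r => ‖g r‖ₑ ^ p) (hg.enorm.pow_const _) hI hΩ,
    radialEnergy, ← Measure.restrict_restrict hI, ← lintegral_indicator hI]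
  congr 1
  refine lintegral_congr fun r => ?_
  by_cases h : r ∈ I
  · rw [indicator_of_mem h]
  · rw [indicator_of_notMem h, hgI r h, enorm_zero, ENNReal.zero_rpow_of_pos hp, mul_zero]

/-- For radial `u` one good ray determines `u` almost everywhere. Its radial primitive has an
explicit weak gradient off the origin, which must coincide with `G`. -/
theorem MemHomSobolevRad.exists_profile (hN : 0 < N) (hp : 1 < p) (hI : IsOpen I) {Ω : Set (E N)}
    (hΩ : ∀ x, x ∈ Ω ↔ ‖x‖ ∈ I) (hW : ∀ a, 0 < a → tailWeight N p I a < ⊤) {u : E N → ℝ}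
    {G : E N → E N} (h : MemHomSobolevRad p Ω u G) :
    ∃ g : ℝ → ℝ, Measurable g ∧ (∀ r, r ∉ I ∩ Ioi 0 → g r = 0) ∧ radialEnergy N p g < ⊤ ∧
      (∀ᵐ x ∂(volume.restrict Ω), u x = tailIntegral g ‖x‖) ∧
      (∀ᵐ x ∂(volume.restrict Ω), G x = g ‖x‖ • (‖x‖⁻¹ • x)) := by
  have h0 : 0 < p := by linarith
  have hΩ' : Ω = norm ⁻¹' I := by ext x; exact hΩ x
  have hΩo : IsOpen Ω := hΩ' ▸ hI.preimage continuous_norm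
  obtain ⟨hmem, f, hf⟩ := h
  -- reduction to measurable functions
  wlog hm : Measurable u ∧ Measurable G generalizing u G
  · have hu := hmem.locallyIntegrableOn.aestronglyMeasurable
    have hG := hmem.gradient_memLp.1
    obtain ⟨g, h1, h2, h3, h4, h5⟩ := this (hmem.congr hu.ae_eq_mk hG.ae_eq_mk)
      (by filter_upwards [hf, hu.ae_eq_mk] with x hx hx'; rw [← hx', hx])
      ⟨hu.stronglyMeasurable_mk.measurable, hG.stronglyMeasurable_mk.measurable⟩
    refine ⟨g, h1, h2, h3, ?_, ?_⟩
    · filter_upwards [h4, hu.ae_eq_mk] with x hx hx'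
      rw [hx', hx]
    · filter_upwards [h5, hG.ae_eq_mk] with x hx hx'
      rw [hx', hx]
  obtain ⟨hum, hGm⟩ := hm
  have : NeZero (sphereMeasure N) := ⟨by
    have := nontrivial_euclidean hN
    exact Measure.toSphere_ne_zero _⟩
  rw [ae_restrict_iff' hΩo.measurableSet] at hf
  obtain ⟨σ, ⟨hσE, hσu⟩, hσf⟩ := ((hmem.ae_ray hN hp hI hΩ hW hum hGm).and (ae_polar hN hf)).exists
  have hσ1 : ‖(σ : E N)‖ = 1 := norm_eq_of_mem_sphere σ
  set g := rayDerivative I G σ with hg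
  have hgm : Measurable g := measurable_rayDerivative hI.measurableSet hGm _
  have hgJ : ∀ r, r ∉ I ∩ Ioi 0 → g r = 0 := fun r hr => indicator_of_notMem hr _
  have hgI : ∀ r, r ∉ I → g r = 0 := fun r hr => hgJ r fun h => hr h.1
  have hprof : ∀ᵐ x, x ∈ Ω → u x = tailIntegral g ‖x‖ := by
    have h1 : ∀ᵐ r ∂(volume.restrict (Ioi (0 : ℝ))), r ∈ I → f r = tailIntegral g r := by
      rw [← Measure.restrict_restrict hI.measurableSet, ae_restrict_iff' hI.measurableSet] at hσu
      filter_upwards [hσu, hσf, ae_restrict_mem measurableSet_Ioi] with r h2 h3 hr hrI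
      have hm : r • (σ : E N) ∈ Ω := by rwa [hΩ, norm_smul_sphere hσ1 (le_of_lt hr)]
      have := h3 hm
      rw [norm_smul_sphere hσ1 (le_of_lt hr)] at this
      rw [← this, h2 hrI]
    filter_upwards [hf, ae_norm_of_ae hN h1] with x hx hx' hxΩ
    rw [hx hxΩ, hx' ((hΩ x).1 hxΩ)]
  refine ⟨g, hgm, hgJ, hσE, (ae_restrict_iff' hΩo.measurableSet).2 hprof, ?_⟩
  -- The primitive may be singular at the origin, so gradients are compared on the punctured set.
  -- The removed point is null.
  have hU : IsOpen (Ω ∩ {0}ᶜ) := hΩo.inter isOpen_compl_singleton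
  have hFm : Measurable fun x : E N => g ‖x‖ • (‖x‖⁻¹ • x) :=
    (hgm.comp measurable_norm).smul (measurable_norm.inv.smul measurable_id)
  have hF : MemLp (fun x : E N => g ‖x‖ • (‖x‖⁻¹ • x)) (ENNReal.ofReal p)
      (volume.restrict Ω) := by
    refine ⟨hFm.aestronglyMeasurable, ?_⟩
    rw [eLpNorm_lt_top_iff_lintegral_rpow_enorm_lt_top (by simpa using h0) ENNReal.ofReal_ne_top,
      ENNReal.toReal_ofReal h0.le, lintegral_radial_gradient hN hI.measurableSet hΩ h0 hgm hgI]
    exact ENNReal.mul_lt_top ENNReal.ofReal_lt_top hσE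
  have key := IsWeakGradientOn.ae_eq hU
    ((hmem.isWeakGradientOn hp.le).mono inter_subset_left)
    (((isWeakGradientOn_tailIntegral hN hgm fun a ha => integrableOn_of_radialEnergy_lt_top
      (N := N) hp hI.measurableSet hgm hgI hσE ha (hW a ha)).mono inter_subset_right).congr
      (by filter_upwards [hprof] with x hx hxU; rw [hx hxU.1]))
    (locallyIntegrableOn_of_memLp hp.le hU inter_subset_left hmem.gradient_memLp)
    (locallyIntegrableOn_of_memLp hp.le hU inter_subset_left hF)
  rw [ae_restrict_iff' hΩo.measurableSet]
  filter_upwards [key, ae_ne_zero hN] with x hx hx0 hxΩ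
  exact hx ⟨hxΩ, hx0⟩

theorem gradEnergy_eq (hN : 0 < N) (hI : MeasurableSet I) {Ω : Set (E N)}
    (hΩ : ∀ x, x ∈ Ω ↔ ‖x‖ ∈ I) (hp : 0 < p) {g : ℝ → ℝ} (hg : Measurable g)
    (hgI : ∀ r, r ∉ I → g r = 0) {G : E N → E N}
    (hG : ∀ᵐ x ∂(volume.restrict Ω), G x = g ‖x‖ • (‖x‖⁻¹ • x)) :
    gradEnergy p Ω G = ENNReal.ofReal (sphereArea N) * radialEnergy N p g := by
  rw [← lintegral_radial_gradient hN hI hΩ hp hg hgI, gradEnergy]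
  refine lintegral_congr_ae ?_
  filter_upwards [hG] with x hx
  rw [hx, ← ENNReal.ofReal_rpow_of_nonneg (norm_nonneg _) hp.le, ofReal_norm]

end

/-! ### The change of variables between radial functions and one-dimensional functions -/

section

/-- The Jacobian of the change of variables `|x| ↦ t`. -/
def radialSpeed (N : ℕ) (p r : ℝ) : ℝ := (sphereArea N * r ^ (N - 1)) ^ (-(1 / (p - 1)))

/-- `θ` is a decreasing change of variables of `J` onto `(0, ∞)` with derivative
`-radialSpeed`. -/
structure IsRadialVar (N : ℕ) (p : ℝ) (J : Set ℝ) (θ : ℝ → ℝ) : Prop where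
  measurableSet : MeasurableSet J
  pos : J ⊆ Ioi 0
  measurable : Measurable θ
  hasDerivAt : ∀ r ∈ J, HasDerivAt θ (-radialSpeed N p r) r
  strictAntiOn : StrictAntiOn θ J
  image_eq : θ '' J = Ioi 0

variable {N : ℕ} {p q : ℝ} {J : Set ℝ} {θ : ℝ → ℝ}

theorem radialSpeed_pos (hN : 0 < N) {r : ℝ} (hr : 0 < r) : 0 < radialSpeed N p r :=
  Real.rpow_pos_of_pos (mul_pos (sphereArea_pos hN) (pow_pos hr _)) _

/-- The exponent `-1/(p - 1)` is chosen so that the speed to the power `1 - p` is `ω r^(N-1)`. Hence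
the energies agree with no constant. -/
theorem radialSpeed_mul_rpow (hN : 0 < N) (hp : 1 < p) {r : ℝ} (hr : 0 < r) {y : ℝ} (hy : 0 ≤ y) :
    radialSpeed N p r * (y / radialSpeed N p r) ^ p = sphereArea N * r ^ (N - 1) * y ^ p := by
  have h3 : 0 < p - 1 := by linarith
  have hA : 0 < sphereArea N * r ^ (N - 1) := mul_pos (sphereArea_pos hN) (pow_pos hr _)
  have hk := radialSpeed_pos (p := p) hN hr
  rw [Real.div_rpow hy hk.le]
  have : radialSpeed N p r / radialSpeed N p r ^ p = sphereArea N * r ^ (N - 1) := by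
    nth_rewrite 1 [← Real.rpow_one (radialSpeed N p r)]
    rw [← Real.rpow_sub hk, radialSpeed, ← Real.rpow_mul hA.le]
    have : -(1 / (p - 1)) * (1 - p) = 1 := by field_simp; ring
    rw [this, Real.rpow_one]
  rw [← this]
  ring

theorem IsRadialVar.theta_pos (hθ : IsRadialVar N p J θ) {r : ℝ} (hr : r ∈ J) : 0 < θ r :=
  hθ.image_eq.subset (mem_image_of_mem θ hr)

theorem IsRadialVar.image_inter_Ioi (hθ : IsRadialVar N p J θ) {r : ℝ} (hr : r ∈ J) :
    θ '' (J ∩ Ioi r) = Ioo 0 (θ r) := by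
  ext t
  constructor
  · rintro ⟨s, ⟨hs, hrs⟩, rfl⟩
    exact ⟨hθ.theta_pos hs, hθ.strictAntiOn hr hs hrs⟩
  · rintro ⟨h0, ht⟩
    obtain ⟨s, hs, rfl⟩ := hθ.image_eq.superset h0
    exact ⟨s, ⟨hs, (hθ.strictAntiOn.lt_iff_gt hs hr).1 ht⟩, rfl⟩

theorem IsRadialVar.lintegral_Ioi (hN : 0 < N) (hθ : IsRadialVar N p J θ) (F : ℝ → ℝ≥0∞) :
    ∫⁻ t in Ioi 0, F t = ∫⁻ r in J, ENNReal.ofReal (radialSpeed N p r) * F (θ r) := by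
  rw [← hθ.image_eq, lintegral_image_eq_lintegral_abs_deriv_mul hθ.measurableSet
    (fun r hr => (hθ.hasDerivAt r hr).hasDerivWithinAt) hθ.strictAntiOn.injOn]
  refine setLIntegral_congr_fun hθ.measurableSet fun r hr => ?_
  rw [abs_neg, abs_of_pos (radialSpeed_pos hN (hθ.pos hr))]

/-- The one-dimensional derivative corresponding to the radial derivative `g`. -/
def lineDerivative (N : ℕ) (p : ℝ) (J : Set ℝ) (θ g : ℝ → ℝ) : ℝ → ℝ :=
  indicator (Ioi 0) fun t => -(g (Function.invFunOn θ J t) /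
    radialSpeed N p (Function.invFunOn θ J t))

/-- The one-dimensional function corresponding to the radial function with radial
derivative `g`. -/
def lineFunction (N : ℕ) (p : ℝ) (J : Set ℝ) (θ g : ℝ → ℝ) (t : ℝ) : ℝ :=
  ∫ s in (0 : ℝ)..t, lineDerivative N p J θ g s

theorem IsRadialVar.lineDerivative_apply (hθ : IsRadialVar N p J θ) (g : ℝ → ℝ) {r : ℝ}
    (hr : r ∈ J) : lineDerivative N p J θ g (θ r) = -(g r / radialSpeed N p r) := by
  rw [lineDerivative, indicator_of_mem (show θ r ∈ Ioi 0 from hθ.theta_pos hr),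
    hθ.strictAntiOn.injOn.leftInvOn_invFunOn hr]

theorem IsRadialVar.speed_smul_lineDerivative (hN : 0 < N) (hθ : IsRadialVar N p J θ) (g : ℝ → ℝ)
    {r : ℝ} (hr : r ∈ J) :
    |-radialSpeed N p r| • lineDerivative N p J θ g (θ r) = -g r := by
  have hk := radialSpeed_pos (p := p) hN (hθ.pos hr)
  rw [hθ.lineDerivative_apply g hr, abs_neg, abs_of_pos hk, smul_eq_mul]
  field_simp

/-- Small `t` corresponds to outer radii, so integrability of `g` away from the origin gives
integrability up to `t = 0`. -/
theorem IsRadialVar.integrableOn_lineDerivative_Iio (hN : 0 < N) (hθ : IsRadialVar N p J θ)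
    {g : ℝ → ℝ} (hg : ∀ a, 0 < a → IntegrableOn g (Ioi a)) (T : ℝ) :
    IntegrableOn (lineDerivative N p J θ g) (Iio T) := by
  have h0 : IntegrableOn (lineDerivative N p J θ g) (Iic 0) := by
    refine (integrableOn_zero (ε' := ℝ)).congr_fun (fun t ht => ?_) measurableSet_Iic
    rw [lineDerivative, indicator_of_notMem (notMem_Ioi.2 ht)]
  rcases le_or_gt T 0 with hT | hT
  · exact h0.mono_set fun t ht => (le_of_lt ht).trans hT
  obtain ⟨r, hr, rfl⟩ := hθ.image_eq.superset hT
  have h1 : IntegrableOn (lineDerivative N p J θ g) (Ioo 0 (θ r)) := by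
    rw [← hθ.image_inter_Ioi hr, integrableOn_image_iff_integrableOn_abs_deriv_smul
      (hθ.measurableSet.inter measurableSet_Ioi)
      (fun s hs => (hθ.hasDerivAt s hs.1).hasDerivWithinAt)
      (hθ.strictAntiOn.injOn.mono inter_subset_left)]
    refine (((hg r (hθ.pos hr)).mono_set inter_subset_right).neg).congr_fun (fun s hs => ?_)
      (hθ.measurableSet.inter measurableSet_Ioi)
    exact (hθ.speed_smul_lineDerivative hN g hs.1).symm
  refine (h0.union h1).mono_set fun t ht => ?_
  rcases le_or_gt t 0 with h | h
  · exact Or.inl h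
  · exact Or.inr ⟨h, ht⟩

/-- As `θ` decreases, the interval `(0, θ r)` corresponds to the radii in `J` beyond `r`. The signs
in the two definitions account for this reversal. -/
theorem IsRadialVar.lineFunction_apply (hN : 0 < N) (hθ : IsRadialVar N p J θ) {g : ℝ → ℝ}
    (hgJ : ∀ r, r ∉ J → g r = 0) {r : ℝ} (hr : r ∈ J) :
    lineFunction N p J θ g (θ r) = tailIntegral g r := by
  have hm := hθ.measurableSet.inter (measurableSet_Ioi (a := r))
  rw [lineFunction, intervalIntegral.integral_of_le (hθ.theta_pos hr).le,
    integral_Ioc_eq_integral_Ioo, ← hθ.image_inter_Ioi hr,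
    integral_image_eq_integral_abs_deriv_smul hm
      (fun s hs => (hθ.hasDerivAt s hs.1).hasDerivWithinAt)
      (hθ.strictAntiOn.injOn.mono inter_subset_left),
    setIntegral_congr_fun hm fun s hs => hθ.speed_smul_lineDerivative hN g hs.1, integral_neg,
    tailIntegral, ← Measure.restrict_restrict hθ.measurableSet,
    ← integral_indicator hθ.measurableSet]
  congr 2
  funext s
  by_cases h : s ∈ J
  · rw [indicator_of_mem h]
  · rw [indicator_of_notMem h, hgJ s h]

theorem IsRadialVar.intervalIntegrable_lineDerivative (hN : 0 < N) (hθ : IsRadialVar N p J θ)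
    {g : ℝ → ℝ} (hg : ∀ a, 0 < a → IntegrableOn g (Ioi a)) (a b : ℝ) :
    IntervalIntegrable (lineDerivative N p J θ g) volume a b := by
  refine (intervalIntegrable_iff_integrableOn_Ioc_of_le (a := a ⊓ b) (b := a ⊔ b) inf_le_sup).2
    ((hθ.integrableOn_lineDerivative_Iio hN hg (a ⊔ b + 1)).mono_set fun t ht => ?_) |>.mono_set ?_
  · have := ht.2
    simp only [mem_Iio]
    linarith
  · rw [uIcc_of_le (inf_le_sup : a ⊓ b ≤ a ⊔ b)]
    exact le_rfl

theorem IsRadialVar.continuous_lineFunction (hN : 0 < N) (hθ : IsRadialVar N p J θ)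
    {g : ℝ → ℝ} (hg : ∀ a, 0 < a → IntegrableOn g (Ioi a)) :
    Continuous (lineFunction N p J θ g) :=
  intervalIntegral.continuous_primitive (hθ.intervalIntegrable_lineDerivative hN hg) 0

theorem IsRadialVar.deriv_lineFunction (hN : 0 < N) (hθ : IsRadialVar N p J θ)
    {g : ℝ → ℝ} (hg : ∀ a, 0 < a → IntegrableOn g (Ioi a)) :
    deriv (lineFunction N p J θ g) =ᵐ[volume] lineDerivative N p J θ g := by
  have hloc : LocallyIntegrable (lineDerivative N p J θ g) volume := fun x =>
    ⟨Iio (x + 1), Iio_mem_nhds (by linarith), hθ.integrableOn_lineDerivative_Iio hN hg _⟩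
  filter_upwards [LocallyIntegrable.ae_hasDerivAt_integral hloc] with x hx
  exact (hx 0).deriv

theorem IsRadialVar.lintegral_lineDerivative (hN : 0 < N) (hp : 1 < p) (hθ : IsRadialVar N p J θ)
    {g : ℝ → ℝ} (hgJ : ∀ r, r ∉ J → g r = 0) :
    ∫⁻ t in Ioi 0, ENNReal.ofReal (|lineDerivative N p J θ g t| ^ p) =
      ENNReal.ofReal (sphereArea N) * radialEnergy N p g := by
  have h0 : 0 < p := by linarith
  have e1 : radialEnergy N p g = ∫⁻ r in J, ENNReal.ofReal (r ^ (N - 1)) * ‖g r‖ₑ ^ p := by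
    rw [radialEnergy, ← inter_eq_self_of_subset_left hθ.pos,
      ← Measure.restrict_restrict hθ.measurableSet, ← lintegral_indicator hθ.measurableSet]
    refine lintegral_congr fun r => ?_
    by_cases h : r ∈ J
    · rw [indicator_of_mem h]
    · rw [indicator_of_notMem h, hgJ r h, enorm_zero, ENNReal.zero_rpow_of_pos h0, mul_zero]
  rw [hθ.lintegral_Ioi hN, e1, ← lintegral_const_mul' _ _ ENNReal.ofReal_ne_top]
  refine setLIntegral_congr_fun hθ.measurableSet fun r hr => ?_
  have hr0 : 0 < r := hθ.pos hr
  have hk := radialSpeed_pos (p := p) hN hr0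
  have hω := sphereArea_pos hN
  rw [hθ.lineDerivative_apply g hr, abs_neg, abs_div, abs_of_pos hk,
    ← ENNReal.ofReal_mul hk.le, radialSpeed_mul_rpow hN hp hr0 (abs_nonneg _),
    ENNReal.ofReal_mul (by positivity), ENNReal.ofReal_mul hω.le, mul_assoc,
    ← ENNReal.ofReal_rpow_of_nonneg (abs_nonneg _) h0.le, ← Real.norm_eq_abs, ofReal_norm]

theorem IsRadialVar.blissEnergy_lineFunction (hN : 0 < N) (hp : 1 < p) (hθ : IsRadialVar N p J θ)
    {g : ℝ → ℝ} (hg : ∀ a, 0 < a → IntegrableOn g (Ioi a)) (hgJ : ∀ r, r ∉ J → g r = 0) :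
    blissEnergy p (lineFunction N p J θ g) =
      ENNReal.ofReal (sphereArea N) * radialEnergy N p g := by
  rw [← hθ.lintegral_lineDerivative hN hp hgJ, blissEnergy]
  refine lintegral_congr_ae (ae_restrict_of_ae ?_)
  filter_upwards [hθ.deriv_lineFunction hN hg] with t ht
  rw [ht]

theorem IsRadialVar.blissAdmissible_lineFunction (hN : 0 < N) (hp : 1 < p)
    (hθ : IsRadialVar N p J θ) {g : ℝ → ℝ} (hg : ∀ a, 0 < a → IntegrableOn g (Ioi a))
    (hgJ : ∀ r, r ∉ J → g r = 0) (hE : radialEnergy N p g < ⊤) :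
    BlissAdmissible p (lineFunction N p J θ g) := by
  have h0 : 0 < p := by linarith
  refine ⟨fun R _ => ?_, intervalIntegral.integral_same, ?_⟩
  · exact (hθ.intervalIntegrable_lineDerivative hN hg 0 R)
      |>.absolutelyContinuousOnInterval_intervalIntegral left_mem_uIcc
  · refine ⟨(measurable_deriv _).aestronglyMeasurable, ?_⟩
    rw [eLpNorm_ofReal_eq h0]
    refine ENNReal.rpow_lt_top_of_nonneg (by positivity) (ne_of_lt ?_)
    have := hθ.blissEnergy_lineFunction hN hp hg hgJ
    rw [blissEnergy] at this
    rw [this]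
    exact ENNReal.mul_lt_top ENNReal.ofReal_lt_top hE

/-- The hypothesis `hmc` compares the volume density with the Jacobian pointwise. The Sobolev mass
(`m = 1`) and the Hardy mass are both instances. -/
theorem IsRadialVar.lintegral_mass (hN : 0 < N) {I : Set ℝ} (hI : MeasurableSet I)
    (hθ : IsRadialVar N p (I ∩ Ioi 0) θ) {Ω : Set (E N)} (hΩ : ∀ x, x ∈ Ω ↔ ‖x‖ ∈ I)
    {u : E N → ℝ} {v m : ℝ → ℝ} (hv : Measurable v) (hm : Measurable m) {c : ℝ} (hc : 0 ≤ c)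
    (hu : ∀ᵐ x ∂(volume.restrict Ω), u x = v (θ ‖x‖))
    (hmc : ∀ r ∈ I ∩ Ioi 0, sphereArea N * r ^ (N - 1) * m r =
      c * (radialSpeed N p r / θ r ^ (1 + q * ((p - 1) / p)))) :
    ∫⁻ x in Ω, ENNReal.ofReal (|u x| ^ q * m ‖x‖) = ENNReal.ofReal c * blissMass p q v := by
  have hω := sphereArea_pos hN
  have e1 : ∫⁻ x in Ω, ENNReal.ofReal (|u x| ^ q * m ‖x‖) =
      ∫⁻ x in Ω, ENNReal.ofReal (|v (θ ‖x‖)| ^ q * m ‖x‖) := by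
    refine lintegral_congr_ae ?_
    filter_upwards [hu] with x hx
    rw [hx]
  rw [e1, setLIntegral_radial hN (F := fun r => ENNReal.ofReal (|v (θ r)| ^ q * m r))
    ((((hv.comp hθ.measurable).norm.pow_const q).mul hm).ennreal_ofReal) hI hΩ, blissMass,
    hθ.lintegral_Ioi hN, ← lintegral_const_mul' _ _ ENNReal.ofReal_ne_top,
    ← lintegral_const_mul' _ _ ENNReal.ofReal_ne_top]
  refine setLIntegral_congr_fun hθ.measurableSet fun r hr => ?_
  have hr0 : 0 < r := hθ.pos hr
  have hk := radialSpeed_pos (p := p) hN hr0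
  rw [← ENNReal.ofReal_mul (by positivity), ← ENNReal.ofReal_mul hω.le,
    ← ENNReal.ofReal_mul hk.le, ← ENNReal.ofReal_mul hc]
  congr 1
  calc sphereArea N * (r ^ (N - 1) * (|v (θ r)| ^ q * m r))
      = |v (θ r)| ^ q * (sphereArea N * r ^ (N - 1) * m r) := by ring
    _ = _ := by rw [hmc r hr]; ring

/-- The correspondence between radial Sobolev functions and one-dimensional functions. -/
theorem MemHomSobolevRad.exists_blissAdmissible (hN : 0 < N) (hp : 1 < p) {I : Set ℝ}
    (hI : IsOpen I) {Ω : Set (E N)} (hΩ : ∀ x, x ∈ Ω ↔ ‖x‖ ∈ I)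
    (hW : ∀ a, 0 < a → tailWeight N p I a < ⊤) (hθ : IsRadialVar N p (I ∩ Ioi 0) θ)
    {u : E N → ℝ} {G : E N → E N} (h : MemHomSobolevRad p Ω u G) :
    ∃ v : ℝ → ℝ, BlissAdmissible p v ∧ Measurable v ∧
      (∀ᵐ x ∂(volume.restrict Ω), u x = v (θ ‖x‖)) ∧ gradEnergy p Ω G = blissEnergy p v := by
  obtain ⟨g, hgm, hgJ, hE, hu, hG⟩ := h.exists_profile hN hp hI hΩ hW
  have hgI : ∀ r, r ∉ I → g r = 0 := fun r hr => hgJ r fun h => hr h.1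
  have hgi : ∀ a, 0 < a → IntegrableOn g (Ioi a) := fun a ha =>
    integrableOn_of_radialEnergy_lt_top hp hI.measurableSet hgm hgI hE ha (hW a ha)
  refine ⟨lineFunction N p (I ∩ Ioi 0) θ g, hθ.blissAdmissible_lineFunction hN hp hgi hgJ hE,
    (hθ.continuous_lineFunction hN hgi).measurable, ?_, ?_⟩
  · have hΩm : MeasurableSet Ω := by
      have : Ω = norm ⁻¹' I := by ext x; exact hΩ x
      exact this ▸ measurable_norm hI.measurableSet
    filter_upwards [hu, ae_restrict_of_ae (ae_ne_zero hN), ae_restrict_mem hΩm] with x hx hx0 hxΩ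
    rw [hx, hθ.lineFunction_apply hN hgJ ⟨(hΩ x).1 hxΩ, norm_pos_iff.2 hx0⟩]
  · rw [hθ.blissEnergy_lineFunction hN hp hgi hgJ,
      gradEnergy_eq hN hI.measurableSet hΩ (by linarith) hgm hgI hG]

end

/-! ### The power and logarithmic variables, and the comparison of constants. -/

section

variable {N : ℕ} {p q : ℝ}

theorem natCast_sub_one (hN : 0 < N) : ((N - 1 : ℕ) : ℝ) = (N : ℝ) - 1 := by
  rw [Nat.cast_sub hN, Nat.cast_one]

theorem sphereArea_eq (hN : 0 < N) :
    sphereArea N = N * Real.pi ^ ((N : ℝ) / 2) / Real.Gamma (1 + (N : ℝ) / 2) := by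
  have : Nonempty (Fin N) := ⟨⟨0, hN⟩⟩
  have := nontrivial_euclidean hN
  rw [sphereArea, Measure.toSphere_apply_univ, EuclideanSpace.volume_ball]
  simp only [finrank_euclideanSpace, Fintype.card_fin, ENNReal.ofReal_one, one_pow, one_mul,
    ENNReal.toReal_mul, ENNReal.toReal_natCast]
  rw [ENNReal.toReal_ofReal (div_nonneg (by positivity) (Real.Gamma_pos_of_pos (by positivity)).le),
    Real.sqrt_eq_rpow, ← Real.rpow_natCast, ← Real.rpow_mul Real.pi_pos.le, add_comm, mul_div_assoc]
  congr 3
  ring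

theorem radialSpeed_eq (hN : 0 < N) {r : ℝ} (hr : 0 < r) :
    radialSpeed N p r =
      sphereArea N ^ (-(1 / (p - 1))) * r ^ (-(((N : ℝ) - 1) / (p - 1))) := by
  rw [radialSpeed, Real.mul_rpow (sphereArea_pos hN).le (by positivity), ← Real.rpow_natCast,
    ← Real.rpow_mul hr.le, natCast_sub_one hN]
  congr 2
  ring

/-- The weight decays like `r^(-(N-1)/(p-1))`, and `(N - 1)/(p - 1) > 1` because `p < N`. -/
theorem tailWeight_univ_lt_top (hp : 1 < p) (hpN : p < N) {a : ℝ} (ha : 0 < a) :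
    tailWeight N p univ a < ⊤ := by
  have hN : 0 < N := by exact_mod_cast (by linarith : (0 : ℝ) < N)
  have h3 : 0 < p - 1 := by linarith
  rw [tailWeight, univ_inter]
  refine (integrableOn_Ioi_rpow_of_lt ?_ ha).setLIntegral_lt_top
  rw [natCast_sub_one hN, neg_lt_neg_iff, lt_div_iff₀ h3]
  linarith

theorem tailWeight_Iio_lt_top {a b : ℝ} (ha : 0 < a) : tailWeight N p (Iio b) a < ⊤ := by
  rw [tailWeight]
  refine IntegrableOn.setLIntegral_lt_top ?_
  refine IntegrableOn.mono_set (t := Icc a b) (ContinuousOn.integrableOn_Icc ?_)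
    fun r hr => ⟨le_of_lt hr.2, le_of_lt hr.1⟩
  exact continuousOn_id.rpow_const fun r hr => Or.inl (ha.trans_le hr.1).ne'

theorem isRadialVar_sobolevVar (hp : 1 < p) (hpN : p < N) :
    IsRadialVar N p (univ ∩ Ioi 0) (sobolevVar N p) := by
  have hN : 0 < N := by exact_mod_cast (by linarith : (0 : ℝ) < N)
  have h3 : 0 < p - 1 := by linarith
  have h4 : 0 < N - p := by linarith
  have hω := sphereArea_pos hN
  have hc : 0 < (p - 1) / (N - p) * sphereArea N ^ (-(1 / (p - 1))) := by positivity
  have he : 0 < (N - p) / (p - 1) := by positivity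
  rw [univ_inter]
  refine ⟨measurableSet_Ioi, subset_rfl, ?_, fun r hr => ?_, fun r hr s hs hrs => ?_, ?_⟩
  · exact measurable_const.mul (measurable_id.pow_const _)
  · have hr : 0 < r := hr
    have := (Real.hasDerivAt_rpow_const (p := -((N - p) / (p - 1))) (Or.inl hr.ne')).const_mul
      ((p - 1) / (N - p) * sphereArea N ^ (-(1 / (p - 1))))
    refine this.congr_deriv ?_
    rw [radialSpeed_eq hN hr]
    have e : -((N - p) / (p - 1)) - 1 = -(((N : ℝ) - 1) / (p - 1)) := by field_simp; ring
    rw [e]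
    field_simp
  · exact mul_lt_mul_of_pos_left
      (Real.rpow_lt_rpow_of_neg hr hrs (neg_neg_of_pos he)) hc
  · ext t
    constructor
    · rintro ⟨r, hr, rfl⟩
      exact mul_pos hc (Real.rpow_pos_of_pos hr _)
    · intro ht
      have ht : 0 < t := ht
      refine ⟨(t / ((p - 1) / (N - p) * sphereArea N ^ (-(1 / (p - 1))))) ^
        (-((N - p) / (p - 1)))⁻¹, Real.rpow_pos_of_pos (by positivity) _, ?_⟩
      rw [sobolevVar, Real.rpow_inv_rpow (by positivity) (neg_neg_of_pos he).ne]
      field_simp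

/-- For `p = N` the speed is a multiple of `1/r`, so its antiderivative is a logarithm, normalised
to vanish at `r = 1`. -/
theorem isRadialVar_moserVar (hN : 2 ≤ N) : IsRadialVar N N (Iio 1 ∩ Ioi 0) (moserVar N) := by
  have hN0 : 0 < N := by omega
  have h3 : (0 : ℝ) < N - 1 := by
    have : (2 : ℝ) ≤ N := by exact_mod_cast hN
    linarith
  have hω := sphereArea_pos hN0
  have hc : 0 < sphereArea N ^ (-(1 / ((N : ℝ) - 1))) := by positivity
  refine ⟨measurableSet_Iio.inter measurableSet_Ioi, inter_subset_right, ?_, fun r hr => ?_,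
    fun r hr s hs hrs => ?_, ?_⟩
  · exact measurable_const.mul (Real.measurable_log.comp (measurable_const.div measurable_id))
  · have hr : 0 < r := hr.2
    have := (Real.hasDerivAt_log hr.ne').neg.const_mul (sphereArea N ^ (-(1 / ((N : ℝ) - 1))))
    refine (this.congr_deriv ?_).congr_of_eventuallyEq ?_
    · rw [radialSpeed_eq hN0 hr, div_self h3.ne', Real.rpow_neg_one]
      ring
    · refine Eventually.of_forall fun s => ?_
      simp [moserVar]
  · have hr0 : 0 < r := hr.2
    have hs0 : 0 < s := hs.2
    refine mul_lt_mul_of_pos_left (Real.log_lt_log (by positivity) ?_) hc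
    exact one_div_lt_one_div_of_lt hr0 hrs
  · ext t
    constructor
    · rintro ⟨r, hr, rfl⟩
      have hr0 : 0 < r := hr.2
      refine mul_pos hc (Real.log_pos ?_)
      rw [lt_div_iff₀ hr0, one_mul]
      exact hr.1
    · intro ht
      have ht : 0 < t := ht
      refine ⟨Real.exp (-(t / sphereArea N ^ (-(1 / ((N : ℝ) - 1))))), ⟨?_, Real.exp_pos _⟩, ?_⟩
      · rw [mem_Iio, Real.exp_lt_one_iff, neg_lt_zero]
        positivity
      · rw [moserVar, one_div (Real.exp _), ← Real.exp_neg, neg_neg, Real.log_exp]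
        field_simp

theorem lt_critExp (hp : 1 < p) (hpN : p < N) : p < critExp N p := by
  have h4 : 0 < N - p := by linarith
  rw [critExp, lt_div_iff₀ h4]
  nlinarith

theorem sobolevFactor_pos (hp : 1 < p) (hpN : p < N) : 0 < sobolevFactor N p := by
  have hN : 0 < N := by exact_mod_cast (by linarith : (0 : ℝ) < N)
  have hω := sphereArea_pos hN
  have h3 : 0 < p - 1 := by linarith
  have h4 : 0 < N - p := by linarith
  exact mul_pos (Real.rpow_pos_of_pos hω _) (Real.rpow_pos_of_pos (by positivity) _)

theorem sobolevMass_eq (hp : 1 < p) (hpN : p < N) {u : E N → ℝ} {v : ℝ → ℝ} (hv : Measurable v)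
    (hu : ∀ᵐ x : E N, u x = v (sobolevVar N p ‖x‖)) :
    sobolevMass p u = ENNReal.ofReal (sobolevFactor N p) * blissMass p (critExp N p) v := by
  have hN : 0 < N := by exact_mod_cast (by linarith : (0 : ℝ) < N)
  have h3 : 0 < p - 1 := by linarith
  have h4 : 0 < N - p := by linarith
  have h0 : 0 < p := by linarith
  have hω := sphereArea_pos hN
  have ha : 0 < (p - 1) / (N - p) := by positivity
  have := (isRadialVar_sobolevVar hp hpN).lintegral_mass (q := critExp N p) hN MeasurableSet.univ
    (Ω := univ) (by simp) hv (measurable_const (a := (1 : ℝ))) (sobolevFactor_pos hp hpN).le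
    (by rwa [Measure.restrict_univ]) ?_
  · simpa [sobolevMass] using this
  · rintro r ⟨-, hr : 0 < r⟩
    have hθ : 0 < sobolevVar N p r := (isRadialVar_sobolevVar hp hpN).theta_pos ⟨mem_univ _, hr⟩
    -- At the critical exponent the powers of `r` cancel, leaving Lebesgue measure without weight.
    have hκ : 1 + critExp N p * ((p - 1) / p) = p * (N - 1) / (N - p) := by
      rw [critExp]; field_simp; ring
    rw [hκ, radialSpeed_eq hN hr, sobolevVar, sobolevFactor,
      Real.mul_rpow (by positivity) (by positivity), Real.mul_rpow (by positivity) (by positivity),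
      ← Real.rpow_natCast, natCast_sub_one hN, ← Real.rpow_mul hω.le, ← Real.rpow_mul hr.le,
      mul_one]
    set a := (p - 1) / ((N : ℝ) - p)
    have e1 : sphereArea N = sphereArea N ^ (-(p / (N - p))) * sphereArea N ^ (-(1 / (p - 1))) /
        sphereArea N ^ (-(1 / (p - 1)) * (p * (N - 1) / (N - p))) := by
      rw [← Real.rpow_add hω, ← Real.rpow_sub hω]
      nth_rewrite 1 [← Real.rpow_one (sphereArea N)]
      congr 1
      field_simp; ring
    have e2 : r ^ ((N : ℝ) - 1) = r ^ (-(((N : ℝ) - 1) / (p - 1))) /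
        r ^ (-((N - p) / (p - 1)) * (p * (N - 1) / (N - p))) := by
      rw [← Real.rpow_sub hr]
      congr 1
      field_simp; ring
    rw [e2]
    nth_rewrite 1 [e1]
    have p1 : a ^ (p * ((N : ℝ) - 1) / (N - p)) ≠ 0 := by positivity
    field_simp

theorem critHardyMass_eq (hN : 2 ≤ N) {u : E N → ℝ} {v : ℝ → ℝ} (hv : Measurable v)
    (hu : ∀ᵐ x ∂(volume.restrict (unitBall N)), u x = v (moserVar N ‖x‖)) (q : ℝ) :
    critHardyMass q u = ENNReal.ofReal (sphereArea N ^ (1 - q / N)) * blissMass N q v := by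
  have hN0 : 0 < N := by omega
  have hNr : (0 : ℝ) < N := by exact_mod_cast hN0
  have h3 : (0 : ℝ) < N - 1 := by
    have : (2 : ℝ) ≤ N := by exact_mod_cast hN
    linarith
  have hω := sphereArea_pos hN0
  rw [critHardyMass, ← (isRadialVar_moserVar hN).lintegral_mass (q := q)
    (m := fun r => (r ^ N * Real.log (1 / r) ^ (1 + q * (((N : ℝ) - 1) / N)))⁻¹) hN0
    measurableSet_Iio (Ω := unitBall N) (fun x => mem_ball_zero_iff) hv ?_
    (Real.rpow_nonneg hω.le _) hu ?_]
  · rfl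
  · exact ((measurable_id.pow_const N).mul ((Real.measurable_log.comp
      (measurable_const.div measurable_id)).pow_const _)).inv
  · rintro r ⟨hr1, hr : 0 < r⟩
    have hlog : 0 < Real.log (1 / r) := by
      refine Real.log_pos ?_
      rw [lt_div_iff₀ hr, one_mul]
      exact hr1
    rw [radialSpeed_eq hN0 hr, div_self h3.ne', Real.rpow_neg_one, moserVar,
      Real.mul_rpow (by positivity) hlog.le, ← Real.rpow_mul hω.le]
    have e1 : sphereArea N = sphereArea N ^ (1 - q / N) * sphereArea N ^ (-(1 / ((N : ℝ) - 1))) /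
        sphereArea N ^ (-(1 / ((N : ℝ) - 1)) * (1 + q * (((N : ℝ) - 1) / N))) := by
      rw [← Real.rpow_add hω, ← Real.rpow_sub hω]
      nth_rewrite 1 [← Real.rpow_one (sphereArea N)]
      congr 1
      field_simp; ring
    have e2 : r ^ N = r ^ (N - 1) * r := by rw [← pow_succ, Nat.sub_add_cancel hN0]
    rw [e2]
    nth_rewrite 1 [e1]
    have p1 : Real.log (1 / r) ^ (1 + q * (((N : ℝ) - 1) / N)) ≠ 0 := by positivity
    field_simp

theorem BlissAdmissible.mul_blissMass_rpow_le (hp : 1 < p) (hpq : p < q) {v : ℝ → ℝ}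
    (hv : BlissAdmissible p v) :
    ENNReal.ofReal (blissConst p q ^ p) * blissMass p q v ^ (p / q) ≤ blissEnergy p v := by
  have h0 : 0 < p := by linarith
  have := ENNReal.rpow_le_rpow (hv.blissInequality hp hpq) h0.le
  rw [ENNReal.mul_rpow_of_nonneg _ _ h0.le, ← ENNReal.rpow_mul, ← ENNReal.rpow_mul,
    ENNReal.ofReal_rpow_of_nonneg (blissConst_pos hp hpq).le h0.le, one_div_mul_cancel h0.ne',
    ENNReal.rpow_one] at this
  convert this using 3
  ring

theorem BlissAdmissible.mul_rpow_le (hp : 1 < p) (hpq : p < q) {v : ℝ → ℝ}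
    (hv : BlissAdmissible p v) {S c : ℝ} (hS : 0 ≤ S) (hc : 0 ≤ c)
    (hSc : S * c ^ (p / q) = blissConst p q ^ p) :
    ENNReal.ofReal S * (ENNReal.ofReal c * blissMass p q v) ^ (p / q) ≤ blissEnergy p v := by
  have h0 : 0 < p / q := div_pos (by linarith) (by linarith)
  rw [ENNReal.mul_rpow_of_nonneg _ _ h0.le, ← mul_assoc, ENNReal.ofReal_rpow_of_nonneg hc h0.le,
    ← ENNReal.ofReal_mul hS, hSc]
  exact hv.mul_blissMass_rpow_le hp hpq

theorem sobolevConst_pos (hp : 1 < p) (hpN : p < N) : 0 < sobolevConst N p := by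
  have h3 : 0 < p - 1 := by linarith
  have h4 : 0 < N - p := by linarith
  have h5 : (0 : ℝ) < N := by linarith
  have g1 : 0 < Real.Gamma (N / p) := Real.Gamma_pos_of_pos (by positivity)
  have g2 : 0 < Real.Gamma (1 + N - N / p) := Real.Gamma_pos_of_pos (by
    have : (N : ℝ) / p < N := div_lt_self h5 hp
    linarith)
  have g3 : 0 < Real.Gamma (1 + (N : ℝ) / 2) := Real.Gamma_pos_of_pos (by positivity)
  have g4 : 0 < Real.Gamma N := Real.Gamma_pos_of_pos h5
  have := Real.pi_pos
  rw [sobolevConst]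
  positivity

/-- At `q = p^*` the Gamma arguments become `N/p`, `1 + N - N/p` and `N`. The explicit sphere area
supplies `π` and `Γ(1 + N/2)`. -/
theorem sobolevConst_mul_sobolevFactor_rpow (hp : 1 < p) (hpN : p < N) :
    sobolevConst N p * sobolevFactor N p ^ (p / critExp N p) = blissConst p (critExp N p) ^ p := by
  have hN : 0 < N := by exact_mod_cast (by linarith : (0 : ℝ) < N)
  have h0 : 0 < p := by linarith
  have h3 : 0 < p - 1 := by linarith
  have h4 : 0 < N - p := by linarith
  have h5 : (0 : ℝ) < N := by linarith
  have g1 : 0 < Real.Gamma (N / p) := Real.Gamma_pos_of_pos (by positivity)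
  have g2 : 0 < Real.Gamma (1 + N - N / p) := Real.Gamma_pos_of_pos (by
    have : (N : ℝ) / p < N := div_lt_self h5 hp
    linarith)
  have g3 : 0 < Real.Gamma (1 + (N : ℝ) / 2) := Real.Gamma_pos_of_pos (by positivity)
  have g4 : 0 < Real.Gamma N := Real.Gamma_pos_of_pos h5
  have hπ := Real.pi_pos
  have e0 : critExp N p - p = p ^ 2 / (N - p) := by rw [critExp]; field_simp; ring
  have e1 : critExp N p / (critExp N p - p) = N / p := by
    rw [e0, critExp]; field_simp
  have e2 : p * (critExp N p - 1) / (critExp N p - p) = 1 + N - N / p := by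
    rw [e0, critExp]; field_simp; ring
  have e3 : p * critExp N p / (critExp N p - p) = N := by
    rw [e0, critExp]; field_simp
  have e4 : 1 / p - 1 / critExp N p = 1 / N := by rw [critExp]; field_simp; ring
  have e5 : p / critExp N p = (N - p) / N := by rw [critExp]; field_simp
  have e6 : critExp N p * (p - 1) / p = N * ((p - 1) / (N - p)) := by rw [critExp]; field_simp
  have e7 : 1 / critExp N p = (N - p) / (N * p) := by rw [critExp]; field_simp
  rw [blissConst, e1, e2, e3, e4, e5, e6, e7, sobolevConst, sobolevFactor, sphereArea_eq hN,
    show ((N : ℝ) - p) / (p - 1) = ((p - 1) / (N - p))⁻¹ by rw [inv_div]]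
  have ha : 0 < (p - 1) / (N - p) := by positivity
  set a := (p - 1) / ((N : ℝ) - p) with hadef
  generalize Real.Gamma (N / p) = A at *
  generalize Real.Gamma (1 + N - N / p) = B at *
  generalize Real.Gamma (1 + (N : ℝ) / 2) = C at *
  generalize Real.Gamma N = D at *
  -- The Gamma values and `a` are independent symbols by now, so after taking logarithms only their
  -- exponents are compared.
  refine Real.log_injOn_pos (mem_Ioi.2 (by positivity)) (mem_Ioi.2 (by positivity)) ?_
  simp (disch := positivity) only [Real.log_mul, Real.log_rpow, Real.log_div, Real.log_inv]
  field_simp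
  ring

theorem critHardyConst_mul_rpow (hN : 0 < N) (hq : (N : ℝ) < q) :
    critHardyConst N q * (sphereArea N ^ (1 - q / N)) ^ ((N : ℝ) / q) = blissConst N q ^ (N : ℝ) := by
  have hNr : (0 : ℝ) < N := by exact_mod_cast hN
  have h1 : (1 : ℝ) ≤ N := by exact_mod_cast hN
  have hω := sphereArea_pos hN
  have hq0 : 0 < q := by linarith
  have hqN : 0 < q - N := by linarith
  have g1 : 0 < Real.Gamma (q / (q - N)) := Real.Gamma_pos_of_pos (by positivity)
  have g2 : 0 < Real.Gamma (N * (q - 1) / (q - N)) := Real.Gamma_pos_of_pos (by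
    have : 0 < q - 1 := by linarith
    positivity)
  have g3 : 0 < Real.Gamma (N * q / (q - N)) := Real.Gamma_pos_of_pos (by positivity)
  have hB : 0 ≤ q * ((N : ℝ) - 1) / N := by
    have : (0 : ℝ) ≤ N - 1 := by linarith
    positivity
  rw [critHardyConst, blissConst, Real.mul_rpow (by positivity) (by positivity),
    ← Real.rpow_mul hω.le, ← Real.rpow_mul (by positivity), ← Real.rpow_mul hB,
    mul_right_comm, mul_right_comm (sphereArea N ^ _), ← Real.rpow_add hω]
  have e1 : 1 - N / q + (1 - q / N) * (N / q) = 0 := by field_simp; ring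
  have e2 : (1 / (N : ℝ) - 1 / q) * N = 1 - N / q := by field_simp
  have e3 : 1 / q * (N : ℝ) = N / q := by ring
  rw [e1, e2, e3, Real.rpow_zero, one_mul]

theorem critHardyConst_pos (hN : 2 ≤ N) (hq : (N : ℝ) < q) : 0 < critHardyConst N q := by
  have hN0 : 0 < N := by omega
  have h2 : (2 : ℝ) ≤ N := by exact_mod_cast hN
  have h := critHardyConst_mul_rpow hN0 hq
  have h1 : 0 < blissConst N q ^ (N : ℝ) := Real.rpow_pos_of_pos (blissConst_pos (by linarith) hq) _
  rw [← h] at h1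
  exact pos_of_mul_pos_left h1 (by have := sphereArea_pos hN0; positivity)

theorem MemHomSobolevRad.exists_sobolevVar (hp : 1 < p) (hpN : p < N) {u : E N → ℝ}
    {G : E N → E N} (h : MemHomSobolevRad p univ u G) :
    ∃ v : ℝ → ℝ, BlissAdmissible p v ∧ (∀ᵐ x : E N, u x = v (sobolevVar N p ‖x‖)) ∧
      gradEnergy p univ G = blissEnergy p v ∧
      sobolevMass p u = ENNReal.ofReal (sobolevFactor N p) * blissMass p (critExp N p) v := by
  have hN : 0 < N := by exact_mod_cast (by linarith : (0 : ℝ) < N)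
  obtain ⟨v, hv, hvm, hu, hE⟩ := h.exists_blissAdmissible hN hp isOpen_univ (by simp)
    (fun a ha => tailWeight_univ_lt_top hp hpN ha) (isRadialVar_sobolevVar hp hpN)
  rw [Measure.restrict_univ] at hu
  exact ⟨v, hv, hu, hE, sobolevMass_eq hp hpN hvm hu⟩

theorem MemHomSobolevRad.exists_moserVar (hN : 2 ≤ N) {u : E N → ℝ} {G : E N → E N}
    (h : MemHomSobolevRad N (unitBall N) u G) :
    ∃ v : ℝ → ℝ, BlissAdmissible N v ∧
      (∀ᵐ x ∂(volume.restrict (unitBall N)), u x = v (moserVar N ‖x‖)) ∧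
      gradEnergy N (unitBall N) G = blissEnergy N v ∧
      ∀ q : ℝ, (N : ℝ) < q → critHardyMass q u =
        ENNReal.ofReal (sphereArea N ^ (1 - q / N)) * blissMass N q v := by
  have h2 : (2 : ℝ) ≤ N := by exact_mod_cast hN
  obtain ⟨v, hv, hvm, hu, hE⟩ := h.exists_blissAdmissible (by omega) (by linarith) isOpen_Iio
    (fun x => mem_ball_zero_iff) (fun a ha => tailWeight_Iio_lt_top ha) (isRadialVar_moserVar hN)
  exact ⟨v, hv, hu, hE, fun q _ => critHardyMass_eq hN hvm hu q⟩

theorem MemHomSobolevRad.sobolev_inequality (hp : 1 < p) (hpN : p < N) {u : E N → ℝ}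
    {G : E N → E N} (h : MemHomSobolevRad p univ u G) :
    ENNReal.ofReal (sobolevConst N p) * sobolevMass p u ^ (p / critExp N p) ≤
      gradEnergy p univ G := by
  obtain ⟨v, hv, -, hE, hM⟩ := h.exists_sobolevVar hp hpN
  rw [hE, hM]
  exact hv.mul_rpow_le hp (lt_critExp hp hpN) (sobolevConst_pos hp hpN).le
    (sobolevFactor_pos hp hpN).le (sobolevConst_mul_sobolevFactor_rpow hp hpN)

theorem MemHomSobolevRad.critHardy_inequality (hN : 2 ≤ N) (hq : (N : ℝ) < q) {u : E N → ℝ}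
    {G : E N → E N} (h : MemHomSobolevRad N (unitBall N) u G) :
    ENNReal.ofReal (critHardyConst N q) * critHardyMass q u ^ ((N : ℝ) / q) ≤
      gradEnergy N (unitBall N) G := by
  have h2 : (2 : ℝ) ≤ N := by exact_mod_cast hN
  obtain ⟨v, hv, -, hE, hM⟩ := h.exists_moserVar hN
  rw [hE, hM q hq]
  have hω := sphereArea_pos (N := N) (by omega)
  exact hv.mul_rpow_le (by linarith) hq (critHardyConst_pos hN hq).le
    (by positivity) (critHardyConst_mul_rpow (by omega) hq)

end

/-! ### Sharpness of the radial Sobolev inequality -/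

section

variable {N : ℕ} {p q : ℝ}

/-- The extremal function of the Bliss inequality. -/
def extremal (p q t : ℝ) : ℝ := t * (1 + t ^ ((q - p) / p)) ^ (-(1 / ((q - p) / p)))

/-- The derivative of the extremal function of the Bliss inequality. -/
def extremalSlope (p q t : ℝ) : ℝ := (1 + t ^ ((q - p) / p)) ^ (-(1 / ((q - p) / p)) - 1)

theorem extremalSlope_pos {t : ℝ} (ht : 0 ≤ t) : 0 < extremalSlope p q t :=
  Real.rpow_pos_of_pos (by positivity) _

theorem extremal_nonneg {t : ℝ} (ht : 0 ≤ t) : 0 ≤ extremal p q t :=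
  mul_nonneg ht (Real.rpow_nonneg (by positivity) _)

theorem extremal_le (hp : 0 < p) (hpq : p < q) {t : ℝ} (ht : 0 ≤ t) : extremal p q t ≤ t := by
  have hr : 0 < (q - p) / p := div_pos (by linarith) hp
  refine mul_le_of_le_one_right ht (Real.rpow_le_one_of_one_le_of_nonpos ?_ ?_)
  · linarith [Real.rpow_nonneg ht ((q - p) / p)]
  · rw [neg_nonpos]; positivity

theorem measurable_extremal : Measurable (extremal p q) :=
  measurable_id.mul ((measurable_const.add (measurable_id.pow_const _)).pow_const _)

theorem hasDerivAt_extremal (hp : 0 < p) (hpq : p < q) {t : ℝ} (ht : 0 < t) :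
    HasDerivAt (extremal p q) (extremalSlope p q t) t := by
  have hr : 0 < (q - p) / p := div_pos (by linarith) hp
  unfold extremal extremalSlope
  set r := (q - p) / p
  have hpos : 0 < 1 + t ^ r := by positivity
  have h1 : HasDerivAt (fun t : ℝ => 1 + t ^ r) (r * t ^ (r - 1)) t :=
    (Real.hasDerivAt_rpow_const (Or.inl ht.ne')).const_add 1
  have h2 := (hasDerivAt_id t).mul (h1.rpow_const (p := -(1 / r)) (Or.inl hpos.ne'))
  refine h2.congr_deriv ?_
  have e1 : (1 + t ^ r) ^ (-(1 / r)) = (1 + t ^ r) ^ (-(1 / r) - 1) * (1 + t ^ r) := by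
    rw [← Real.rpow_add_one hpos.ne', sub_add_cancel]
  have e2 : t ^ r = t ^ (r - 1) * t := by rw [← Real.rpow_add_one ht.ne', sub_add_cancel]
  simp only [id]
  rw [e1]
  nth_rewrite 2 [e2]
  field_simp
  ring

theorem extremalSlope_rpow (hp : 0 < p) (hpq : p < q) {t : ℝ} (ht : 0 ≤ t) :
    extremalSlope p q t ^ p = extremalEnergyDensity p q t := by
  have hqp : 0 < q - p := by linarith
  rw [extremalSlope, extremalEnergyDensity, ← Real.rpow_mul (by positivity)]
  congr 1
  field_simp
  ring

theorem extremal_rpow_div (hp : 0 < p) (hpq : p < q) {t : ℝ} (ht : 0 < t) :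
    extremal p q t ^ q / t ^ (1 + q * ((p - 1) / p)) = extremalMassDensity p q t := by
  have hqp : 0 < q - p := by linarith
  rw [extremal, extremalMassDensity, Real.mul_rpow ht.le (Real.rpow_nonneg (by positivity) _),
    ← Real.rpow_mul (by positivity), mul_div_right_comm, ← Real.rpow_sub ht]
  congr 2
  · field_simp
    ring
  · ring

theorem blissMass_extremal (hp : 1 < p) (hpq : p < q) :
    blissMass p q (extremal p q) = ENNReal.ofReal (extremalMass p q) := by
  rw [← lintegral_extremalMassDensity hp hpq, blissMass]
  refine setLIntegral_congr_fun measurableSet_Ioi fun t ht => ?_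
  have ht : 0 < t := ht
  rw [abs_of_nonneg (extremal_nonneg ht.le), extremal_rpow_div (by linarith) hpq ht]

theorem exists_smooth_cutoff : ∃ χ : ℕ → ℝ → ℝ, (∀ n, ContDiff ℝ ∞ (χ n)) ∧
    (∀ n, HasCompactSupport (χ n)) ∧ (∀ n, tsupport (χ n) ⊆ Ioi 0) ∧
    (∀ n s, χ n s ∈ Icc (0 : ℝ) 1) ∧ ∀ s, 0 < s → ∀ᶠ n in atTop, χ n s = 1 := by
  have hn : ∀ n : ℕ, (0 : ℝ) < n + 2 := fun n => by positivity
  have hlt : ∀ n : ℕ, 2 / ((n : ℝ) + 2) < n + 2 := fun n => by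
    rw [div_lt_iff₀ (hn n)]
    nlinarith [Nat.cast_nonneg (α := ℝ) n]
  have hlt' : ∀ n : ℕ, 1 / ((n : ℝ) + 2) < 2 / (n + 2) := fun n =>
    div_lt_div_of_pos_right (by norm_num) (hn n)
  -- The centre is `n + 2`. The plateau starts at `2/(n + 2)` and the support at `1/(n + 2) > 0`, so
  -- the plateaus exhaust `(0, ∞)`.
  let b : ∀ n : ℕ, ContDiffBump ((n : ℝ) + 2) := fun n =>
    ⟨n + 2 - 2 / (n + 2), n + 2 - 1 / (n + 2), by linarith [hlt n], by linarith [hlt' n]⟩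
  refine ⟨fun n => b n, fun n => (b n).contDiff, fun n => (b n).hasCompactSupport, fun n => ?_,
    fun n s => ⟨(b n).nonneg, (b n).le_one⟩, fun s hs => ?_⟩
  · rw [(b n).tsupport_eq, Real.closedBall_eq_Icc]
    intro s hs
    have : 0 < 1 / ((n : ℝ) + 2) := by positivity
    have h1 := hs.1
    simp only [b] at h1
    simp only [mem_Ioi]
    linarith
  · filter_upwards [eventually_ge_atTop ⌈s⌉₊, eventually_ge_atTop ⌈2 / s⌉₊] with n h1 h2
    have h1 : s ≤ n := (Nat.le_ceil _).trans (by exact_mod_cast h1)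
    have h2 : 2 / s ≤ n := (Nat.le_ceil _).trans (by exact_mod_cast h2)
    have h3 : 2 / ((n : ℝ) + 2) ≤ s := by
      rw [div_le_iff₀ hs] at h2
      rw [div_le_iff₀ (hn n)]
      nlinarith
    refine (b n).one_of_mem_closedBall ?_
    rw [Real.closedBall_eq_Icc]
    simp only [b, mem_Icc]
    constructor <;> linarith [hlt n]

theorem contDiff_of_contDiffOn_of_tsupport_subset {f : ℝ → ℝ} {s : Set ℝ} (hs : IsOpen s)
    (hf : ContDiffOn ℝ ∞ f s) (hsub : tsupport f ⊆ s) : ContDiff ℝ ∞ f := by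
  refine contDiff_iff_contDiffAt.2 fun x => ?_
  by_cases hx : x ∈ s
  · exact hf.contDiffAt (hs.mem_nhds hx)
  · have : f =ᶠ[𝓝 x] fun _ => 0 := notMem_tsupport_iff_eventuallyEq.1 fun h => hx (hsub h)
    exact contDiffAt_const.congr_of_eventuallyEq this

theorem hasDerivAt_tailIntegral {γ : ℝ → ℝ} (hγ : Continuous γ) (hc : HasCompactSupport γ)
    (r : ℝ) : HasDerivAt (tailIntegral γ) (γ r) r := by
  have hi : Integrable γ := hγ.integrable_of_hasCompactSupport hc
  have h : ∀ s ∈ Ioo (r - 1) (r + 1), tailIntegral γ s =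
      tailIntegral γ (r - 1) + ∫ t in (r - 1)..s, γ t := by
    intro s hs
    rw [tailIntegral_eq_sub hi.integrableOn le_rfl hs.1.le]
    ring
  refine HasDerivAt.congr_of_eventuallyEq
    (f := fun s => tailIntegral γ (r - 1) + ∫ t in (r - 1)..s, γ t)
    ((hγ.integral_hasStrictDerivAt _ _).hasDerivAt.const_add _) ?_
  filter_upwards [Ioo_mem_nhds (show r - 1 < r by linarith) (show r < r + 1 by linarith)] using h

/-- Since `γ` vanishes near `0`, the function is constant near the origin and does not see the
singularity of the norm. It vanishes for large `|x|`. -/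
theorem isTestFunction_tailIntegral {γ : ℝ → ℝ} (hγ : ContDiff ℝ ∞ γ) (hc : HasCompactSupport γ)
    (hsub : tsupport γ ⊆ Ioi 0) : IsTestFunction univ fun x : E N => tailIntegral γ ‖x‖ := by
  have hd := hasDerivAt_tailIntegral hγ.continuous hc
  refine ⟨?_, ?_, subset_univ _⟩
  · have hsm : ContDiff ℝ ∞ (tailIntegral γ) := by
      refine contDiff_infty_iff_deriv.2 ⟨fun r => (hd r).differentiableAt, ?_⟩
      rwa [funext fun r => (hd r).deriv]
    refine contDiff_iff_contDiffAt.2 fun x => ?_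
    by_cases hx : x = 0
    · subst hx
      have h0 : γ =ᶠ[𝓝 0] fun _ => 0 :=
        notMem_tsupport_iff_eventuallyEq.1 fun h => lt_irrefl (0 : ℝ) (hsub h)
      obtain ⟨ε, hε, hball⟩ := Metric.eventually_nhds_iff_ball.1 h0
      refine contDiffAt_const (c := tailIntegral γ 0) |>.congr_of_eventuallyEq ?_
      filter_upwards [Metric.ball_mem_nhds (0 : E N) hε] with x hx
      have hxε : ‖x‖ < ε := mem_ball_zero_iff.1 hx
      rw [tailIntegral_eq_sub (hγ.continuous.integrable_of_hasCompactSupport hc).integrableOn le_rfl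
        (norm_nonneg x), intervalIntegral.integral_zero_ae, sub_zero]
      refine Eventually.of_forall fun t ht => hball t ?_
      rw [uIoc_of_le (norm_nonneg x)] at ht
      rw [mem_ball_zero_iff, Real.norm_eq_abs, abs_of_pos ht.1]
      exact ht.2.trans_lt hxε
    · exact hsm.contDiffAt.comp x (contDiffAt_norm ℝ hx)
  · obtain ⟨R, hR⟩ := hc.isCompact.isBounded.subset_closedBall 0
    refine HasCompactSupport.intro (isCompact_closedBall (0 : E N) R) fun x hx => ?_
    rw [mem_closedBall_zero_iff, not_le] at hx
    rw [tailIntegral, setIntegral_eq_zero_of_forall_eq_zero, neg_zero]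
    intro s hs
    refine image_eq_zero_of_notMem_tsupport fun h => ?_
    have := hR h
    rw [mem_closedBall_zero_iff, Real.norm_eq_abs] at this
    linarith [le_abs_self s, (mem_Ioi.1 hs)]

theorem IsTestFunction.memHomSobolev {Ω : Set (E N)} {φ : E N → ℝ} (hφ : IsTestFunction Ω φ) :
    MemHomSobolev p Ω φ (gradient φ) := by
  have hcs : HasCompactSupport (gradient φ) :=
    HasCompactSupport.intro hφ.compactSupport.isCompact fun x hx =>
      gradient_eq_zero_of_notMem_tsupport hx
  refine ⟨hφ.smooth.continuous.locallyIntegrable.locallyIntegrableOn _,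
    (continuous_gradient hφ.smooth).memLp_of_hasCompactSupport hcs, fun _ => φ, fun _ => hφ, ?_, ?_⟩
  · simp
  · simp

theorem contDiffOn_sobolevVar : ContDiffOn ℝ ∞ (sobolevVar N p) (Ioi 0) :=
  contDiffOn_const.mul (contDiffOn_id.rpow_const_of_ne fun _ hr => ne_of_gt hr)

theorem contDiffOn_radialSpeed (hN : 0 < N) : ContDiffOn ℝ ∞ (radialSpeed N p) (Ioi 0) :=
  (contDiffOn_const.mul (contDiffOn_id.pow _)).rpow_const_of_ne fun _ hr =>
    (mul_pos (sphereArea_pos hN) (pow_pos hr _)).ne'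

theorem contDiffOn_extremalSlope : ContDiffOn ℝ ∞ (extremalSlope p q) (Ioi 0) :=
  (contDiffOn_const.add (contDiffOn_id.rpow_const_of_ne fun _ hr => ne_of_gt hr)).rpow_const_of_ne
    fun t ht => by
      have ht : 0 < t := ht
      have : 0 < 1 + t ^ ((q - p) / p) := by positivity
      exact this.ne'

theorem tendsto_sobolevVar (hp : 1 < p) (hpN : p < N) :
    Tendsto (sobolevVar N p) atTop (𝓝 0) := by
  have := (tendsto_rpow_neg_atTop (y := (N - p) / (p - 1))
    (div_pos (by linarith) (by linarith))).const_mul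
      ((p - 1) / (N - p) * sphereArea N ^ (-(1 / (p - 1))))
  rwa [mul_zero] at this

/-- The radial derivative of the extremal function of the Sobolev inequality. -/
def sobolevSlope (N : ℕ) (p r : ℝ) : ℝ :=
  -(extremalSlope p (critExp N p) (sobolevVar N p r) * radialSpeed N p r)

/-- The extremal profile in the variable `r` is nonincreasing and tends to `0` at infinity. A
derivative of constant sign with such a limit is integrable. -/
theorem integrableOn_and_tailIntegral_sobolevSlope (hp : 1 < p) (hpN : p < N) {a : ℝ} (ha : 0 < a) :
    IntegrableOn (sobolevSlope N p) (Ioi a) ∧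
      tailIntegral (sobolevSlope N p) a = extremal p (critExp N p) (sobolevVar N p a) := by
  have hN : 0 < N := by exact_mod_cast (by linarith : (0 : ℝ) < N)
  have h0 : 0 < p := by linarith
  have hθ := isRadialVar_sobolevVar hp hpN
  have hJ : ∀ {r : ℝ}, 0 < r → r ∈ univ ∩ Ioi (0 : ℝ) := fun hr => ⟨mem_univ _, hr⟩
  have hpq := lt_critExp hp hpN
  have hd : ∀ r, 0 < r → HasDerivAt (fun r => extremal p (critExp N p) (sobolevVar N p r))
      (sobolevSlope N p r) r := fun r hr => by
    refine ((hasDerivAt_extremal h0 hpq (hθ.theta_pos (hJ hr))).comp r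
      (hθ.hasDerivAt r (hJ hr))).congr_deriv ?_
    rw [sobolevSlope]; ring
  have hneg : ∀ r ∈ Ioi a, sobolevSlope N p r ≤ 0 := fun r hr => by
    have hr0 : 0 < r := ha.trans hr
    rw [sobolevSlope, neg_nonpos]
    exact (mul_pos (extremalSlope_pos (hθ.theta_pos (hJ hr0)).le) (radialSpeed_pos hN hr0)).le
  have hlim : Tendsto (fun r => extremal p (critExp N p) (sobolevVar N p r)) atTop (𝓝 0) := by
    refine tendsto_of_tendsto_of_tendsto_of_le_of_le' tendsto_const_nhds
      (tendsto_sobolevVar hp hpN) ?_ ?_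
    · filter_upwards [eventually_gt_atTop 0] with r hr
      exact extremal_nonneg (hθ.theta_pos (hJ hr)).le
    · filter_upwards [eventually_gt_atTop 0] with r hr
      exact extremal_le h0 hpq (hθ.theta_pos (hJ hr)).le
  have hcont : ContinuousWithinAt (fun r => extremal p (critExp N p) (sobolevVar N p r))
      (Ici a) a := (hd a ha).continuousAt.continuousWithinAt
  have hd' : ∀ r ∈ Ioi a, HasDerivAt (fun r => extremal p (critExp N p) (sobolevVar N p r))
      (sobolevSlope N p r) r := fun r hr => hd r (ha.trans hr)
  refine ⟨integrableOn_Ioi_deriv_of_nonpos hcont hd' hneg hlim, ?_⟩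
  rw [tailIntegral, integral_Ioi_of_hasDerivAt_of_nonpos hcont hd' hneg hlim]
  ring

/-- The best constant of the radial Sobolev inequality cannot be improved. -/
theorem le_sobolevConst (hp : 1 < p) (hpN : p < N) {S : ℝ}
    (hS : ∀ (u : E N → ℝ) (G : E N → E N), MemHomSobolevRad p univ u G →
      ENNReal.ofReal S * sobolevMass p u ^ (p / critExp N p) ≤ gradEnergy p univ G) :
    S ≤ sobolevConst N p := by
  -- For `S ≤ 0`, `ENNReal.ofReal` truncates to zero and the hypothesis is empty. The claim then
  -- holds by positivity of the constant.
  rcases le_or_gt S 0 with hS0 | hS0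
  · exact hS0.trans (sobolevConst_pos hp hpN).le
  have hN : 0 < N := by exact_mod_cast (by linarith : (0 : ℝ) < N)
  have h0 : 0 < p := by linarith
  have hθ := isRadialVar_sobolevVar hp hpN
  have hJ : ∀ {r : ℝ}, 0 < r → r ∈ univ ∩ Ioi (0 : ℝ) := fun hr => ⟨mem_univ _, hr⟩
  have hpq := lt_critExp hp hpN
  set q := critExp N p with hq
  have hq0 : 0 < q := h0.trans hpq
  obtain ⟨χ, hχs, hχc, hχsub, hχ01, hχ1⟩ := exists_smooth_cutoff
  -- The slope is cut off, not the function. No derivative of `χ n` appears, and the energy stays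
  -- below the extremal energy.
  set γ : ℕ → ℝ → ℝ := fun n => χ n * sobolevSlope N p with hγ
  have hγsub : ∀ n, tsupport (γ n) ⊆ Ioi 0 := fun n =>
    (tsupport_mul_subset_left (f := χ n) (g := sobolevSlope N p)).trans (hχsub n)
  have hγc : ∀ n, HasCompactSupport (γ n) := fun n => (hχc n).mul_right
  have hslope : ContDiffOn ℝ ∞ (sobolevSlope N p) (Ioi 0) :=
    ((contDiffOn_extremalSlope.comp contDiffOn_sobolevVar fun r hr =>
      hθ.theta_pos (hJ hr)).mul (contDiffOn_radialSpeed hN)).neg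
  have hγs : ∀ n, ContDiff ℝ ∞ (γ n) := fun n =>
    contDiff_of_contDiffOn_of_tsupport_subset isOpen_Ioi ((hχs n).contDiffOn.mul hslope) (hγsub n)
  have hγ0 : ∀ n r, r ∉ univ ∩ Ioi (0 : ℝ) → γ n r = 0 := fun n r hr =>
    image_eq_zero_of_notMem_tsupport fun h => hr (hJ (hγsub n h))
  set φ : ℕ → E N → ℝ := fun n x => tailIntegral (γ n) ‖x‖ with hφ
  have hφt : ∀ n, IsTestFunction univ (φ n) := fun n =>
    isTestFunction_tailIntegral (hγs n) (hγc n) (hγsub n)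
  have henergy : ∀ n, gradEnergy p univ (gradient (φ n)) ≤
      ENNReal.ofReal (extremalEnergy p q) := by
    intro n
    have hG : ∀ᵐ x ∂(volume.restrict (univ : Set (E N))),
        gradient (φ n) x = γ n ‖x‖ • (‖x‖⁻¹ • x) := by
      rw [Measure.restrict_univ]
      filter_upwards [ae_ne_zero hN] with x hx
      exact (hasGradientAt_comp_norm hx
        (hasDerivAt_tailIntegral (hγs n).continuous (hγc n) _)).gradient
    rw [gradEnergy_eq hN MeasurableSet.univ (by simp) h0 (hγs n).continuous.measurable (by simp) hG,
      ← hθ.lintegral_lineDerivative hN hp (hγ0 n), ← lintegral_extremalEnergyDensity hp hpq]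
    refine setLIntegral_mono' measurableSet_Ioi fun t ht => ?_
    obtain ⟨r, hr, rfl⟩ := hθ.image_eq.superset ht
    have hθr := hθ.theta_pos hr
    have hk := radialSpeed_pos (p := p) hN hr.2
    rw [hθ.lineDerivative_apply _ hr, ← extremalSlope_rpow h0 hpq hθr.le]
    refine ENNReal.ofReal_le_ofReal (Real.rpow_le_rpow (abs_nonneg _) ?_ h0.le)
    have e : -(γ n r / radialSpeed N p r) = χ n r * extremalSlope p q (sobolevVar N p r) := by
      simp only [hγ, Pi.mul_apply, sobolevSlope]
      field_simp
      simp [hq]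
    have hs := extremalSlope_pos (p := p) (q := q) hθr.le
    rw [e, abs_of_nonneg (mul_nonneg (hχ01 n r).1 hs.le)]
    exact mul_le_of_le_one_left hs.le (hχ01 n r).2
  have hconv : ∀ x : E N, x ≠ 0 → Tendsto (fun n => φ n x) atTop
      (𝓝 (extremal p q (sobolevVar N p ‖x‖))) := by
    intro x hx
    obtain ⟨hi, ht⟩ := integrableOn_and_tailIntegral_sobolevSlope (N := N) hp hpN (norm_pos_iff.2 hx)
    rw [← ht]
    refine (tendsto_integral_of_dominated_convergence (fun r => ‖sobolevSlope N p r‖)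
      (fun n => (hγs n).continuous.aestronglyMeasurable) hi.norm (fun n => ?_) ?_).neg
    · refine Eventually.of_forall fun r => ?_
      simp only [hγ, Pi.mul_apply, norm_mul]
      refine mul_le_of_le_one_left (norm_nonneg _) ?_
      rw [Real.norm_eq_abs, abs_of_nonneg (hχ01 n r).1]
      exact (hχ01 n r).2
    · filter_upwards [ae_restrict_mem measurableSet_Ioi] with r hr
      refine tendsto_const_nhds.congr' ?_
      filter_upwards [hχ1 r ((norm_nonneg x).trans_lt hr)] with n hn
      simp [hγ, hn]
  have hfatou := mul_lintegral_rpow_le_of_tendsto (μ := (volume : Measure (E N)))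
    (f := fun n x => ENNReal.ofReal (|φ n x| ^ q))
    (F := fun x => ENNReal.ofReal (|extremal p q (sobolevVar N p ‖x‖)| ^ q))
    (c := ENNReal.ofReal S) (a := p / q) (E := fun _ => ENNReal.ofReal (extremalEnergy p q))
    (div_pos h0 hq0) (by simpa using hS0) ENNReal.ofReal_ne_top
    (fun n => (((hφt n).smooth.continuous.measurable.norm.pow_const q).ennreal_ofReal).aemeasurable)
    (by
      filter_upwards [ae_ne_zero hN] with x hx
      exact ENNReal.tendsto_ofReal ((hconv x hx).abs.rpow_const (Or.inr hq0.le)))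
    (fun n => (hS (φ n) (gradient (φ n)) ⟨(hφt n).memHomSobolev, tailIntegral (γ n),
      Eventually.of_forall fun x => rfl⟩).trans (henergy n))
    tendsto_const_nhds
  have hmass := sobolevMass_eq (N := N) hp hpN (measurable_extremal (p := p) (q := q))
    (u := fun x => extremal p q (sobolevVar N p ‖x‖)) (Eventually.of_forall fun x => rfl)
  rw [sobolevMass, ← hq] at hmass
  have hM := extremalMass_pos hp hpq
  have hE := extremalEnergy_pos hp hpq
  have hF := sobolevFactor_pos hp hpN
  have hpq' : 0 < p / q := div_pos h0 hq0
  rw [hmass, blissMass_extremal hp hpq, ← ENNReal.ofReal_mul hF.le,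
    ENNReal.ofReal_rpow_of_nonneg (by positivity) hpq'.le, ← ENNReal.ofReal_mul hS0.le,
    ENNReal.ofReal_le_ofReal_iff hE.le] at hfatou
  -- Equality for the extremal function expresses its energy through the Sobolev constant and its
  -- mass, so the common positive factors cancel.
  have hb := congrArg (· ^ p) (blissConst_mul_extremalMass hp hpq)
  rw [Real.mul_rpow (blissConst_pos hp hpq).le (by positivity), ← Real.rpow_mul hM.le,
    ← Real.rpow_mul hE.le, one_div_mul_cancel h0.ne', Real.rpow_one,
    ← sobolevConst_mul_sobolevFactor_rpow hp hpN, ← hq, one_div_mul_eq_div] at hb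
  rw [← hb, Real.mul_rpow hF.le hM.le, ← mul_assoc] at hfatou
  exact le_of_mul_le_mul_right (le_of_mul_le_mul_right hfatou (by positivity)) (by positivity)

end

/-! ### The limit of the generalized critical Hardy inequality -/

section

/-- Restrict the Gamma integral to `t > y`, where `t^y ≥ y^y`. -/
theorem rpow_mul_exp_neg_le_Gamma {y : ℝ} (hy : 0 < y) :
    y ^ y * Real.exp (-y) ≤ Real.Gamma (y + 1) := by
  have hint := Real.GammaIntegral_convergent (s := y + 1) (by positivity)
  rw [Real.Gamma_eq_integral (by positivity)]
  simp only [add_sub_cancel_right] at hint ⊢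
  calc y ^ y * Real.exp (-y) = ∫ t in Ioi y, Real.exp (-t) * y ^ y := by
        rw [integral_mul_const, integral_exp_neg_Ioi, mul_comm]
    _ ≤ ∫ t in Ioi y, Real.exp (-t) * t ^ y := by
        refine setIntegral_mono_on ?_ (hint.mono_set (Ioi_subset_Ioi hy.le)) measurableSet_Ioi
          fun t ht => ?_
        · exact (integrableOn_exp_neg_Ioi y).mul_const _
        · exact mul_le_mul_of_nonneg_left (Real.rpow_le_rpow hy.le (le_of_lt ht) hy.le)
            (Real.exp_pos _).le
    _ ≤ _ := by
        refine setIntegral_mono_set hint ?_ (Ioi_subset_Ioi hy.le).eventuallyLE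
        filter_upwards [ae_restrict_mem measurableSet_Ioi] with t ht
        exact mul_nonneg (Real.exp_pos _).le (Real.rpow_nonneg (le_of_lt ht) _)

/-- The factor `t^y e^(-θt)` is maximal at `t = y/θ`, and the remaining `e^(-(1-θ)t)` integrates to
`1/(1 - θ)`. -/
theorem Gamma_le_rpow_mul_exp_neg {y θ : ℝ} (hy : 0 < y) (hθ : 0 < θ) (hθ1 : θ < 1) :
    Real.Gamma (y + 1) ≤ (y / θ) ^ y * Real.exp (-y) * (1 - θ)⁻¹ := by
  have hint := Real.GammaIntegral_convergent (s := y + 1) (by positivity)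
  rw [Real.Gamma_eq_integral (by positivity)]
  simp only [add_sub_cancel_right] at hint ⊢
  have hneg : θ - 1 < 0 := by linarith
  calc ∫ t in Ioi 0, Real.exp (-t) * t ^ y
      ≤ ∫ t in Ioi 0, (y / θ) ^ y * Real.exp (-y) * Real.exp ((θ - 1) * t) := by
        refine setIntegral_mono_on hint ((integrableOn_exp_mul_Ioi hneg 0).const_mul _)
          measurableSet_Ioi fun t ht => ?_
        have ht : 0 < t := ht
        rw [Real.rpow_def_of_pos ht, Real.rpow_def_of_pos (by positivity), ← Real.exp_add,
          ← Real.exp_add, ← Real.exp_add, Real.exp_le_exp]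
        have h1 := Real.log_le_sub_one_of_pos (show 0 < t / (y / θ) by positivity)
        rw [Real.log_div ht.ne' (by positivity)] at h1
        have h2 : t / (y / θ) * y = θ * t := by field_simp
        nlinarith
    _ = _ := by
        rw [integral_const_mul, integral_exp_mul_Ioi hneg]
        congr 1
        rw [mul_zero, Real.exp_zero, neg_div, ← div_neg, neg_sub, one_div]

/-- First-order Stirling. The two Gamma bounds, the upper one with `θ = (y - 1)/y`, enclose the
expression between `-(log y)/y` and `1/(y - 1)`. -/
theorem tendsto_log_Gamma_div :
    Tendsto (fun y => Real.log (Real.Gamma y) / y - Real.log y + 1) atTop (𝓝 0) := by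
  have h1 : Tendsto (fun y : ℝ => -(Real.log y / y)) atTop (𝓝 0) := by
    simpa using (Real.isLittleO_log_id_atTop.tendsto_div_nhds_zero).neg
  have h2 : Tendsto (fun y : ℝ => (y - 1)⁻¹) atTop (𝓝 0) :=
    tendsto_inv_atTop_zero.comp (tendsto_atTop_add_const_right _ _ tendsto_id)
  refine tendsto_of_tendsto_of_tendsto_of_le_of_le' h1 h2 ?_ ?_
  · filter_upwards [eventually_gt_atTop 1] with y hy
    have hy0 : 0 < y := by linarith
    have hΓ := Real.Gamma_pos_of_pos hy0
    have h := Real.log_le_log (by positivity) (rpow_mul_exp_neg_le_Gamma hy0)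
    rw [Real.Gamma_add_one hy0.ne', Real.log_mul (by positivity) (by positivity),
      Real.log_mul hy0.ne' hΓ.ne', Real.log_exp, Real.log_rpow hy0] at h
    have e : Real.log (Real.Gamma y) / y - Real.log y + 1 =
        (Real.log (Real.Gamma y) - y * Real.log y + y) / y := by field_simp
    rw [e, ← neg_div]
    gcongr
    linarith
  · filter_upwards [eventually_gt_atTop 1] with y hy
    have hy0 : 0 < y := by linarith
    have hy1 : 0 < y - 1 := by linarith
    have hΓ := Real.Gamma_pos_of_pos hy0
    have h := Real.log_le_log (Real.Gamma_pos_of_pos (by positivity)) (Gamma_le_rpow_mul_exp_neg hy0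
      (show 0 < (y - 1) / y by positivity) (by rw [div_lt_one hy0]; linarith))
    have e1 : y / ((y - 1) / y) = y * (y / (y - 1)) := by field_simp
    have e2 : (1 - (y - 1) / y)⁻¹ = y := by field_simp; ring
    have h3 := Real.log_le_sub_one_of_pos (show 0 < y / (y - 1) by positivity)
    have e3 : y / (y - 1) - 1 = (y - 1)⁻¹ := by field_simp; ring
    rw [e1, e2, Real.Gamma_add_one hy0.ne', Real.log_mul (by positivity) (by positivity),
      Real.log_mul (by positivity) (by positivity), Real.log_mul (by positivity) (by positivity),
      Real.log_exp, Real.log_rpow (by positivity), Real.log_mul (by positivity) (by positivity)] at h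
    rw [e3] at h3
    have e : Real.log (Real.Gamma y) / y - Real.log y + 1 =
        (Real.log (Real.Gamma y) - y * Real.log y + y) / y := by field_simp
    rw [e, div_le_iff₀ hy0]
    nlinarith [mul_le_mul_of_nonneg_left h3 hy0.le]

theorem log_Gamma_term {y w q : ℝ} (hw : 0 < w) (hq : 0 < q) {ε : ℝ} (hε : 0 < ε)
    (hy : y = w / ε) :
    ε / q * Real.log (Real.Gamma y) = w / q *
      (Real.log (Real.Gamma y) / y - Real.log y + 1) + w / q * (Real.log w - Real.log ε - 1) := by
  have hy0 : 0 < y := by rw [hy]; positivity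
  have e1 : Real.log y = Real.log w - Real.log ε := by rw [hy, Real.log_div hw.ne' hε.ne']
  rw [e1]
  have e2 : Real.log (Real.Gamma y) / y = Real.log (Real.Gamma y) * ε / w := by
    rw [hy]; field_simp
  rw [e2]
  field_simp
  ring

/-- Each Gamma argument is `w/(q - N)` with `w` equal to `q`, `N(q - 1)` or `Nq`. Their signed sum
is `q - N`, so the divergent `log(q - N)` survives only with the factor `(q - N)/q` and disappears
in the limit. -/
theorem tendsto_log_gammaRatio {N : ℝ} (hN : 1 < N) :
    Tendsto (fun q : ℝ => (1 - N / q) * Real.log (Real.Gamma (q / (q - N)) *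
      Real.Gamma (N * (q - 1) / (q - N)) / Real.Gamma (N * q / (q - N)))) (𝓝[>] N)
      (𝓝 ((N - 1) * Real.log (N - 1) - N * Real.log N)) := by
  have hN0 : 0 < N := by linarith
  set l : ℝ → ℝ := fun y => Real.log (Real.Gamma y) / y - Real.log y + 1 with hl
  have hid : Tendsto (fun q : ℝ => q) (𝓝[>] N) (𝓝 N) := tendsto_id.mono_left nhdsWithin_le_nhds
  have hε0 : Tendsto (fun q : ℝ => q - N) (𝓝[>] N) (𝓝 0) := by
    simpa using hid.sub_const N
  have hε : Tendsto (fun q : ℝ => q - N) (𝓝[>] N) (𝓝[>] 0) :=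
    tendsto_nhdsWithin_iff.2 ⟨hε0, by
      filter_upwards [self_mem_nhdsWithin] with q hq
      exact sub_pos.2 (mem_Ioi.1 hq)⟩
  have hlε : Tendsto (fun q : ℝ => Real.log (q - N) * (q - N)) (𝓝[>] N) (𝓝 0) :=
    by simpa [Function.comp_def] using
      (tendsto_log_mul_rpow_nhdsGT_zero (r := 1) one_pos).comp hε
  have hinv : Tendsto (fun q : ℝ => (q - N)⁻¹) (𝓝[>] N) atTop := tendsto_inv_nhdsGT_zero.comp hε
  have hL : ∀ {w : ℝ → ℝ} {w₀ : ℝ}, 0 < w₀ → Tendsto w (𝓝[>] N) (𝓝 w₀) →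
      Tendsto (fun q => w q / q * l (w q / (q - N))) (𝓝[>] N) (𝓝 0) := by
    intro w w₀ hw₀ hw
    have h1 : Tendsto (fun q => w q / (q - N)) (𝓝[>] N) atTop :=
      Tendsto.pos_mul_atTop hw₀ hw hinv
    simpa using (hw.div hid hN0.ne').mul (tendsto_log_Gamma_div.comp h1)
  have w2 : Tendsto (fun q : ℝ => N * (q - 1)) (𝓝[>] N) (𝓝 (N * (N - 1))) :=
    (hid.sub_const 1).const_mul N
  have w3 : Tendsto (fun q : ℝ => N * q) (𝓝[>] N) (𝓝 (N * N)) := hid.const_mul N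
  have hN1 : 0 < N - 1 := by linarith
  have p2 : 0 < N * (N - 1) := by positivity
  have p3 : 0 < N * N := by positivity
  have hmain : Tendsto (fun q : ℝ => (q / q * l (q / (q - N)) +
      N * (q - 1) / q * l (N * (q - 1) / (q - N)) - N * q / q * l (N * q / (q - N))) +
      (Real.log q + N * (q - 1) / q * Real.log (N * (q - 1)) - N * Real.log (N * q) -
        Real.log (q - N) * (q - N) / q - (q - N) / q)) (𝓝[>] N)
      (𝓝 ((0 + 0 - 0) + (Real.log N + N * (N - 1) / N * Real.log (N * (N - 1)) -
        N * Real.log (N * N) - 0 / N - 0 / N))) :=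
    (((hL hN0 hid).add (hL p2 w2)).sub (hL p3 w3)).add
      (((((hid.log hN0.ne').add ((w2.div hid hN0.ne').mul (w2.log p2.ne'))).sub
        ((w3.log p3.ne').const_mul N)).sub (hlε.div hid hN0.ne')).sub (hε0.div hid hN0.ne'))
  have e : (0 + 0 - 0) + (Real.log N + N * (N - 1) / N * Real.log (N * (N - 1)) -
        N * Real.log (N * N) - 0 / N - 0 / N) = (N - 1) * Real.log (N - 1) - N * Real.log N := by
    rw [Real.log_mul hN0.ne' hN1.ne', Real.log_mul hN0.ne' hN0.ne']
    field_simp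
    ring
  rw [e] at hmain
  refine hmain.congr' ?_
  filter_upwards [self_mem_nhdsWithin] with q hq
  have hq : N < q := hq
  have hq0 : 0 < q := by linarith
  have hq1 : 0 < q - 1 := by linarith
  have hqN : 0 < q - N := by linarith
  have g1 : 0 < Real.Gamma (q / (q - N)) := Real.Gamma_pos_of_pos (by positivity)
  have g2 : 0 < Real.Gamma (N * (q - 1) / (q - N)) := Real.Gamma_pos_of_pos (by positivity)
  have g3 : 0 < Real.Gamma (N * q / (q - N)) := Real.Gamma_pos_of_pos (by positivity)
  have key : (1 - N / q) * Real.log (Real.Gamma (q / (q - N)) *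
      Real.Gamma (N * (q - 1) / (q - N)) / Real.Gamma (N * q / (q - N))) =
      (q - N) / q * Real.log (Real.Gamma (q / (q - N))) +
      (q - N) / q * Real.log (Real.Gamma (N * (q - 1) / (q - N))) -
      (q - N) / q * Real.log (Real.Gamma (N * q / (q - N))) := by
    rw [Real.log_div (by positivity) (by positivity), Real.log_mul g1.ne' g2.ne']
    field_simp
  rw [key, log_Gamma_term hq0 hq0 hqN rfl,
    log_Gamma_term (w := N * (q - 1)) (by positivity) hq0 hqN rfl,
    log_Gamma_term (w := N * q) (by positivity) hq0 hqN rfl]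
  have hl' : ∀ y, Real.log (Real.Gamma y) / y - Real.log y + 1 = l y := fun _ => rfl
  simp only [hl']
  generalize l (q / (q - N)) = l₁
  generalize l (N * (q - 1) / (q - N)) = l₂
  generalize l (N * q / (q - N)) = l₃
  generalize Real.log (q - N) = a
  generalize Real.log (N * (q - 1)) = b
  generalize Real.log (N * q) = c
  field_simp
  ring

theorem tendsto_critHardyConst {N : ℕ} (hN : 2 ≤ N) :
    Tendsto (fun q : ℝ => critHardyConst N q) (𝓝[>] (N : ℝ)) (𝓝 ((((N : ℝ) - 1) / N) ^ N)) := by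
  have h2 : (2 : ℝ) ≤ N := by exact_mod_cast hN
  have hN0 : (0 : ℝ) < N := by linarith
  have hN1 : (0 : ℝ) < N - 1 := by linarith
  have hω := sphereArea_pos (N := N) (by omega)
  have hid : Tendsto (fun q : ℝ => q) (𝓝[>] (N : ℝ)) (𝓝 N) :=
    tendsto_id.mono_left nhdsWithin_le_nhds
  have hNq : Tendsto (fun q : ℝ => (N : ℝ) / q) (𝓝[>] (N : ℝ)) (𝓝 1) := by
    have := (tendsto_const_nhds (x := (N : ℝ))).div hid hN0.ne'
    rwa [div_self hN0.ne'] at this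
  have h1 : Tendsto (fun q : ℝ => sphereArea N ^ (1 - N / q)) (𝓝[>] (N : ℝ)) (𝓝 1) := by
    simpa using (tendsto_const_nhds (x := sphereArea N)).rpow (hNq.const_sub 1) (Or.inl hω.ne')
  have h3 : Tendsto (fun q : ℝ => (q * (N - 1) / N) ^ (N / q)) (𝓝[>] (N : ℝ)) (𝓝 (N - 1)) := by
    have := ((hid.mul_const ((N : ℝ) - 1)).div_const (N : ℝ)).rpow hNq (Or.inr one_pos)
    rwa [mul_div_cancel_left₀ _ hN0.ne', Real.rpow_one] at this
  have hA := (Real.continuous_exp.tendsto _).comp (tendsto_log_gammaRatio (N := (N : ℝ))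
    (by linarith))
  have hlim := (h1.mul hA).mul h3
  have e : 1 * Real.exp ((N - 1) * Real.log (N - 1) - N * Real.log N) * ((N : ℝ) - 1) =
      (((N : ℝ) - 1) / N) ^ N := by
    rw [div_pow, one_mul, Real.exp_sub, ← Real.rpow_natCast, ← Real.rpow_natCast,
      Real.rpow_def_of_pos hN0, mul_comm (Real.log (N : ℝ)), div_mul_eq_mul_div]
    congr 1
    rw [← Real.log_rpow hN1, Real.exp_log (by positivity), ← Real.rpow_add_one hN1.ne',
      sub_add_cancel]
  rw [e] at hlim
  refine hlim.congr' ?_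
  filter_upwards [self_mem_nhdsWithin] with q hq
  have hq : (N : ℝ) < q := hq
  have hq0 : 0 < q := by linarith
  have hq1 : 0 < q - 1 := by linarith
  have hqN : 0 < q - N := by linarith
  have g1 : 0 < Real.Gamma (q / (q - N)) := Real.Gamma_pos_of_pos (by positivity)
  have g2 : 0 < Real.Gamma (N * (q - 1) / (q - N)) := Real.Gamma_pos_of_pos (by positivity)
  have g3 : 0 < Real.Gamma (N * q / (q - N)) := Real.Gamma_pos_of_pos (by positivity)
  rw [critHardyConst, Function.comp_apply]
  congr 2
  rw [Real.rpow_def_of_pos (by positivity), mul_comm]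

theorem MemHomSobolev.gradEnergy_lt_top {N : ℕ} {p : ℝ} (hp : 0 < p) {Ω : Set (E N)} {u : E N → ℝ}
    {G : E N → E N} (h : MemHomSobolev p Ω u G) : gradEnergy p Ω G < ⊤ := by
  have := h.gradient_memLp.2
  rw [eLpNorm_lt_top_iff_lintegral_rpow_enorm_lt_top (by simpa using hp) ENNReal.ofReal_ne_top,
    ENNReal.toReal_ofReal hp.le] at this
  refine lt_of_eq_of_lt (lintegral_congr fun x => ?_) this
  rw [← ENNReal.ofReal_rpow_of_nonneg (norm_nonneg _) hp.le, ofReal_norm]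

/-- The critical Hardy inequality for radial functions. -/
theorem MemHomSobolevRad.critHardy_limit {N : ℕ} (hN : 2 ≤ N) {u : E N → ℝ} {G : E N → E N}
    (h : MemHomSobolevRad N (unitBall N) u G) :
    ENNReal.ofReal ((((N : ℝ) - 1) / N) ^ N) * ∫⁻ x in unitBall N, ENNReal.ofReal
      (|u x| ^ N / (‖x‖ ^ N * Real.log (1 / ‖x‖) ^ N)) ≤ gradEnergy N (unitBall N) G := by
  have h2 : (2 : ℝ) ≤ N := by exact_mod_cast hN
  have hN0 : (0 : ℝ) < N := by linarith
  have hN1 : (0 : ℝ) < N - 1 := by linarith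
  have hC : 0 < (((N : ℝ) - 1) / N) ^ N := by positivity
  have hEfin := (h.1.gradEnergy_lt_top hN0).ne
  set e := (gradEnergy N (unitBall N) G).toReal with he
  -- Exponents decreasing to `N`: the inequality holds for each, and Fatou needs a sequence.
  set s : ℕ → ℝ := fun n => N + 1 / ((n : ℝ) + 1) with hs
  have hsN : ∀ n, (N : ℝ) < s n := fun n => by
    have : (0 : ℝ) < 1 / ((n : ℝ) + 1) := by positivity
    simp only [hs]; linarith
  have hslim : Tendsto s atTop (𝓝 N) := by
    have := (tendsto_one_div_add_atTop_nhds_zero_nat (𝕜 := ℝ)).const_add (N : ℝ)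
    rwa [add_zero] at this
  have hslim' : Tendsto s atTop (𝓝[>] (N : ℝ)) :=
    tendsto_nhdsWithin_iff.2 ⟨hslim, Eventually.of_forall hsN⟩
  have hum : AEMeasurable u (volume.restrict (unitBall N)) :=
    h.1.locallyIntegrableOn.aestronglyMeasurable.aemeasurable
  have hbound : ∀ n, critHardyMass (s n) u ≤
      ENNReal.ofReal ((e / critHardyConst N (s n)) ^ (s n / N)) := by
    intro n
    have hCn := critHardyConst_pos hN (hsN n)
    have hsn : 0 < s n := hN0.trans (hsN n)
    have h3 := h.critHardy_inequality hN (hsN n)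
    rw [← ENNReal.ofReal_toReal hEfin, ← he, mul_comm, ← ENNReal.le_div_iff_mul_le
      (Or.inl (by simpa using hCn)) (Or.inl ENNReal.ofReal_ne_top),
      ← ENNReal.ofReal_div_of_pos hCn] at h3
    have h4 := ENNReal.rpow_le_rpow h3 (show 0 ≤ s n / N by positivity)
    rwa [← ENNReal.rpow_mul, div_mul_div_cancel₀ hsn.ne', div_self hN0.ne', ENNReal.rpow_one,
      ENNReal.ofReal_rpow_of_nonneg (by positivity) (by positivity)] at h4
  have hlim : Tendsto (fun n => ENNReal.ofReal ((e / critHardyConst N (s n)) ^ (s n / N))) atTop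
      (𝓝 (ENNReal.ofReal (e / (((N : ℝ) - 1) / N) ^ N))) := by
    refine ENNReal.tendsto_ofReal ?_
    have := ((tendsto_const_nhds (x := e)).div ((tendsto_critHardyConst hN).comp hslim') hC.ne').rpow
      (hslim.div_const (N : ℝ)) (Or.inr (by rw [div_self hN0.ne']; exact one_pos))
    rwa [div_self hN0.ne', Real.rpow_one] at this
  have hfatou := mul_lintegral_rpow_le_of_tendsto (μ := volume.restrict (unitBall N))
    (f := fun n x => ENNReal.ofReal (|u x| ^ s n / (‖x‖ ^ N *
      Real.log (1 / ‖x‖) ^ (1 + s n * (((N : ℝ) - 1) / N)))))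
    (F := fun x => ENNReal.ofReal (|u x| ^ N / (‖x‖ ^ N * Real.log (1 / ‖x‖) ^ N)))
    (c := 1) (a := 1) one_pos one_ne_zero ENNReal.one_ne_top ?_ ?_
    (fun n => by rw [one_mul, ENNReal.rpow_one]; exact hbound n) hlim
  · rw [one_mul, ENNReal.rpow_one] at hfatou
    calc _ ≤ ENNReal.ofReal ((((N : ℝ) - 1) / N) ^ N) *
          ENNReal.ofReal (e / (((N : ℝ) - 1) / N) ^ N) := by gcongr
      _ = gradEnergy N (unitBall N) G := by
          rw [← ENNReal.ofReal_mul hC.le, mul_div_cancel₀ _ hC.ne', he,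
            ENNReal.ofReal_toReal hEfin]
  · intro n
    have hnm : Measurable fun x : E N => ‖x‖ := measurable_norm
    exact ((hum.norm.pow_const (s n)).div ((hnm.pow_const N).mul ((Real.measurable_log.comp
      (measurable_const.div hnm)).pow_const _)).aemeasurable).ennreal_ofReal
  · filter_upwards [ae_restrict_mem measurableSet_ball,
      ae_restrict_of_ae (ae_ne_zero (N := N) (by omega))] with x hx hx0
    have hx0 : 0 < ‖x‖ := norm_pos_iff.2 hx0
    have hlog : 0 < Real.log (1 / ‖x‖) := by
      refine Real.log_pos ?_
      rw [lt_div_iff₀ hx0, one_mul]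
      exact mem_ball_zero_iff.1 hx
    refine ENNReal.tendsto_ofReal ?_
    have t1 : Tendsto (fun n => |u x| ^ s n) atTop (𝓝 (|u x| ^ N)) := by
      rw [← Real.rpow_natCast]
      exact tendsto_const_nhds.rpow hslim (Or.inr hN0)
    have t2 : Tendsto (fun n => Real.log (1 / ‖x‖) ^ (1 + s n * (((N : ℝ) - 1) / N))) atTop
        (𝓝 (Real.log (1 / ‖x‖) ^ N)) := by
      -- The exponent of the logarithm tends to `1 + (N - 1) = N`.
      have := (hslim.mul_const (((N : ℝ) - 1) / N)).const_add 1
      rw [mul_div_cancel₀ _ hN0.ne', add_sub_cancel] at this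
      rw [← Real.rpow_natCast]
      exact tendsto_const_nhds.rpow this (Or.inl hlog.ne')
    exact t1.div (t2.const_mul _) (by positivity)

end

end BlissHardy

end

/-! ### Assembly of the proposition. -/

theorem proposition5p5 :
    -- the Bliss inequality
    (∀ p q : ℝ, 1 < p → p < q → ∀ v : ℝ → ℝ,
      BlissHardy.BlissAdmissible p v → BlissHardy.BlissInequality p q v) ∧
    -- the radial Sobolev inequality: change of variables, inequality and best constant
    (∀ (N : ℕ) (p : ℝ), 1 < p → p < N →
      (∀ (u : BlissHardy.E N → ℝ) (G : BlissHardy.E N → BlissHardy.E N),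
        BlissHardy.MemHomSobolevRad p univ u G →
        ∃ v : ℝ → ℝ, BlissHardy.BlissAdmissible p v ∧
          (∀ᵐ x : BlissHardy.E N, u x = v (BlissHardy.sobolevVar N p ‖x‖)) ∧
          BlissHardy.gradEnergy p univ G = BlissHardy.blissEnergy p v ∧
          BlissHardy.sobolevMass p u =
            ENNReal.ofReal (BlissHardy.sobolevFactor N p) *
              BlissHardy.blissMass p (BlissHardy.critExp N p) v) ∧
      IsGreatest {S : ℝ | ∀ (u : BlissHardy.E N → ℝ) (G : BlissHardy.E N → BlissHardy.E N),
        BlissHardy.MemHomSobolevRad p univ u G →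
        ENNReal.ofReal S * BlissHardy.sobolevMass p u ^ (p / BlissHardy.critExp N p) ≤
          BlissHardy.gradEnergy p univ G}
        (BlissHardy.sobolevConst N p)) ∧
    -- the generalized critical Hardy inequality, and its limit as `q` decreases to `N`
    (∀ N : ℕ, 2 ≤ N →
      (∀ (u : BlissHardy.E N → ℝ) (G : BlissHardy.E N → BlissHardy.E N),
        BlissHardy.MemHomSobolevRad N (BlissHardy.unitBall N) u G →
        ∃ v : ℝ → ℝ, BlissHardy.BlissAdmissible N v ∧
          (∀ᵐ x ∂(volume.restrict (BlissHardy.unitBall N)),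
            u x = v (BlissHardy.moserVar N ‖x‖)) ∧
          BlissHardy.gradEnergy N (BlissHardy.unitBall N) G = BlissHardy.blissEnergy N v ∧
          ∀ q : ℝ, (N : ℝ) < q →
            BlissHardy.critHardyMass q u =
              ENNReal.ofReal (BlissHardy.sphereArea N ^ (1 - q / N)) *
                BlissHardy.blissMass N q v) ∧
      (∀ q : ℝ, (N : ℝ) < q →
        ∀ (u : BlissHardy.E N → ℝ) (G : BlissHardy.E N → BlissHardy.E N),
          BlissHardy.MemHomSobolevRad N (BlissHardy.unitBall N) u G →
          ENNReal.ofReal (BlissHardy.critHardyConst N q) *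
              BlissHardy.critHardyMass q u ^ ((N : ℝ) / q) ≤
            BlissHardy.gradEnergy N (BlissHardy.unitBall N) G) ∧
      Tendsto (fun q : ℝ => BlissHardy.critHardyConst N q) (𝓝[>] (N : ℝ))
        (𝓝 ((((N : ℝ) - 1) / N) ^ N)) ∧
      (∀ (u : BlissHardy.E N → ℝ) (G : BlissHardy.E N → BlissHardy.E N),
        BlissHardy.MemHomSobolevRad N (BlissHardy.unitBall N) u G →
        ENNReal.ofReal ((((N : ℝ) - 1) / N) ^ N) *
            ∫⁻ x in BlissHardy.unitBall N, ENNReal.ofReal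
              (|u x| ^ N / (‖x‖ ^ N * Real.log (1 / ‖x‖) ^ N)) ≤
          BlissHardy.gradEnergy N (BlissHardy.unitBall N) G)) := by
  refine ⟨fun p q hp hpq v hv => hv.blissInequality hp hpq, fun N p hp hpN =>
    ⟨fun u G h => h.exists_sobolevVar hp hpN, fun u G h => h.sobolev_inequality hp hpN,
      fun S hS => BlissHardy.le_sobolevConst hp hpN hS⟩, fun N hN =>
    ⟨fun u G h => h.exists_moserVar hN, fun q hq u G h => h.critHardy_inequality hN hq,
      BlissHardy.tendsto_critHardyConst hN, fun u G h => h.critHardy_limit hN⟩⟩
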